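/- **Setting.** For $\alpha,\beta\in\mathbb C$ let $\mathcal H(\alpha,\beta)$ be the Hilbert space with orthonormal basis $\Phi_\eta$ indexed by the multi-indices $\eta=(\eta_1,\eta_2,\dots)$, $\eta_i\in\mathbb N_0$, $\|\eta\|:=\sum_i i\,\eta_i<\infty$, and let $\mathcal F=\mathcal F(\alpha,\beta)$ be the linear span of the $\Phi_\eta$. For $k>0$ the closed operators $a_{\pm k}$ with domain $\{\sum_\eta c_\eta\Phi_\eta:\sum_\eta|c_\eta|^2(\eta_k+1)<\infty\}$ act by $a_k\Phi_\eta=\sqrt{k\eta_k}\,\Phi_{\eta-e_k}$, $a_{-k}\Phi_\eta=\sqrt{k(\eta_k+1)}\,\Phi_{\eta+e_k}$, and $a_0=\alpha$ on $\mathcal H(\alpha,\beta)$. The Virasoro operator $L_n=L_n(\alpha,\beta)$, $n\in\mathbb Z$, is the closure of the operator on $\mathcal F$ given by $\frac12\sum_{k\in\mathbb Z}a_{-k}a_{n+k}+n\beta a_n$ for $n\ne0$ and by $\frac12(\alpha^2-\beta^2)+\sum_{k\ge1}a_{-k}a_k$ for $n=0$. For $\omega=(\omega_k)_{k\in\mathbb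 Z\setminus\{0\}}\subset\mathbb C$ the vertex operator $$V(\omega)=\exp\Big(\sum_{n\ge1}\tfrac{\omega_n}{\sqrt n}a_{-n}\Big)\exp\Big(-\sum_{n\ge1}\tfrac{\omega_{-n}}{\sqrt n}a_n\Big)$$ is the matrix operator with matrix elements $v_{\eta,\nu}(\omega)=(\eta!\,\nu!)^{-1/2}\prod_i m_{\eta_i,\nu_i}(\omega_i,-\omega_{-i})$, where $m_{n,m}(x,y)=\sum_j\binom nj\binom mj j!\,x^{n-j}y^{m-j}$: $\Psi\in D(V(\omega))$ if the limits $\lim_{N\to\infty}\sum_{\|\nu\|\le N}v_{\eta,\nu}(\omega)\langle\Phi_\nu,\Psi\rangle$ exist for all $\eta$ and are square summable in $\eta$, and they are then the coefficients of $V(\omega)\Psi$. For $\gamma_1,\dots,\gamma_r\in\mathbb C$ and $z_i\neq0$, let $V(\gamma_1,\dots,\gamma_r;z_1,\dots,z_r)=V(\omega)$ with $\omega_k=|k|^{-1/2}\sum_i\gamma_iz_i^k$; for $r=1$ this is $V(\gamma,z)$. $T_\gamma:\mathcal H(\alpha,\beta)\to\mathcal H(\alpha+\gamma,\beta)$ is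 the unitary operator $\Phi_\eta\mapsto\Phi_\eta$. For an operator $P:\mathcal H(\alpha,\beta)\to\mathcal H(\alpha+\gamma,\beta)$ write $[L_n,P]=L_n(\alpha+\gamma,\beta)P-PL_n(\alpha,\beta)$. A relation holds strongly on $\mathcal F$ if for every $\Phi\in\mathcal F$ both sides, applied to $\Phi$, are defined (all vectors lie in the domains of the operators applied to them, series converge and derivatives exist in norm) and agree. **Theorem.** Let $\alpha,\beta\in\mathbb C$. 1. Let $\gamma\in\mathbb C$, $\sum_{k\ge1}k|\omega_k|<\infty$, and put $\theta_{k}=\sqrt{|k|}\,\omega_{k}$ $(k\ne0)$, $\theta_0=\gamma$. Then for all $n\in\mathbb Z$, strongly on $\mathcal F$, with $V=T_\gamma V(\omega)$, $$[L_n,V]=\sum_{k\ge1}\theta_{n+k}\,a_{-k}V+\sum_{k\ge1}\theta_{n-k}\,Va_k+\Big(\tfrac12\sum_{k=1}^{n-1}\theta_k\theta_{n-k}+\theta_n(\alpha+\gamma+n\beta)\Big)V ,$$ where for $n\le0$ the sum $\sum_{k=1}^{n-1}$ means $-\sum_{k=n}^{0}$. 2. Let $r\in\mathbb N_0$, $\gamma_1,\dots,\gamma_r\in\mathbb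 C$, $\Phi\in\mathcal F$. Then $V(\gamma_1,\dots,\gamma_r;z_1,\dots,z_r)\Phi$ is holomorphic in $(z_1,\dots,z_r)$ on $\{0<|z_i|<1\ \forall i\}$, and there, for every $j$, with $V=V(\gamma_1,\dots,\gamma_r;z_1,\dots,z_r)$, $$z_j\frac{\partial}{\partial z_j}V\Phi=\gamma_j\sum_{k\ge1}z_j^k\,a_{-k}V\Phi+\gamma_j\sum_{k\ge1}z_j^{-k}\,Va_k\Phi .$$ 3. Let $\gamma\in\mathbb C$. For $0<|z|<1$ and every local branch of $z^{\gamma(\alpha-\beta)}$ (given by a continuous branch of $\log z$ on an open set) the operator $F(z)=T_\gamma z^{\gamma(\alpha-\beta)}V(\gamma,z)$ satisfies, strongly on $\mathcal F$, for all $n\in\mathbb Z$, $$[L_n,F(z)]=z^n\Big\{z\frac{\partial}{\partial z}+(n+1)\Big(\frac{\gamma^2}2+\beta\gamma\Big)\Big\}F(z);$$ that is, $F$ is a conformal field of weight $\gamma^2/2+\beta\gamma$. 4. Let $r\in\mathbb N_0$, $\gamma_1,\dots,\gamma_r,\lambda\in\mathbb C$, $T=T_{\gamma_1+\dots+\gamma_r}$,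 $V=V(\gamma_1,\dots,\gamma_r;z_1,\dots,z_r)$ and $F_\lambda=\prod_{i<j}(z_i-z_j)^{\gamma_i\gamma_j}\prod_iz_i^{\lambda\gamma_i}$, for any local branch given by continuous branches of $\log(z_i-z_j)$ $(i<j)$ and of $\log z_i$ on an open subset of $\{0<|z_i|<1,\ z_i\ne z_j\ (i\neq j)\}$. Then, strongly on $\mathcal F$, for all $n\in\mathbb Z$, $$[L_n,F_\lambda TV]=\sum_{j=1}^rz_j^n\Big\{z_j\frac{\partial}{\partial z_j}+(n+1)\frac{\gamma_j^2}2+n\beta\gamma_j+\gamma_j\Big(a_0-\sum_{i=1}^r\gamma_i-\lambda\Big)\Big\}F_\lambda TV .$$ -/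

import Mathlib

open Filter Topology

noncomputable section

namespace VertexOp

/-! ### Multi-indices and Fock spaces -/

/-- Multi-indices `η = (η₁, η₂, …)` with finitely many non-zero entries. -/
abbrev MultiIndex : Type := ℕ+ →₀ ℕ

/-- The degree `‖η‖ = ∑ i η_i`. -/
def level (η : MultiIndex) : ℕ := η.sum fun i m => (i : ℕ) * m

/-- `η! = ∏ η_i!`. -/
def mfact (η : MultiIndex) : ℕ := η.prod fun _ m => m.factorial

theorem finite_level_le (N : ℕ) : {η : MultiIndex | level η ≤ N}.Finite := by
  classical
  refine Set.Finite.subset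
    (Finset.finite_toSet
      ((Finset.Icc (1 : ℕ+) N.succPNat).finsupp fun _ => Finset.range (N + 1))) ?_
  intro η hη
  have key : ∀ i ∈ η.support, (i : ℕ) * η i ≤ N := fun i hi =>
    (Finset.single_le_sum (f := fun i : ℕ+ => (i : ℕ) * η i)
      (fun _ _ => Nat.zero_le _) hi).trans hη
  have hval : ∀ i, η i ≤ N := by
    intro i
    by_cases hi : i ∈ η.support
    · exact (Nat.le_mul_of_pos_left _ i.pos).trans (key i hi)
    · simp [Finsupp.notMem_support_iff.1 hi]
  refine Finset.mem_coe.2 (Finset.mem_finsupp_iff.2 ⟨fun i hi => ?_, fun i _ => ?_⟩)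
  · refine Finset.mem_Icc.2 ⟨one_le (a := i), ?_⟩
    rw [← PNat.coe_le_coe, Nat.succPNat_coe]
    have h0 : 0 < η i := Nat.pos_of_ne_zero (Finsupp.mem_support_iff.1 hi)
    exact ((Nat.le_mul_of_pos_right _ h0).trans (key i hi)).trans (Nat.le_succ N)
  · exact Finset.mem_range.2 (Nat.lt_succ_of_le (hval i))

/-- The Fock space `H(α, β)`: a Hilbert space with an orthonormal basis indexed by multi-indices.
As Hilbert spaces all the `H(α, β)` agree; the parameters only enter in the action of `a₀` and of
the Virasoro operators. -/
abbrev FockSpace (_α _β : ℂ) : Type := lp (fun _ : MultiIndex => ℂ) 2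

/-- The orthonormal basis vectors `Φ_η`. -/
def basisVec (α β : ℂ) (η : MultiIndex) : FockSpace α β := lp.single 2 η (1 : ℂ)

/-- The dense subspace `F(α, β)`, the linear span of the vectors `Φ_η`. -/
def finiteSpace (α β : ℂ) : Submodule ℂ (FockSpace α β) :=
  Submodule.span ℂ (Set.range (basisVec α β))

/-- The value of a partially defined operator, extended by `0` outside of its domain. -/
def ev {E E' : Type*} [AddCommGroup E] [Module ℂ E] [AddCommGroup E'] [Module ℂ E']
    (A : E →ₗ.[ℂ] E') (x : E) : E' :=
  open Classical in if h : x ∈ A.domain then A ⟨x, h⟩ else 0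

theorem ev_of_mem {E E' : Type*} [AddCommGroup E] [Module ℂ E] [AddCommGroup E'] [Module ℂ E']
    (A : E →ₗ.[ℂ] E') {x : E} (h : x ∈ A.domain) : ev A x = A ⟨x, h⟩ := dif_pos h

/-! ### The Heisenberg algebra -/

/-- The domain `{Ψ = ∑ c_η Φ_η : ∑ |c_η|² (η_k + 1) < ∞}` of `a_k` and of `a_{-k}`, `k > 0`. -/
def modeDomain (α β : ℂ) (k : ℕ+) : Submodule ℂ (FockSpace α β) where
  carrier := {Ψ | Summable fun η : MultiIndex => ((η k : ℝ) + 1) * ‖Ψ η‖ ^ 2}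
  zero_mem' := by simp [summable_zero]
  add_mem' := by
    intro x y hx hy
    refine Summable.of_nonneg_of_le (fun η => by positivity) (fun η => ?_)
      ((hx.add hy).mul_left 2)
    have h1 : ‖(x + y) η‖ ≤ ‖x η‖ + ‖y η‖ := norm_add_le _ _
    have h2 : ‖(x + y) η‖ ^ 2 ≤ 2 * (‖x η‖ ^ 2 + ‖y η‖ ^ 2) := by
      nlinarith [norm_nonneg ((x + y) η), sq_nonneg (‖x η‖ - ‖y η‖), norm_nonneg (x η),
        norm_nonneg (y η)]
    have h3 : (0 : ℝ) ≤ (η k : ℝ) + 1 := by positivity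
    nlinarith [mul_le_mul_of_nonneg_left h2 h3]
  smul_mem' := by
    intro c x hx
    refine (hx.mul_left (‖c‖ ^ 2)).congr fun η => ?_
    have : ‖(c • x) η‖ = ‖c‖ * ‖x η‖ := norm_mul c (x η)
    rw [this]; ring

theorem memlp_two {f : MultiIndex → ℂ} (h : Summable fun η => ‖f η‖ ^ 2) : Memℓp f 2 :=
  memℓp_gen (h.congr fun η => by simp)

theorem memlp_annihilation {α β : ℂ} {k : ℕ+} {Ψ : FockSpace α β} (h : Ψ ∈ modeDomain α β k) :
    Memℓp (fun μ : MultiIndex =>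
      ((√((k : ℝ) * ((μ k : ℝ) + 1)) : ℝ) : ℂ) * Ψ (μ + Finsupp.single k 1)) 2 := by
  refine memlp_two ?_
  have hinj : Function.Injective fun μ : MultiIndex => μ + Finsupp.single k 1 :=
    add_left_injective _
  refine Summable.of_nonneg_of_le (fun η => by positivity) (fun μ => ?_)
    ((h.comp_injective hinj).mul_left (k : ℝ))
  have hk : (0 : ℝ) ≤ (k : ℝ) := by positivity
  rw [norm_mul, Complex.norm_real, Real.norm_eq_abs, mul_pow, sq_abs,
    Real.sq_sqrt (by positivity)]
  simp only [Function.comp, Finsupp.add_apply, Finsupp.single_eq_same, Nat.cast_add, Nat.cast_one]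
  rw [mul_assoc]
  gcongr
  linarith

theorem memlp_creation {α β : ℂ} {k : ℕ+} {Ψ : FockSpace α β} (h : Ψ ∈ modeDomain α β k) :
    Memℓp (fun μ : MultiIndex =>
      ((√((k : ℝ) * (μ k : ℝ)) : ℝ) : ℂ) * Ψ (μ - Finsupp.single k 1)) 2 := by
  refine memlp_two ?_
  have hinj : Function.Injective fun μ : MultiIndex => μ + Finsupp.single k 1 :=
    add_left_injective _
  refine (hinj.summable_iff ?_).1 ?_
  · intro μ hμ
    have : μ k = 0 := by
      by_contra hne
      refine hμ ⟨μ - Finsupp.single k 1, ?_⟩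
      exact tsub_add_cancel_of_le (Finsupp.single_le_iff.2 (Nat.pos_of_ne_zero hne))
    simp [this]
  · refine (Summable.mul_left (k : ℝ) h).congr fun μ => ?_
    simp only [Function.comp]
    rw [add_tsub_cancel_right, norm_mul, Complex.norm_real, Real.norm_eq_abs, mul_pow, sq_abs,
      Real.sq_sqrt (by positivity)]
    simp only [Finsupp.add_apply, Finsupp.single_eq_same, Nat.cast_add, Nat.cast_one]
    ring

/-- The closed operator `a_k`, `k > 0`, in coordinates; `a_k Φ_η = √(k η_k) Φ_{η - e_k}`. -/
def annihilation (α β : ℂ) (k : ℕ+) : FockSpace α β →ₗ.[ℂ] FockSpace α β where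
  domain := modeDomain α β k
  toFun :=
    { toFun := fun Ψ => ⟨fun μ : MultiIndex => ((√((k : ℝ) * ((μ k : ℝ) + 1)) : ℝ) : ℂ) *
        (Ψ : FockSpace α β) (μ + Finsupp.single k 1), memlp_annihilation Ψ.2⟩
      map_add' := fun _ _ => lp.ext (funext fun _ => mul_add _ _ _)
      map_smul' := fun _ _ => lp.ext (funext fun _ => mul_left_comm _ _ _) }

/-- The closed operator `a_{-k}`, `k > 0`, in coordinates;
`a_{-k} Φ_η = √(k (η_k + 1)) Φ_{η + e_k}`. -/
def creation (α β : ℂ) (k : ℕ+) : FockSpace α β →ₗ.[ℂ] FockSpace α β where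
  domain := modeDomain α β k
  toFun :=
    { toFun := fun Ψ => ⟨fun μ : MultiIndex => ((√((k : ℝ) * (μ k : ℝ)) : ℝ) : ℂ) *
        (Ψ : FockSpace α β) (μ - Finsupp.single k 1), memlp_creation Ψ.2⟩
      map_add' := fun _ _ => lp.ext (funext fun _ => mul_add _ _ _)
      map_smul' := fun _ _ => lp.ext (funext fun _ => mul_left_comm _ _ _) }

/-- The operators `a_n`, `n ∈ ℤ`, of the Heisenberg algebra on `H(α, β)`; `a₀ = α`. -/
def mode (α β : ℂ) : ℤ → (FockSpace α β →ₗ.[ℂ] FockSpace α β)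
  | Int.ofNat 0 => (α • LinearMap.id : FockSpace α β →ₗ[ℂ] FockSpace α β).toPMap ⊤
  | Int.ofNat (m + 1) => annihilation α β m.succPNat
  | Int.negSucc m => creation α β m.succPNat

theorem basisVec_mem_modeDomain (α β : ℂ) (k : ℕ+) (η : MultiIndex) :
    basisVec α β η ∈ modeDomain α β k := by
  classical
  refine summable_of_ne_finset_zero (s := {η}) fun μ hμ => ?_
  have : basisVec α β η μ = 0 := by
    simp only [basisVec]
    exact lp.single_apply_ne 2 η _ (by simpa using hμ)
  simp [this]

theorem annihilation_basisVec (α β : ℂ) (k : ℕ+) (η : MultiIndex) :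
    annihilation α β k ⟨basisVec α β η, basisVec_mem_modeDomain α β k η⟩ =
      ((√((k : ℝ) * (η k : ℝ)) : ℝ) : ℂ) • basisVec α β (η - Finsupp.single k 1) := by
  classical
  refine lp.ext (funext fun μ => ?_)
  change ((√((k : ℝ) * ((μ k : ℝ) + 1)) : ℝ) : ℂ) * (Pi.single η (1 : ℂ) : MultiIndex → ℂ)
      (μ + Finsupp.single k 1) = ((√((k : ℝ) * (η k : ℝ)) : ℝ) : ℂ) *
      (Pi.single (η - Finsupp.single k 1) (1 : ℂ) : MultiIndex → ℂ) μ
  by_cases h0 : η k = 0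
  · have : μ + Finsupp.single k 1 ≠ η := by
      rintro rfl; simp at h0
    simp [h0, Pi.single_eq_of_ne this]
  · have hle : Finsupp.single k 1 ≤ η := Finsupp.single_le_iff.2 (Nat.pos_of_ne_zero h0)
    by_cases h : μ + Finsupp.single k 1 = η
    · subst h; simp
    · have h' : μ ≠ η - Finsupp.single k 1 := by
        rintro rfl; exact h (tsub_add_cancel_of_le hle)
      simp [Pi.single_eq_of_ne h, Pi.single_eq_of_ne h']

theorem creation_basisVec (α β : ℂ) (k : ℕ+) (η : MultiIndex) :
    creation α β k ⟨basisVec α β η, basisVec_mem_modeDomain α β k η⟩ =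
      ((√((k : ℝ) * ((η k : ℝ) + 1)) : ℝ) : ℂ) • basisVec α β (η + Finsupp.single k 1) := by
  classical
  refine lp.ext (funext fun μ => ?_)
  change ((√((k : ℝ) * (μ k : ℝ)) : ℝ) : ℂ) * (Pi.single η (1 : ℂ) : MultiIndex → ℂ)
      (μ - Finsupp.single k 1) = ((√((k : ℝ) * ((η k : ℝ) + 1)) : ℝ) : ℂ) *
      (Pi.single (η + Finsupp.single k 1) (1 : ℂ) : MultiIndex → ℂ) μ
  by_cases h : μ = η + Finsupp.single k 1
  · subst h; simp
  · rw [Pi.single_eq_of_ne h]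
    by_cases h0 : μ k = 0
    · simp [h0]
    · have : μ - Finsupp.single k 1 ≠ η := by
        rintro rfl
        exact h (tsub_add_cancel_of_le
          (Finsupp.single_le_iff.2 (Nat.pos_of_ne_zero h0))).symm
      simp [Pi.single_eq_of_ne this]

theorem basisVec_mem_mode_domain (α β : ℂ) : ∀ (n : ℤ) (η : MultiIndex),
    basisVec α β η ∈ (mode α β n).domain
  | Int.ofNat 0, _ => Submodule.mem_top
  | Int.ofNat (_ + 1), η => basisVec_mem_modeDomain α β _ η
  | Int.negSucc _, η => basisVec_mem_modeDomain α β _ η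

theorem finiteSpace_le_mode_domain (α β : ℂ) (n : ℤ) :
    finiteSpace α β ≤ (mode α β n).domain :=
  Submodule.span_le.2 (by rintro _ ⟨η, rfl⟩; exact basisVec_mem_mode_domain α β n η)

theorem mode_basisVec_mem (α β : ℂ) : ∀ (n : ℤ) (η : MultiIndex),
    mode α β n ⟨basisVec α β η, basisVec_mem_mode_domain α β n η⟩ ∈ finiteSpace α β
  | Int.ofNat 0, η => Submodule.smul_mem _ α (Submodule.subset_span ⟨η, rfl⟩)
  | Int.ofNat (m + 1), η => by
      change annihilation α β m.succPNat ⟨basisVec α β η, basisVec_mem_modeDomain α β _ η⟩ ∈ _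
      rw [annihilation_basisVec]
      exact Submodule.smul_mem _ _ (Submodule.subset_span ⟨_, rfl⟩)
  | Int.negSucc m, η => by
      change creation α β m.succPNat ⟨basisVec α β η, basisVec_mem_modeDomain α β _ η⟩ ∈ _
      rw [creation_basisVec]
      exact Submodule.smul_mem _ _ (Submodule.subset_span ⟨_, rfl⟩)

theorem mode_mem (α β : ℂ) (n : ℤ) (x : FockSpace α β) (hx : x ∈ finiteSpace α β) :
    mode α β n ⟨x, finiteSpace_le_mode_domain α β n hx⟩ ∈ finiteSpace α β := by
  have : finiteSpace α β ≤ ((finiteSpace α β).comap (mode α β n).toFun).map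
      (mode α β n).domain.subtype := by
    refine Submodule.span_le.2 ?_
    rintro _ ⟨η, rfl⟩
    exact ⟨⟨_, basisVec_mem_mode_domain α β n η⟩, mode_basisVec_mem α β n η, rfl⟩
  obtain ⟨y, hy, rfl⟩ := this hx
  exact hy

/-- The restriction of `a_n` to the invariant subspace `F(α, β)`. -/
def modeF (α β : ℂ) (n : ℤ) : finiteSpace α β →ₗ[ℂ] finiteSpace α β where
  toFun := fun x => ⟨mode α β n ⟨x, finiteSpace_le_mode_domain α β n x.2⟩, mode_mem α β n x x.2⟩
  map_add' := fun x y => Subtype.ext ((mode α β n).map_add ⟨x, _⟩ ⟨y, _⟩)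
  map_smul' := fun c x => Subtype.ext ((mode α β n).map_smul c ⟨x, _⟩)

/-- `Φ_η` as an element of `F(α, β)`. -/
def basisF (α β : ℂ) (η : MultiIndex) : finiteSpace α β :=
  ⟨basisVec α β η, Submodule.subset_span ⟨η, rfl⟩⟩

theorem modeF_pos_basisF (α β : ℂ) (k : ℕ+) (η : MultiIndex) :
    modeF α β (k : ℤ) (basisF α β η) =
      ((√((k : ℝ) * (η k : ℝ)) : ℝ) : ℂ) • basisF α β (η - Finsupp.single k 1) := by
  obtain ⟨m, rfl⟩ : ∃ m : ℕ, k = m.succPNat := ⟨k.natPred, by simp⟩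
  exact Subtype.ext (annihilation_basisVec α β m.succPNat η)

theorem modeF_neg_basisF (α β : ℂ) (k : ℕ+) (η : MultiIndex) :
    modeF α β (-(k : ℤ)) (basisF α β η) =
      ((√((k : ℝ) * ((η k : ℝ) + 1)) : ℝ) : ℂ) • basisF α β (η + Finsupp.single k 1) := by
  obtain ⟨m, rfl⟩ : ∃ m : ℕ, k = m.succPNat := ⟨k.natPred, by simp⟩
  exact Subtype.ext (creation_basisVec α β m.succPNat η)

theorem finiteSpace_induction {α β : ℂ} {P : finiteSpace α β → Prop}
    (hb : ∀ η, P (basisF α β η)) (h0 : P 0) (ha : ∀ x y, P x → P y → P (x + y))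
    (hs : ∀ (c : ℂ) x, P x → P (c • x)) (x : finiteSpace α β) : P x := by
  obtain ⟨x, hx⟩ := x
  induction hx using Submodule.span_induction with
  | mem x h => obtain ⟨η, rfl⟩ := h; exact hb η
  | zero => exact h0
  | add x y hx hy h1 h2 => exact ha ⟨x, hx⟩ ⟨y, hy⟩ h1 h2
  | smul c x hx h => exact hs c ⟨x, hx⟩ h

theorem finite_of_basisF {α β : ℂ} {ι : Type*} (T : ι → finiteSpace α β →ₗ[ℂ] finiteSpace α β)
    (h : ∀ η, {i | T i (basisF α β η) ≠ 0}.Finite) (x : finiteSpace α β) :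
    {i | T i x ≠ 0}.Finite := by
  induction x using finiteSpace_induction with
  | hb η => exact h η
  | h0 => simp
  | ha x y hx hy =>
    refine (hx.union hy).subset fun i hi => ?_
    by_contra hc
    simp only [Set.mem_union, Set.mem_ofPred_eq, not_or, not_not] at hc
    exact hi (by rw [map_add, hc.1, hc.2, add_zero])
  | hs c x hx =>
    refine hx.subset fun i hi h0 => hi ?_
    rw [map_smul, h0, smul_zero]

theorem exists_bound (η : MultiIndex) : ∃ K : ℕ, ∀ j : ℕ+, K < (j : ℕ) → η j = 0 := by
  refine ⟨η.support.sup fun i => (i : ℕ), fun j hj => ?_⟩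
  by_contra h
  exact absurd (Finset.le_sup (f := fun i : ℕ+ => (i : ℕ)) (Finsupp.mem_support_iff.2 h))
    (not_le.2 hj)

theorem finite_quadratic (α β : ℂ) {n : ℤ} (hn : n ≠ 0) (x : finiteSpace α β) :
    {k : ℤ | (modeF α β (-k) ∘ₗ modeF α β (n + k)) x ≠ 0}.Finite := by
  refine finite_of_basisF (fun k : ℤ => modeF α β (-k) ∘ₗ modeF α β (n + k)) (fun η => ?_) x
  obtain ⟨K, hK⟩ := exists_bound η
  refine (Set.finite_Icc (-(K : ℤ) - |n|) (K + |n|)).subset fun k hk => ?_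
  by_contra hc
  refine hk ?_
  rw [Set.mem_Icc, not_and_or, not_le, not_le] at hc
  have hn1 := le_abs_self n
  have hn2 := neg_abs_le n
  rcases hc with hc | hc
  · obtain ⟨j, hj⟩ : ∃ j : ℕ+, (j : ℤ) = -k := ⟨⟨(-k).toNat, by omega⟩, by simp; omega⟩
    obtain ⟨i, hi⟩ : ∃ i : ℕ+, -(i : ℤ) = n + k :=
      ⟨⟨(-(n + k)).toNat, by omega⟩, by simp; omega⟩
    have hij : j ≠ i := by rintro rfl; omega
    have : η j = 0 := hK j (by omega)
    rw [LinearMap.comp_apply, ← hi, modeF_neg_basisF, map_smul, ← hj, modeF_pos_basisF]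
    simp [this, Finsupp.single_eq_of_ne hij]
  · obtain ⟨j, hj⟩ : ∃ j : ℕ+, (j : ℤ) = n + k := ⟨⟨(n + k).toNat, by omega⟩, by simp; omega⟩
    have : η j = 0 := hK j (by omega)
    rw [LinearMap.comp_apply, ← hj, modeF_pos_basisF]
    simp [this]

theorem finite_number (α β : ℂ) (x : finiteSpace α β) :
    {k : ℕ+ | (modeF α β (-(k : ℤ)) ∘ₗ modeF α β k) x ≠ 0}.Finite := by
  refine finite_of_basisF (fun k : ℕ+ => modeF α β (-(k : ℤ)) ∘ₗ modeF α β k) (fun η => ?_) x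
  refine η.support.finite_toSet.subset fun k hk => ?_
  by_contra hc
  refine hk ?_
  rw [LinearMap.comp_apply, modeF_pos_basisF]
  simp [Finsupp.notMem_support_iff.1 hc]

/-! ### The Virasoro operators -/

/-- The pointwise (finite) sum of a locally finite family of operators on `F(α, β)`. -/
def pointwiseSum {α β : ℂ} {ι : Type*} (T : ι → finiteSpace α β →ₗ[ℂ] finiteSpace α β)
    (h : ∀ x, {i | T i x ≠ 0}.Finite) : finiteSpace α β →ₗ[ℂ] finiteSpace α β where
  toFun := fun x => ∑ᶠ i, T i x
  map_add' := fun x y => by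
    simp only [map_add]
    exact finsum_add_distrib (h x) (h y)
  map_smul' := fun c x => by
    simp only [map_smul, RingHom.id_apply]
    exact (smul_finsum' c (h x)).symm

/-- The Virasoro operators on `F(α, β)`:
`L_n = ½ ∑_{k ∈ ℤ} a_{-k} a_{n+k} + n β a_n` for `n ≠ 0` and
`L_0 = ½ (α² - β²) + ∑_{k ≥ 1} a_{-k} a_k`. -/
def virasoroF (α β : ℂ) (n : ℤ) : finiteSpace α β →ₗ[ℂ] finiteSpace α β :=
  if hn : n = 0 then
    ((α ^ 2 - β ^ 2) / 2) • LinearMap.id +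
      pointwiseSum (fun k : ℕ+ => modeF α β (-(k : ℤ)) ∘ₗ modeF α β k) (finite_number α β)
  else
    (1 / 2 : ℂ) • pointwiseSum (fun k : ℤ => modeF α β (-k) ∘ₗ modeF α β (n + k))
      (finite_quadratic α β hn) + ((n : ℂ) * β) • modeF α β n

/-- The Virasoro operators `L_n(α, β)` as operators in `H(α, β)`: the closure of `L_n` on
`F(α, β)`. -/
def virasoro (α β : ℂ) (n : ℤ) : FockSpace α β →ₗ.[ℂ] FockSpace α β :=
  LinearPMap.closure ⟨finiteSpace α β, (finiteSpace α β).subtype ∘ₗ virasoroF α β n⟩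

theorem mem_virasoro_domain {α β : ℂ} (n : ℤ) (x : finiteSpace α β) :
    (x : FockSpace α β) ∈ (virasoro α β n).domain :=
  (LinearPMap.le_closure _).1 x.2

theorem ev_virasoro {α β : ℂ} (n : ℤ) (x : finiteSpace α β) :
    ev (virasoro α β n) (x : FockSpace α β) = virasoroF α β n x := by
  rw [ev_of_mem _ (mem_virasoro_domain n x)]
  exact ((LinearPMap.le_closure
    (⟨finiteSpace α β, (finiteSpace α β).subtype ∘ₗ virasoroF α β n⟩ :
      FockSpace α β →ₗ.[ℂ] FockSpace α β)).2 (x := x) (y := ⟨x, mem_virasoro_domain n x⟩) rfl).symm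

/-! ### Vertex operators -/

/-- `m_{n,m}(x, y) = ∑_j (n choose j) (m choose j) j! x^{n-j} y^{m-j}`. -/
def charlier (n m : ℕ) (x y : ℂ) : ℂ :=
  ∑ j ∈ Finset.range (min n m + 1),
    (n.choose j : ℂ) * (m.choose j : ℂ) * (j.factorial : ℂ) * x ^ (n - j) * y ^ (m - j)

/-- The matrix elements `v_{η,ν}(ω) = (η! ν!)^{-1/2} ∏_i m_{η_i,ν_i}(ω_i, -ω_{-i})`. All factors
outside of the supports of `η` and `ν` are `1`. The entry `ω 0` plays no role. -/
def vertexCoeff (ω : ℤ → ℂ) (η ν : MultiIndex) : ℂ :=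
  ((√((mfact η : ℝ) * (mfact ν : ℝ)) : ℝ) : ℂ)⁻¹ *
    ∏ i ∈ η.support ∪ ν.support, charlier (η i) (ν i) (ω i) (-ω (-(i : ℤ)))

/-- The graph of the matrix operator with matrix elements `v_{η,ν}(ω)`: the pairs `(Ψ, X)` such
that `⟨Φ_η, X⟩ = lim_{N → ∞} ∑_{‖ν‖ ≤ N} v_{η,ν}(ω) ⟨Φ_ν, Ψ⟩` for all `η`. That `X` is an element
of the Hilbert space expresses the square summability of these limits. -/
def vertexGraph (α β : ℂ) (ω : ℤ → ℂ) : Submodule ℂ (FockSpace α β × FockSpace α β) where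
  carrier := {p | ∀ η : MultiIndex,
    Tendsto (fun N : ℕ => ∑ ν ∈ (finite_level_le N).toFinset, vertexCoeff ω η ν * p.1 ν)
      atTop (𝓝 (p.2 η))}
  zero_mem' := fun η => by
    refine tendsto_const_nhds.congr fun N => ?_
    exact (Finset.sum_eq_zero fun ν _ => mul_zero (vertexCoeff ω η ν)).symm
  add_mem' := fun {p q} hp hq η => by
    refine ((hp η).add (hq η)).congr fun N => ?_
    rw [← Finset.sum_add_distrib]
    exact Finset.sum_congr rfl fun ν _ => (mul_add (vertexCoeff ω η ν) (p.1 ν) (q.1 ν)).symm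
  smul_mem' := fun c p hp η => by
    refine ((hp η).const_mul c).congr fun N => ?_
    rw [Finset.mul_sum]
    exact Finset.sum_congr rfl fun ν _ => mul_left_comm c (vertexCoeff ω η ν) (p.1 ν)

theorem vertexGraph_singleValued (α β : ℂ) (ω : ℤ → ℂ) :
    ∀ p ∈ vertexGraph α β ω, p.1 = 0 → p.2 = 0 := by
  rintro ⟨x, y⟩ hp h
  obtain rfl : x = 0 := h
  refine lp.ext (funext fun η => tendsto_nhds_unique (hp η) ?_)
  refine tendsto_const_nhds.congr fun N => ?_
  exact (Finset.sum_eq_zero fun ν _ => mul_zero (vertexCoeff ω η ν)).symm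

/-- The vertex operator `V(ω) = exp(∑ ω_n n^{-1/2} a_{-n}) exp(-∑ ω_{-n} n^{-1/2} a_n)`, defined
as the matrix operator with matrix elements `v_{η,ν}(ω)` on its maximal domain. -/
def vertexOp (α β : ℂ) (ω : ℤ → ℂ) : FockSpace α β →ₗ.[ℂ] FockSpace α β :=
  (vertexGraph α β ω).toLinearPMap

theorem vertexOp_graph (α β : ℂ) (ω : ℤ → ℂ) :
    (vertexOp α β ω).graph = vertexGraph α β ω :=
  Submodule.toLinearPMap_graph_eq _ (vertexGraph_singleValued α β ω)

/-- The sequence `ω_k = ∑_i γ_i z_i^k / √|k|`, `k ≠ 0`. -/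
def multiSeq {r : ℕ} (γ z : Fin r → ℂ) (k : ℤ) : ℂ :=
  ∑ i, γ i * z i ^ k / ((√|(k : ℝ)| : ℝ) : ℂ)

/-- `V(γ₁, …, γ_r; z₁, …, z_r)
= exp(∑_n n⁻¹ (∑_i γ_i z_i^n) a_{-n}) exp(-∑_n n⁻¹ (∑_i γ_i z_i^{-n}) a_n)`. -/
def vertexMulti (α β : ℂ) {r : ℕ} (γ z : Fin r → ℂ) : FockSpace α β →ₗ.[ℂ] FockSpace α β :=
  vertexOp α β (multiSeq γ z)

/-- `V(γ, z) = exp(γ ∑_n n⁻¹ z^n a_{-n}) exp(-γ ∑_n n⁻¹ z^{-n} a_n)`. -/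
def vertexSingle (α β γ z : ℂ) : FockSpace α β →ₗ.[ℂ] FockSpace α β :=
  vertexOp α β fun k : ℤ => γ * z ^ k / ((√|(k : ℝ)| : ℝ) : ℂ)

/-- The translation `T_γ = exp(i γ q) : H(α, β) → H(α + γ, β)`, which commutes with the `a_k`,
`k ≠ 0`, and maps vacuum to vacuum: it identifies the two Hilbert spaces. -/
def translation (α β γ : ℂ) : FockSpace α β ≃ₗᵢ[ℂ] FockSpace (α + γ) β :=
  LinearIsometryEquiv.refl ℂ (lp (fun _ : MultiIndex => ℂ) 2)

/-- `c • T_γ A` for an operator `A` in `H(α, β)`, an operator `H(α, β) → H(α + γ, β)` with the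
same domain as `A`. -/
def scaledTranslate (α β γ c : ℂ) (A : FockSpace α β →ₗ.[ℂ] FockSpace α β) :
    FockSpace α β →ₗ.[ℂ] FockSpace (α + γ) β where
  domain := A.domain
  toFun := c • ((translation α β γ).toLinearEquiv.toLinearMap ∘ₗ A.toFun)

/-! ### Branches and prefactors -/

/-- `ℓ` is a continuous branch of `log f` on `U`. -/
def IsLogBranch {X : Type*} [TopologicalSpace X] (U : Set X) (f ℓ : X → ℂ) : Prop :=
  ContinuousOn ℓ U ∧ ∀ z ∈ U, Complex.exp (ℓ z) = f z

/-- The function `F_λ = ∏_{i<j} (z_i - z_j)^{γ_i γ_j} ∏_i z_i^{λ γ_i}`, for given logarithms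
`d i j` of `z_i - z_j` (`i < j`) and `ℓ i` of `z_i`. -/
def prefactor {r : ℕ} (lam : ℂ) (γ : Fin r → ℂ) (d : Fin r → Fin r → ℂ) (ℓ : Fin r → ℂ) : ℂ :=
  (∏ i, ∏ j ∈ Finset.Ioi i, Complex.exp (γ i * γ j * d i j)) *
    ∏ i, Complex.exp (lam * γ i * ℓ i)

/-! ### Commutation relations -/

/-- The commutator of the Virasoro operators with an operator `P : H(α, β) → H(α', β)`, evaluated
at `Φ`: `[L_n, P] Φ = L_n(α', β) P Φ - P L_n(α, β) Φ`. -/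
def virComm {α α' β : ℂ} (n : ℤ) (P : FockSpace α β →ₗ.[ℂ] FockSpace α' β)
    (Φ : FockSpace α β) : FockSpace α' β :=
  ev (virasoro α' β n) (ev P Φ) - ev P (ev (virasoro α β n) Φ)

/-- All the terms of `[L_n, P] Φ` are defined. -/
def VirCommDefined {α α' β : ℂ} (n : ℤ) (P : FockSpace α β →ₗ.[ℂ] FockSpace α' β)
    (Φ : FockSpace α β) : Prop :=
  Φ ∈ P.domain ∧ ev P Φ ∈ (virasoro α' β n).domain ∧
    Φ ∈ (virasoro α β n).domain ∧ ev (virasoro α β n) Φ ∈ P.domain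

/-- The operator-valued function `P` is a conformal field of weight `κ` on `U`, strongly on
`F(α, β)`: `[L_n, P(z)] = z^n (z ∂_z + (n + 1) κ) P(z)` for all `n ∈ ℤ`. -/
def IsConformalField {α α' β : ℂ} (U : Set ℂ) (P : ℂ → FockSpace α β →ₗ.[ℂ] FockSpace α' β)
    (κ : ℂ) : Prop :=
  ∀ z ∈ U, ∀ Φ ∈ finiteSpace α β, ∃ D : FockSpace α' β,
    HasDerivAt (fun w => ev (P w) Φ) D z ∧
    ∀ n : ℤ, VirCommDefined n (P z) Φ ∧
      virComm n (P z) Φ = z ^ n • (z • D + (((n : ℂ) + 1) * κ) • ev (P z) Φ)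

/-- `θ_k = √|k| ω_k` for `k ≠ 0` and `θ_0 = γ`. -/
def theta (ω : ℤ → ℂ) (γ : ℂ) (k : ℤ) : ℂ :=
  if k = 0 then γ else ((√|(k : ℝ)| : ℝ) : ℂ) * ω k

/-- `∑_{k=1}^{n-1} f k`, with the usual convention `∑_{k=1}^{n-1} f k = - ∑_{k=n}^{0} f k` if
`n ≤ 0`. -/
def signedSum (n : ℤ) (f : ℤ → ℂ) : ℂ :=
  if 0 < n then ∑ k ∈ Finset.Icc 1 (n - 1), f k else -∑ k ∈ Finset.Icc n 0, f k

end VertexOp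

end

open VertexOp

noncomputable section

namespace VertexOp

/-! ### Matrix elements -/

/-! Everything rests on one relation, [a_n, T_γ V(ω)] = θ_n T_γ V(ω) for all n ∈ ℤ
(`coordMode_vertexF`). In coordinates it is a pair of recursions for the matrix elements,
`vertexCoeff_add_single_left` and `vertexCoeff_add_single_right`, inherited mode by mode from
Pascal's rule for m_{n,m}; for n = 0 it is the shift of the charge from α to α + γ. Since L_n is
quadratic in the modes, the Leibniz rule turns [L_n, V] for n ≠ 0 into ½ ∑_k (θ_{-k} V a_{n+k} +
θ_{n+k} a_{-k} V) + nβ θ_n V. Moving annihilators to the right of V and creators to its left leaves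
multiples of V that collapse to ½ ∑ θ_k θ_{n-k} and θ_n (α + γ) (`half_sum_eq`). L_0 is already
normally ordered and is treated separately.

The analytic difficulty is that VΦ is an infinite vector while a_k and L_n are unbounded. It is met
by `RapidDecay`: the coefficients of VΦ are absolutely summable against (‖η‖ + 1) R^{|η|} for every
R (`rapidDecay_vertexCoeff`). Rows of L_n are finite combinations of coordinates, so the closure
acts by the same rows (`closure_apply_of_rows`). Columns of L_n are bounded by C (‖η‖ + 1) 4^{|η|}
(`norm_virasoroF_basisF_le`), so rapidly decaying vectors lie in the domain of the closure. All
commutator identities are then checked coordinate by coordinate, where every sum is finite.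

For the operators depending on z, the expansion of VΦ in the basis has a summable majorant on each
annulus δ < |z_i| < ρ < 1, so it is holomorphic in norm; the derivative is read off from the
coordinates. The prefactor F_λ is made for its logarithmic derivative: the finite sum ½ ∑ θ_k
θ_{n-k} with θ_k = ∑ γ_i z_i^k consists of geometric sums, which evaluate to the terms γ_i γ_j
z_j/(z_j - z_i) and the weights γ_j²/2 (`half_signedSum_theta`). The conformal field is the case r =
1, λ = α - β. -/

theorem charlier_comm (n m : ℕ) (x y : ℂ) : charlier n m x y = charlier m n y x := by
  simp only [charlier, min_comm n m]
  exact Finset.sum_congr rfl fun j _ => by ring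

/-- The binomials kill every term beyond min n m, so the range may end anywhere above n; sums with
different indices get a common range. -/
theorem charlier_eq_sum (n m N : ℕ) (hN : n ≤ N) (x y : ℂ) :
    charlier n m x y = ∑ j ∈ Finset.range (N + 1),
      (n.choose j : ℂ) * (m.choose j : ℂ) * (j.factorial : ℂ) * x ^ (n - j) * y ^ (m - j) := by
  refine Finset.sum_subset (fun j hj => ?_) fun j _ hj => ?_
  · simp only [Finset.mem_range] at hj ⊢
    omega
  · rw [Finset.mem_range, not_lt, Nat.succ_le_iff, min_lt_iff] at hj
    rcases hj with h | h <;> simp [Nat.choose_eq_zero_of_lt h]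

/-- Pascal's rule for (n+1 choose j+1), together with (m choose j+1) (j+1)! = m (m-1 choose j) j!.
This is the commutation relation of a single mode with its exponentials. -/
theorem charlier_succ_left (n m : ℕ) (x y : ℂ) :
    charlier (n + 1) m x y = x * charlier n m x y + m * charlier n (m - 1) x y := by
  rw [charlier_eq_sum (n + 1) m (n + 1) le_rfl, charlier_eq_sum n m (n + 1) (Nat.le_succ n),
    charlier_eq_sum n (m - 1) n le_rfl, Finset.sum_range_succ' _ (n + 1),
    Finset.sum_range_succ' _ (n + 1), Finset.mul_sum, mul_add, Finset.mul_sum, add_right_comm,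
    ← Finset.sum_add_distrib]
  congr 1
  · refine Finset.sum_congr rfl fun j hj => ?_
    -- Truncated subtraction spoils the power law only for j ≥ n, where the binomial vanishes.
    have h1 : x * ((n.choose (j + 1) : ℂ) * x ^ (n - (j + 1))) =
        n.choose (j + 1) * x ^ (n - j) := by
      rcases Nat.lt_or_ge j n with h | h
      · rw [show n - j = n - (j + 1) + 1 by omega, pow_succ]; ring
      · simp [Nat.choose_eq_zero_of_lt (Nat.lt_succ_of_le h)]
    have h2 : (m.choose (j + 1) : ℂ) * ((j + 1).factorial : ℂ) =
        m * ((m - 1).choose j * j.factorial) := by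
      rcases m with _ | m
      · simp
      · have := Nat.add_one_mul_choose_eq m j
        rw [Nat.factorial_succ, Nat.add_sub_cancel]
        have h3 : ((m + 1 : ℕ) : ℂ) * m.choose j = (m + 1).choose (j + 1) * ((j + 1 : ℕ) : ℂ) := by
          exact_mod_cast this
        rw [← mul_assoc, h3]; push_cast; ring
    rw [Nat.choose_succ_succ', Nat.add_sub_add_right, show m - (j + 1) = m - 1 - j by omega]
    push_cast
    linear_combination (-((m.choose (j + 1) : ℂ) * ((j + 1).factorial : ℂ)
      * y ^ (m - 1 - j))) * h1 + (n.choose j * x ^ (n - j) * y ^ (m - 1 - j)) * h2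
  · simp [pow_succ]; ring

theorem hasDerivAt_charlier_left (n m : ℕ) (x y : ℂ) :
    HasDerivAt (fun x => charlier n m x y) (n * charlier (n - 1) m x y) x := by
  have hfun : (fun x => charlier n m x y) = fun x => ∑ j ∈ Finset.range (n + 1),
      (n.choose j : ℂ) * (m.choose j : ℂ) * (j.factorial : ℂ) * x ^ (n - j) * y ^ (m - j) :=
    funext fun x => charlier_eq_sum n m n le_rfl x y
  rw [hfun, charlier_eq_sum (n - 1) m n (Nat.sub_le n 1), Finset.mul_sum]
  refine HasDerivAt.fun_sum fun j hj => ?_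
  refine (((hasDerivAt_pow (n - j) x).const_mul
    ((n.choose j : ℂ) * (m.choose j : ℂ) * (j.factorial : ℂ))).mul_const (y ^ (m - j))).congr_deriv ?_
  have h : (n.choose j : ℂ) * ((n - j : ℕ) : ℂ) = n * (n - 1).choose j := by
    rcases n with _ | n
    · simp
    · have := Nat.choose_mul_succ_eq n j
      rw [Nat.add_sub_cancel]
      exact_mod_cast (this.symm.trans (mul_comm _ _)).trans (by ring)
  rw [show n - j - 1 = n - 1 - j by omega]
  linear_combination (m.choose j * j.factorial * x ^ (n - 1 - j) * y ^ (m - j) : ℂ) * h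

/-- The matrix elements of a vertex operator with a single mode. -/
def modeCoeff (n m : ℕ) (x y : ℂ) : ℂ :=
  charlier n m x y / ((√(n.factorial : ℝ) : ℝ) * (√(m.factorial : ℝ) : ℝ))

theorem modeCoeff_comm (n m : ℕ) (x y : ℂ) : modeCoeff n m x y = modeCoeff m n y x := by
  rw [modeCoeff, modeCoeff, charlier_comm, mul_comm]

theorem modeCoeff_zero_zero (x y : ℂ) : modeCoeff 0 0 x y = 1 := by
  simp [modeCoeff, charlier]

theorem modeCoeff_zero_right (n : ℕ) (x y : ℂ) :
    modeCoeff n 0 x y = x ^ n / (√(n.factorial : ℝ) : ℝ) := by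
  simp [modeCoeff, charlier]

theorem sqrt_factorial_succ (n : ℕ) :
    ((√((n + 1).factorial : ℝ) : ℝ) : ℂ) = (√((n : ℝ) + 1) : ℝ) * (√(n.factorial : ℝ) : ℝ) := by
  rw [Nat.factorial_succ, Nat.cast_mul, Real.sqrt_mul (by positivity)]
  push_cast; rfl

theorem sqrt_factorial_ne_zero (n : ℕ) : ((√(n.factorial : ℝ) : ℝ) : ℂ) ≠ 0 := by
  rw [Complex.ofReal_ne_zero, Real.sqrt_ne_zero']
  exact_mod_cast n.factorial_pos

theorem ofReal_sqrt_mul_self {x : ℝ} (hx : 0 ≤ x) : ((√x : ℝ) : ℂ) * (√x : ℝ) = x := by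
  rw [← Complex.ofReal_mul, Real.mul_self_sqrt hx]

theorem modeCoeff_succ_left (n m : ℕ) (x y : ℂ) :
    (√((n : ℝ) + 1) : ℝ) * modeCoeff (n + 1) m x y =
      x * modeCoeff n m x y + (√(m : ℝ) : ℝ) * modeCoeff n (m - 1) x y := by
  have hn := sqrt_factorial_ne_zero n
  have hn' : ((√((n : ℝ) + 1) : ℝ) : ℂ) ≠ 0 := by
    rw [Complex.ofReal_ne_zero, Real.sqrt_ne_zero']; positivity
  rw [modeCoeff, modeCoeff, modeCoeff, charlier_succ_left, sqrt_factorial_succ]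
  rcases m with _ | m
  · simp; field_simp
  · have hm := sqrt_factorial_ne_zero m
    have hm' : ((√((m : ℝ) + 1) : ℝ) : ℂ) ≠ 0 := by
      rw [Complex.ofReal_ne_zero, Real.sqrt_ne_zero']; positivity
    have h := ofReal_sqrt_mul_self (x := (m : ℝ) + 1) (by positivity)
    rw [sqrt_factorial_succ, Nat.add_sub_cancel]
    push_cast at h ⊢
    field_simp
    linear_combination (-(charlier n m x y)) * h

theorem modeCoeff_succ_right (n m : ℕ) (x y : ℂ) :
    (√((m : ℝ) + 1) : ℝ) * modeCoeff n (m + 1) x y =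
      y * modeCoeff n m x y + (√(n : ℝ) : ℝ) * modeCoeff (n - 1) m x y := by
  rw [modeCoeff_comm, modeCoeff_succ_left, modeCoeff_comm m n, modeCoeff_comm m (n - 1)]

theorem hasDerivAt_modeCoeff_left (n m : ℕ) (x y : ℂ) :
    HasDerivAt (fun x => modeCoeff n m x y) ((√(n : ℝ) : ℝ) * modeCoeff (n - 1) m x y) x := by
  refine ((hasDerivAt_charlier_left n m x y).div_const _).congr_deriv ?_
  rcases n with _ | n
  · simp
  · have hn := sqrt_factorial_ne_zero n
    have hm := sqrt_factorial_ne_zero m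
    have hn' : ((√((n : ℝ) + 1) : ℝ) : ℂ) ≠ 0 := by
      rw [Complex.ofReal_ne_zero, Real.sqrt_ne_zero']; positivity
    have h := ofReal_sqrt_mul_self (x := (n : ℝ) + 1) (by positivity)
    rw [modeCoeff, sqrt_factorial_succ, Nat.add_sub_cancel]
    push_cast at h ⊢
    field_simp
    linear_combination (-(charlier n m x y)) * h

theorem hasDerivAt_modeCoeff_right (n m : ℕ) (x y : ℂ) :
    HasDerivAt (fun y => modeCoeff n m x y) ((√(m : ℝ) : ℝ) * modeCoeff n (m - 1) x y) y := by
  simp only [modeCoeff_comm n]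
  exact hasDerivAt_modeCoeff_left m n y x

theorem differentiable_modeCoeff (n m : ℕ) : Differentiable ℂ fun p : ℂ × ℂ => modeCoeff n m p.1 p.2 := by
  unfold modeCoeff charlier
  fun_prop

/-- All coefficients of m_{n,m} are nonnegative, so the triangle inequality gives monotonicity in
the absolute values. The majorants for holomorphy in z come from here. -/
theorem norm_charlier_le (n m : ℕ) {x y : ℂ} {x' y' : ℝ} (hx : ‖x‖ ≤ x') (hy : ‖y‖ ≤ y') :
    ‖charlier n m x y‖ ≤ ‖charlier n m x' y'‖ := by
  have hx0 := (norm_nonneg x).trans hx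
  have hy0 := (norm_nonneg y).trans hy
  have h : charlier n m x' y' = ((∑ j ∈ Finset.range (min n m + 1),
      (n.choose j : ℝ) * (m.choose j : ℝ) * (j.factorial : ℝ) * x' ^ (n - j) * y' ^ (m - j) : ℝ) : ℂ) := by
    simp [charlier]
  rw [h, Complex.norm_real, Real.norm_of_nonneg (Finset.sum_nonneg fun j _ => by positivity)]
  refine (norm_sum_le _ _).trans (Finset.sum_le_sum fun j _ => ?_)
  simp only [norm_mul, norm_pow, Complex.norm_natCast]
  gcongr

theorem norm_modeCoeff_le (n m : ℕ) {x y : ℂ} {x' y' : ℝ} (hx : ‖x‖ ≤ x') (hy : ‖y‖ ≤ y') :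
    ‖modeCoeff n m x y‖ ≤ ‖modeCoeff n m x' y'‖ := by
  rw [modeCoeff, modeCoeff, norm_div, norm_div]
  gcongr ?_ / _
  exact norm_charlier_le n m hx hy

/-! ### Factorization of the matrix elements over the modes -/

theorem vertexCoeff_eq_prod (ω : ℤ → ℂ) (η ν : MultiIndex) {s : Finset ℕ+}
    (hη : η.support ⊆ s) (hν : ν.support ⊆ s) :
    vertexCoeff ω η ν = ∏ i ∈ s, modeCoeff (η i) (ν i) (ω i) (-ω (-(i : ℤ))) := by
  have hs : ∏ i ∈ s, modeCoeff (η i) (ν i) (ω i) (-ω (-(i : ℤ))) =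
      ∏ i ∈ η.support ∪ ν.support, modeCoeff (η i) (ν i) (ω i) (-ω (-(i : ℤ))) := by
    refine (Finset.prod_subset (Finset.union_subset hη hν) fun i _ hi => ?_).symm
    simp only [Finset.mem_union, Finsupp.mem_support_iff, not_or, not_not] at hi
    rw [hi.1, hi.2, modeCoeff_zero_zero]
  have hf : ∀ (ξ : MultiIndex), ξ.support ⊆ η.support ∪ ν.support →
      ((√(mfact ξ : ℝ) : ℝ) : ℂ) = ∏ i ∈ η.support ∪ ν.support, ((√((ξ i).factorial : ℝ) : ℝ) : ℂ) := by
    intro ξ hξ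
    rw [mfact, Finsupp.prod_of_support_subset _ hξ _ (by simp), Nat.cast_prod,
      Real.sqrt_prod _ fun i _ => by positivity]
    push_cast; rfl
  rw [hs, vertexCoeff, Real.sqrt_mul (by positivity), Complex.ofReal_mul,
    hf η Finset.subset_union_left, hf ν Finset.subset_union_right, ← Finset.prod_mul_distrib,
    ← Finset.prod_inv_distrib, ← Finset.prod_mul_distrib]
  refine Finset.prod_congr rfl fun i _ => ?_
  rw [modeCoeff, div_eq_inv_mul]

/-- The factors of a matrix element of a vertex operator which do not belong to the mode `k`. -/
def coeffErase (ω : ℤ → ℂ) (k : ℕ+) (η ν : MultiIndex) : ℂ :=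
  ∏ i ∈ (η.support ∪ ν.support).erase k, modeCoeff (η i) (ν i) (ω i) (-ω (-(i : ℤ)))

theorem coeffErase_eq_prod (ω : ℤ → ℂ) (k : ℕ+) (η ν : MultiIndex) {s : Finset ℕ+}
    (hη : η.support ⊆ s) (hν : ν.support ⊆ s) :
    coeffErase ω k η ν = ∏ i ∈ s.erase k, modeCoeff (η i) (ν i) (ω i) (-ω (-(i : ℤ))) := by
  refine Finset.prod_subset (Finset.erase_subset_erase k (Finset.union_subset hη hν))
    fun i hs hi => ?_
  simp only [Finset.mem_erase, Finset.mem_union, Finsupp.mem_support_iff, not_or, not_not, not_and]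
    at hi hs
  obtain ⟨h1, h2⟩ := hi hs.1
  rw [h1, h2, modeCoeff_zero_zero]

theorem coeffErase_congr (ω : ℤ → ℂ) {k : ℕ+} {η ν η' ν' : MultiIndex}
    (hη : ∀ i, i ≠ k → η i = η' i) (hν : ∀ i, i ≠ k → ν i = ν' i) :
    coeffErase ω k η ν = coeffErase ω k η' ν' := by
  classical
  rw [coeffErase_eq_prod ω k η ν (s := (η.support ∪ ν.support) ∪ (η'.support ∪ ν'.support))
      (by intro i; simp +contextual) (by intro i; simp +contextual),
    coeffErase_eq_prod ω k η' ν' (s := (η.support ∪ ν.support) ∪ (η'.support ∪ ν'.support))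
      (by intro i; simp +contextual) (by intro i; simp +contextual)]
  refine Finset.prod_congr rfl fun i hi => ?_
  rw [hη i (Finset.ne_of_mem_erase hi), hν i (Finset.ne_of_mem_erase hi)]

theorem vertexCoeff_eq_mul_erase (ω : ℤ → ℂ) (k : ℕ+) (η ν : MultiIndex) :
    vertexCoeff ω η ν = modeCoeff (η k) (ν k) (ω k) (-ω (-(k : ℤ))) * coeffErase ω k η ν := by
  classical
  rw [vertexCoeff_eq_prod ω η ν (s := insert k (η.support ∪ ν.support))
      (by intro i; simp +contextual) (by intro i; simp +contextual),
    coeffErase_eq_prod ω k η ν (s := insert k (η.support ∪ ν.support))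
      (by intro i; simp +contextual) (by intro i; simp +contextual),
    Finset.mul_prod_erase _ (fun i : ℕ+ => modeCoeff (η i) (ν i) (ω i) (-ω (-(i : ℤ)))) (by simp)]

/-- Only the factor of the mode k changes, and it obeys the one-mode recursion. Multiplied by √k,
this is [a_k, V(ω)] = √k ω_k V(ω) in coordinates. -/
theorem vertexCoeff_add_single_left (ω : ℤ → ℂ) (k : ℕ+) (η ν : MultiIndex) :
    (√((η k : ℝ) + 1) : ℝ) * vertexCoeff ω (η + Finsupp.single k 1) ν =
      ω k * vertexCoeff ω η ν +
        (√(ν k : ℝ) : ℝ) * vertexCoeff ω η (ν - Finsupp.single k 1) := by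
  classical
  rw [vertexCoeff_eq_mul_erase ω k (η + _), vertexCoeff_eq_mul_erase ω k η ν,
    vertexCoeff_eq_mul_erase ω k η (ν - _),
    coeffErase_congr ω (k := k) (η := η + Finsupp.single k 1) (η' := η) (ν := ν) (ν' := ν)
      (fun i hi => by simp [Finsupp.single_eq_of_ne hi]) (fun _ _ => rfl),
    coeffErase_congr ω (k := k) (η := η) (η' := η) (ν := ν - Finsupp.single k 1) (ν' := ν)
      (fun _ _ => rfl) (fun i hi => by simp [Finsupp.single_eq_of_ne hi])]
  have := modeCoeff_succ_left (η k) (ν k) (ω k) (-ω (-(k : ℤ)))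
  simp only [Finsupp.add_apply, Finsupp.tsub_apply, Finsupp.single_eq_same]
  linear_combination (coeffErase ω k η ν) * this

/-- The mirror image, which multiplied by √k is [a_{-k}, V(ω)] = √k ω_{-k} V(ω) in coordinates. -/
theorem vertexCoeff_add_single_right (ω : ℤ → ℂ) (k : ℕ+) (η ν : MultiIndex) :
    (√((ν k : ℝ) + 1) : ℝ) * vertexCoeff ω η (ν + Finsupp.single k 1) =
      -ω (-(k : ℤ)) * vertexCoeff ω η ν +
        (√(η k : ℝ) : ℝ) * vertexCoeff ω (η - Finsupp.single k 1) ν := by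
  classical
  rw [vertexCoeff_eq_mul_erase ω k η (ν + _), vertexCoeff_eq_mul_erase ω k η ν,
    vertexCoeff_eq_mul_erase ω k (η - _),
    coeffErase_congr ω (k := k) (ν := ν + Finsupp.single k 1) (ν' := ν) (η := η) (η' := η)
      (fun _ _ => rfl) (fun i hi => by simp [Finsupp.single_eq_of_ne hi]),
    coeffErase_congr ω (k := k) (ν := ν) (ν' := ν) (η := η - Finsupp.single k 1) (η' := η)
      (fun i hi => by simp [Finsupp.single_eq_of_ne hi]) (fun _ _ => rfl)]
  have := modeCoeff_succ_right (η k) (ν k) (ω k) (-ω (-(k : ℤ)))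
  simp only [Finsupp.add_apply, Finsupp.tsub_apply, Finsupp.single_eq_same]
  linear_combination (coeffErase ω k η ν) * this

/-- The second argument of m is -ω_{-i}; the sign in `h2` makes both arguments for ω' nonnegative.
-/
theorem norm_vertexCoeff_le {ω ω' : ℤ → ℂ} {b : ℤ → ℝ} (hb : ∀ k : ℤ, ‖ω k‖ ≤ b k)
    (h1 : ∀ k : ℕ+, ω' k = b k) (h2 : ∀ k : ℕ+, ω' (-(k : ℤ)) = -b (-(k : ℤ)))
    (η ν : MultiIndex) : ‖vertexCoeff ω η ν‖ ≤ ‖vertexCoeff ω' η ν‖ := by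
  rw [vertexCoeff_eq_prod ω η ν Finset.subset_union_left Finset.subset_union_right,
    vertexCoeff_eq_prod ω' η ν Finset.subset_union_left Finset.subset_union_right,
    norm_prod, norm_prod]
  refine Finset.prod_le_prod (fun _ _ => norm_nonneg _) fun i _ => ?_
  rw [h1, h2, neg_neg]
  exact norm_modeCoeff_le _ _ (hb i) (by rw [norm_neg]; exact hb _)

/-! ### Absolutely summable sequences of coefficients -/

theorem level_add (η ξ : MultiIndex) : level (η + ξ) = level η + level ξ :=
  Finsupp.sum_add_index' (fun _ => mul_zero _) fun _ _ _ => mul_add _ _ _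

theorem level_single (k : ℕ+) (m : ℕ) : level (Finsupp.single k m) = k * m :=
  Finsupp.sum_single_index (mul_zero _)

theorem le_level {η : MultiIndex} {k : ℕ+} (h : η k ≠ 0) : (k : ℕ) ≤ level η := by
  refine (Nat.le_mul_of_pos_right _ (Nat.pos_of_ne_zero h)).trans ?_
  exact Finset.single_le_sum (f := fun i : ℕ+ => (i : ℕ) * η i) (fun _ _ => Nat.zero_le _)
    (Finsupp.mem_support_iff.2 h)

/-! ### Sums of products over multi-indices -/

theorem one_add_sum_le_prod {ι : Type*} (s : Finset ι) (a : ι → ℝ) (ha : ∀ i, 0 ≤ a i) :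
    1 + ∑ i ∈ s, a i ≤ ∏ i ∈ s, (1 + a i) := by
  classical
  induction s using Finset.induction_on with
  | empty => simp
  | insert i s hi ih =>
    rw [Finset.sum_insert hi, Finset.prod_insert hi]
    have h1 := Finset.sum_nonneg fun j (_ : j ∈ s) => ha j
    nlinarith [mul_le_mul_of_nonneg_left ih (ha i), mul_nonneg (ha i) h1]

/-- Splitting off an index a sends η injectively to (η a, η.erase a), so the sum is at most a sum
over the value at a times a sum over the remaining entries. -/
theorem sum_finsupp_prod_le {ι : Type*} (f : ι → ℕ → ℝ) (hf : ∀ i n, 0 ≤ f i n)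
    (u : ι → ℝ) (hu : ∀ i N, ∑ n ∈ Finset.range N, f i (n + 1) ≤ u i) (s : Finset ι) :
    ∀ S : Finset (ι →₀ ℕ), (∀ η ∈ S, η.support ⊆ s) →
      ∑ η ∈ S, η.prod f ≤ ∏ i ∈ s, (1 + u i) := by
  classical
  have hu0 : ∀ i, 0 ≤ u i := fun i => by simpa using hu i 0
  have hprod : ∀ η : ι →₀ ℕ, 0 ≤ η.prod f := fun η => Finset.prod_nonneg fun i _ => hf i _
  induction s using Finset.induction_on with
  | empty =>
    intro S hS
    have hsub : S ⊆ {0} := fun η hη => by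
      simpa [Finset.subset_empty] using hS η hη
    refine (Finset.sum_le_sum_of_subset_of_nonneg hsub fun η _ _ => hprod η).trans ?_
    simp
  | insert a s ha ih =>
    intro S hS
    -- `Finsupp.prod` skips zero entries, so the value 0 has weight 1 whatever `f a 0` is; this is
    -- the 1 in 1 + u a.
    set g : ℕ → ℝ := fun n => if n = 0 then 1 else f a n with hg
    have hg0 : ∀ n, 0 ≤ g n := fun n => by
      simp only [hg]; split_ifs; exacts [zero_le_one, hf a n]
    have hfac : ∀ η : ι →₀ ℕ, η.prod f = g (η a) * (η.erase a).prod f := by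
      intro η
      by_cases h : η a = 0
      · rw [Finsupp.erase_of_notMem_support (by simpa using h)]; simp [hg, h]
      · rw [← Finsupp.mul_prod_erase η a f (by simpa using h)]; simp [hg, h]
    set N := S.sup fun η => η a
    have hinj : Set.InjOn (fun η : ι →₀ ℕ => (η a, η.erase a)) S := by
      intro η _ ξ _ h
      obtain ⟨h1, h2⟩ := Prod.ext_iff.1 h
      simp only at h1 h2
      rw [← Finsupp.single_add_erase a η, ← Finsupp.single_add_erase a ξ, h1, h2]
    have hsub : S.image (fun η : ι →₀ ℕ => (η a, η.erase a)) ⊆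
        Finset.range (N + 1) ×ˢ S.image fun η => η.erase a := by
      intro p hp
      obtain ⟨η, hη, rfl⟩ := Finset.mem_image.1 hp
      exact Finset.mem_product.2 ⟨Finset.mem_range.2 (Nat.lt_succ_of_le
        (Finset.le_sup (f := fun η : ι →₀ ℕ => η a) hη)), Finset.mem_image_of_mem _ hη⟩
    calc ∑ η ∈ S, η.prod f
        = ∑ p ∈ S.image (fun η : ι →₀ ℕ => (η a, η.erase a)), g p.1 * p.2.prod f := by
          rw [Finset.sum_image hinj]
          exact Finset.sum_congr rfl fun η _ => hfac η
      _ ≤ ∑ p ∈ Finset.range (N + 1) ×ˢ S.image fun η => η.erase a, g p.1 * p.2.prod f :=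
          Finset.sum_le_sum_of_subset_of_nonneg hsub fun p _ _ => mul_nonneg (hg0 _) (hprod _)
      _ = (∑ n ∈ Finset.range (N + 1), g n) * ∑ ξ ∈ S.image fun η => η.erase a, ξ.prod f := by
          rw [Finset.sum_product, Finset.sum_mul_sum]
      _ ≤ (1 + u a) * ∏ i ∈ s, (1 + u i) := by
          refine mul_le_mul ?_ (ih _ ?_) (Finset.sum_nonneg fun ξ _ => hprod ξ)
            (add_nonneg zero_le_one (hu0 a))
          · rw [Finset.sum_range_succ', add_comm]
            simpa [hg] using hu a N
          · intro ξ hξ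
            obtain ⟨η, hη, rfl⟩ := Finset.mem_image.1 hξ
            rw [Finsupp.support_erase]
            intro i hi
            exact (Finset.mem_insert.1 (hS η hη (Finset.mem_of_mem_erase hi))).resolve_left
              (Finset.ne_of_mem_erase hi)
      _ = ∏ i ∈ insert a s, (1 + u i) := by rw [Finset.prod_insert ha]

/-- All finite partial sums are at most ∏ (1 + u_i) ≤ exp (∑ u_i). -/
theorem summable_finsupp_prod {ι : Type*} (f : ι → ℕ → ℝ) (hf : ∀ i n, 0 ≤ f i n)
    {u : ι → ℝ} (hus : Summable u) (hu : ∀ i N, ∑ n ∈ Finset.range N, f i (n + 1) ≤ u i) :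
    Summable fun η : ι →₀ ℕ => η.prod f := by
  classical
  have hu0 : ∀ i, 0 ≤ u i := fun i => by simpa using hu i 0
  refine summable_of_sum_le (c := Real.exp (∑' i, u i))
    (fun η => Finset.prod_nonneg fun i _ => hf i _) fun S => ?_
  refine (sum_finsupp_prod_le f hf u hu (S.biUnion fun η => η.support) S
    fun η hη => Finset.subset_biUnion_of_mem (fun η : ι →₀ ℕ => η.support) hη).trans ?_
  refine (Finset.prod_le_prod (fun i _ => add_nonneg zero_le_one (hu0 i))
    fun i _ => (add_comm _ _).trans_le (Real.add_one_le_exp (u i))).trans ?_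
  rw [← Real.exp_sum]
  exact Real.exp_le_exp.2 (hus.sum_le_tsum _ fun i _ => hu0 i)

/-- Write the term as 2^{-n} · (2K)^n/√n! and bound the product by the sum of the squares: a
geometric plus an exponential series. -/
theorem summable_pow_div_sqrt_factorial (K : ℝ) (hK : 0 ≤ K) :
    Summable fun n : ℕ => K ^ n / √(n.factorial : ℝ) := by
  refine Summable.of_nonneg_of_le (fun n => by positivity) (fun n => ?_)
    ((summable_geometric_of_lt_one (by norm_num : (0 : ℝ) ≤ 1 / 4) (by norm_num)).add
      (Real.summable_pow_div_factorial (4 * K ^ 2)))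
  have h1 : (K ^ n / √(n.factorial : ℝ)) = (1 / 2) ^ n * ((2 * K) ^ n / √(n.factorial : ℝ)) := by
    rw [mul_pow, ← mul_div_assoc, ← mul_assoc, ← mul_pow]; norm_num
  have h2 : ((2 * K) ^ n / √(n.factorial : ℝ)) ^ 2 = (4 * K ^ 2) ^ n / n.factorial := by
    rw [div_pow, Real.sq_sqrt (by positivity), ← pow_mul, mul_comm n 2, pow_mul, mul_pow]; norm_num
  have h3 : ((1 / 2 : ℝ) ^ n) ^ 2 = (1 / 4) ^ n := by
    rw [← pow_mul, mul_comm n 2, pow_mul]; norm_num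
  rw [h1, ← h2, ← h3]
  nlinarith [sq_nonneg ((1 / 2 : ℝ) ^ n - (2 * K) ^ n / √(n.factorial : ℝ)),
    sq_nonneg ((1 / 2 : ℝ) ^ n), sq_nonneg ((2 * K) ^ n / √(n.factorial : ℝ))]

/-- Coefficients which are absolutely summable with the weights `(‖η‖ + 1) R^{|η|}`. -/
def RapidDecay (X : MultiIndex → ℂ) : Prop :=
  ∀ R : ℕ, Summable fun η : MultiIndex => ((level η : ℝ) + 1) * (R : ℝ) ^ η.degree * ‖X η‖

theorem RapidDecay.add {X Y : MultiIndex → ℂ} (hX : RapidDecay X) (hY : RapidDecay Y) :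
    RapidDecay fun η => X η + Y η := fun R => by
  refine Summable.of_nonneg_of_le (fun η => by positivity) (fun η => ?_) ((hX R).add (hY R))
  rw [← mul_add]
  gcongr
  exact norm_add_le _ _

theorem RapidDecay.const_mul {X : MultiIndex → ℂ} (c : ℂ) (hX : RapidDecay X) :
    RapidDecay fun η => c * X η := fun R =>
  ((hX R).mul_left ‖c‖).congr fun η => by rw [norm_mul]; ring

theorem degree_lt_two_pow (η : MultiIndex) : (η.degree : ℝ) + 1 ≤ 2 ^ η.degree := by
  exact_mod_cast η.degree.lt_two_pow_self

/-- The factor √(η_k + 1) ≤ 2^{|η|} is paid for by passing from R to 2R, and raising the level by k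
costs at most a factor k + 1. This is why decay is demanded for all R at once. -/
theorem RapidDecay.creation {X : MultiIndex → ℂ} (hX : RapidDecay X) (k : ℕ+) :
    RapidDecay fun η => ((√(η k : ℝ) : ℝ) : ℂ) * X (η - Finsupp.single k 1) := fun R => by
  have hinj : Function.Injective fun μ : MultiIndex => μ + Finsupp.single k 1 :=
    add_left_injective _
  refine (hinj.summable_iff ?_).1 ?_
  · intro μ hμ
    have : μ k = 0 := by
      by_contra hne
      refine hμ ⟨μ - Finsupp.single k 1, ?_⟩
      exact tsub_add_cancel_of_le (Finsupp.single_le_iff.2 (Nat.pos_of_ne_zero hne))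
    simp [this]
  · refine Summable.of_nonneg_of_le (fun η => by simp only [Function.comp]; positivity)
      (fun η => ?_) ((hX (2 * R)).mul_left (((k : ℝ) + 1) * R))
    simp only [Function.comp, add_tsub_cancel_right, norm_mul, Complex.norm_real,
      Finsupp.add_apply, Finsupp.single_eq_same, level_add, level_single, map_add,
      Finsupp.degree_single, pow_succ, Real.norm_of_nonneg (Real.sqrt_nonneg _)]
    push_cast
    have h1 : √((η k : ℝ) + 1) ≤ 2 ^ η.degree := by
      refine (Real.sqrt_le_iff (y := (η k : ℝ) + 1).2 ⟨by positivity, ?_⟩).trans (le_trans ?_ (degree_lt_two_pow η))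
      · nlinarith [Nat.cast_nonneg (α := ℝ) (η k)]
      have : η k ≤ η.degree := Finsupp.le_degree k η
      exact_mod_cast Nat.succ_le_succ this
    have h2 : (level η : ℝ) + k * 1 + 1 ≤ (k + 1) * (level η + 1) := by
      have : (0 : ℝ) ≤ level η * k := by positivity
      linarith
    calc ((level η : ℝ) + k * 1 + 1) * (R ^ η.degree * R) * (√((η k : ℝ) + 1) * ‖X η‖)
        ≤ ((k + 1) * (level η + 1)) * (R ^ η.degree * R) * (2 ^ η.degree * ‖X η‖) := by gcongr
      _ = _ := by rw [mul_pow]; ring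

/-- The vacuum column is ∏ ω_i^{η_i}/√η_i!, the weight R^{|η|} is a product too, and ‖η‖ + 1 ≤ ∏ (1
+ i η_i). Hence the sum is bounded by a product over the modes, whose factor at i is 1 + O(i |ω_i|).
-/
theorem rapidDecay_vertexCoeff_zero (ω : ℤ → ℂ) (hω : Summable fun k : ℕ+ => (k : ℝ) * ‖ω k‖) :
    RapidDecay fun η => vertexCoeff ω η 0 := fun R => by
  obtain ⟨M, hM1, hM⟩ : ∃ M : ℝ, 1 ≤ M ∧ ∀ k : ℕ+, ‖ω k‖ ≤ M := by
    refine ⟨max 1 (∑' k : ℕ+, (k : ℝ) * ‖ω k‖), le_max_left _ _, fun k => ?_⟩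
    refine le_trans ?_ ((hω.le_tsum k fun j _ => by positivity).trans (le_max_right _ _))
    exact le_mul_of_one_le_left (norm_nonneg _) (by exact_mod_cast k.pos)
  have hC := summable_pow_div_sqrt_factorial (2 * R * M) (by positivity)
  set C := ∑' n : ℕ, (2 * R * M) ^ n / √(n.factorial : ℝ)
  refine Summable.of_nonneg_of_le (fun η => by positivity) (fun η => ?_)
    (summable_finsupp_prod (fun (i : ℕ+) n => (1 + (i : ℝ) * n) *
      (R ^ n * (‖ω i‖ ^ n / √(n.factorial : ℝ)))) (fun i n => by positivity) (hω.mul_right C)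
      fun i N => ?_)
  · beta_reduce
    rw [vertexCoeff_eq_prod ω η 0 (Finset.Subset.refl _) (by simp), Finsupp.prod,
      Finset.prod_mul_distrib, Finset.prod_mul_distrib, norm_prod, Finset.prod_pow_eq_pow_sum,
      ← Finsupp.degree_apply, mul_assoc]
    refine mul_le_mul ?_ (le_of_eq ?_) (by positivity) (by positivity)
    · refine le_trans (le_of_eq ?_) (one_add_sum_le_prod _ _ fun i => by positivity)
      rw [level, Finsupp.sum, add_comm]; push_cast; rfl
    · congr 1
      refine Finset.prod_congr rfl fun i _ => ?_
      rw [Finsupp.zero_apply, modeCoeff_zero_right, norm_div, norm_pow, Complex.norm_real,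
        Real.norm_of_nonneg (Real.sqrt_nonneg _)]
  -- One factor |ω_i| is kept for the summability over i, the other powers are absorbed by M ≥ 1,
  -- and 1 + i(n+1) ≤ i 2^{n+1} explains the 2 in 2RM.
  · have hterm : ∀ n : ℕ, (1 + (i : ℝ) * (n + 1 : ℕ)) *
        (R ^ (n + 1) * (‖ω i‖ ^ (n + 1) / √((n + 1).factorial : ℝ))) ≤
        (i * ‖ω i‖) * ((2 * R * M) ^ (n + 1) / √((n + 1).factorial : ℝ)) := by
      intro n
      have h1 : 1 + (i : ℝ) * (n + 1 : ℕ) ≤ i * 2 ^ (n + 1) := by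
        have h : n + 1 + 1 ≤ 2 ^ (n + 1) := (n + 1).lt_two_pow_self
        have hi : 1 ≤ (i : ℕ) := i.pos
        have : 1 + (i : ℕ) * (n + 1) ≤ i * 2 ^ (n + 1) := by nlinarith
        exact_mod_cast this
      have h2 : ‖ω i‖ ^ (n + 1) ≤ ‖ω i‖ * M ^ (n + 1) := by
        rw [pow_succ', pow_succ']
        refine mul_le_mul_of_nonneg_left ?_ (norm_nonneg _)
        calc ‖ω i‖ ^ n ≤ M ^ n := pow_le_pow_left₀ (norm_nonneg _) (hM i) n
          _ ≤ M * M ^ n := le_mul_of_one_le_left (by positivity) hM1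
      calc _ ≤ (i * 2 ^ (n + 1)) * (R ^ (n + 1) *
            (‖ω i‖ * M ^ (n + 1) / √((n + 1).factorial : ℝ))) := by gcongr
        _ = _ := by rw [mul_pow, mul_pow]; ring
    refine (Finset.sum_le_sum fun n _ => hterm n).trans ?_
    rw [← Finset.mul_sum]
    gcongr
    refine le_trans ?_ (hC.sum_le_tsum (Finset.range (N + 1)) fun n _ => by positivity)
    rw [Finset.sum_range_succ']
    exact le_add_of_nonneg_right (by positivity)

theorem multiIndex_induction {P : MultiIndex → Prop} (h0 : P 0)
    (h : ∀ η (k : ℕ+), P η → P (η + Finsupp.single k 1)) (η : MultiIndex) : P η := by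
  induction η using Finsupp.induction₂ with
  | zero => exact h0
  | add_single a b f h1 h2 hf =>
    clear h1 h2
    induction b with
    | zero => simpa using hf
    | succ b ih => rw [Finsupp.single_add, ← add_assoc]; exact h _ _ ih

/-- By the right recursion the column ν + e_k is a combination of the column ν and its image under a
creation operator, both rapidly decaying. The entries ω_{-k} enter only as constants, so nothing is
asked of their growth. -/
theorem rapidDecay_vertexCoeff (ω : ℤ → ℂ) (hω : Summable fun k : ℕ+ => (k : ℝ) * ‖ω k‖)
    (ν : MultiIndex) : RapidDecay fun η => vertexCoeff ω η ν := by
  induction ν using multiIndex_induction with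
  | h0 => exact rapidDecay_vertexCoeff_zero ω hω
  | h ν k ih =>
    have hne : ((√((ν k : ℝ) + 1) : ℝ) : ℂ) ≠ 0 := by
      rw [Complex.ofReal_ne_zero, Real.sqrt_ne_zero']; positivity
    have h := ((ih.const_mul (-ω (-(k : ℤ)))).add (ih.creation k)).const_mul
      ((√((ν k : ℝ) + 1) : ℝ) : ℂ)⁻¹
    refine (funext fun η => ?_ : (fun η => vertexCoeff ω η (ν + Finsupp.single k 1)) = _) ▸ h
    rw [← vertexCoeff_add_single_right, inv_mul_cancel_left₀ hne]

/-! ### Vertex operators on finite vectors -/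

theorem RapidDecay.summable_norm {X : MultiIndex → ℂ} (hX : RapidDecay X) :
    Summable fun η => ‖X η‖ := by
  refine Summable.of_nonneg_of_le (fun η => norm_nonneg _) (fun η => ?_) (hX 1)
  rw [Nat.cast_one, one_pow, mul_one]
  exact le_mul_of_one_le_left (norm_nonneg _) (by simp)

theorem summable_sq_of_summable {ι : Type*} {f : ι → ℝ} (h0 : ∀ i, 0 ≤ f i) (hf : Summable f) :
    Summable fun i => f i ^ 2 := by
  refine Summable.of_nonneg_of_le (fun i => by positivity) (fun i => ?_) (hf.mul_left (∑' j, f j))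
  rw [sq]
  exact mul_le_mul_of_nonneg_right (hf.le_tsum i fun j _ => h0 j) (h0 i)

theorem RapidDecay.memlp {X : MultiIndex → ℂ} (hX : RapidDecay X) : Memℓp X 2 :=
  memlp_two (summable_sq_of_summable (fun _ => norm_nonneg _) hX.summable_norm)

theorem norm_basisVec (α β : ℂ) (η : MultiIndex) : ‖basisVec α β η‖ = 1 := by
  rw [basisVec, lp.norm_single (by norm_num)]; simp

theorem basisVec_apply (α β : ℂ) (η μ : MultiIndex) :
    basisVec α β η μ = if μ = η then 1 else 0 := by
  classical
  rw [basisVec, lp.single_apply, Pi.single_apply]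

theorem hasSum_smul_basisVec {α β : ℂ} (Ψ : FockSpace α β) :
    HasSum (fun η => Ψ η • basisVec α β η) Ψ := by
  refine (lp.hasSum_single (by simp) Ψ).congr_fun ?_
  intro η
  rw [basisVec, ← lp.single_smul]
  simp

theorem norm_le_tsum {α β : ℂ} (Ψ : FockSpace α β) (h : Summable fun η => ‖Ψ η‖) :
    ‖Ψ‖ ≤ ∑' η, ‖Ψ η‖ := by
  have hs : ∀ η, ‖Ψ η • basisVec α β η‖ = ‖Ψ η‖ := fun η => by
    rw [norm_smul, norm_basisVec, mul_one]
  have h' := norm_tsum_le_tsum_norm (f := fun η => Ψ η • basisVec α β η) (by simpa only [hs] using h)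
  rwa [(hasSum_smul_basisVec Ψ).tsum_eq, tsum_congr hs] at h'

/-- The vector `V(ω) Φ_ν`. -/
def vertexVec (α β : ℂ) {ω : ℤ → ℂ} (hω : Summable fun k : ℕ+ => (k : ℝ) * ‖ω k‖)
    (ν : MultiIndex) : FockSpace α β :=
  ⟨fun η => vertexCoeff ω η ν, (rapidDecay_vertexCoeff ω hω ν).memlp⟩

theorem basisVec_vertexVec_mem (α β : ℂ) {ω : ℤ → ℂ}
    (hω : Summable fun k : ℕ+ => (k : ℝ) * ‖ω k‖) (ν : MultiIndex) :
    (basisVec α β ν, vertexVec α β hω ν) ∈ (vertexOp α β ω).graph := by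
  rw [vertexOp_graph]
  intro η
  -- The truncated sums are constant as soon as N ≥ ‖ν‖.
  refine tendsto_const_nhds.congr' ?_
  filter_upwards [eventually_ge_atTop (level ν)] with N hN
  rw [Finset.sum_eq_single ν]
  · simp [basisVec_apply, vertexVec]
  · intro μ _ hμ
    simp [basisVec_apply, hμ]
  · intro h
    exact absurd ((finite_level_le N).mem_toFinset.2 hN) h

theorem finiteSpace_le_vertexOp_domain (α β : ℂ) {ω : ℤ → ℂ}
    (hω : Summable fun k : ℕ+ => (k : ℝ) * ‖ω k‖) :
    finiteSpace α β ≤ (vertexOp α β ω).domain :=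
  Submodule.span_le.2 (by
    rintro _ ⟨η, rfl⟩
    exact LinearPMap.mem_domain_of_mem_graph (basisVec_vertexVec_mem α β hω η))

/-- The restriction of `V(ω)` to the finite vectors. -/
def vertexF (α β : ℂ) {ω : ℤ → ℂ} (hω : Summable fun k : ℕ+ => (k : ℝ) * ‖ω k‖) :
    finiteSpace α β →ₗ[ℂ] FockSpace α β :=
  (vertexOp α β ω).toFun ∘ₗ Submodule.inclusion (finiteSpace_le_vertexOp_domain α β hω)

theorem ev_vertexOp {α β : ℂ} {ω : ℤ → ℂ} (hω : Summable fun k : ℕ+ => (k : ℝ) * ‖ω k‖)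
    (Φ : finiteSpace α β) : ev (vertexOp α β ω) (Φ : FockSpace α β) = vertexF α β hω Φ :=
  ev_of_mem _ (finiteSpace_le_vertexOp_domain α β hω Φ.2)

theorem vertexF_basisF_apply {α β : ℂ} {ω : ℤ → ℂ}
    (hω : Summable fun k : ℕ+ => (k : ℝ) * ‖ω k‖) (η ν : MultiIndex) :
    vertexF α β hω (basisF α β ν) η = vertexCoeff ω η ν := by
  obtain ⟨y, hy1, hy2⟩ := (LinearPMap.mem_graph_iff _).1 (basisVec_vertexVec_mem α β hω ν)
  have : vertexF α β hω (basisF α β ν) = vertexVec α β hω ν := by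
    refine Eq.trans ?_ hy2
    exact congrArg (vertexOp α β ω) (Subtype.ext hy1.symm)
  rw [this]; rfl

theorem rapidDecay_vertexF {α β : ℂ} {ω : ℤ → ℂ}
    (hω : Summable fun k : ℕ+ => (k : ℝ) * ‖ω k‖) (Φ : finiteSpace α β) :
    RapidDecay (vertexF α β hω Φ) := by
  induction Φ using finiteSpace_induction with
  | hb ν =>
    have h : ⇑(vertexF α β hω (basisF α β ν)) = fun η => vertexCoeff ω η ν :=
      funext fun η => vertexF_basisF_apply hω η ν
    exact h ▸ rapidDecay_vertexCoeff ω hω ν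
  | h0 => intro R; simp [summable_zero]
  | ha x y hx hy => rw [map_add]; exact hx.add hy
  | hs c x hx => rw [map_smul]; exact hx.const_mul c

/-- The action of `a_n` on sequences of coefficients, with `a` in the place of `α`. -/
def coordMode (a : ℂ) : ℤ → (MultiIndex → ℂ) →ₗ[ℂ] (MultiIndex → ℂ)
  | Int.ofNat 0 => a • LinearMap.id
  | Int.ofNat (m + 1) =>
    { toFun := fun X μ => ((√((m.succPNat : ℝ) * ((μ m.succPNat : ℝ) + 1)) : ℝ) : ℂ) *
        X (μ + Finsupp.single m.succPNat 1)
      map_add' := fun _ _ => funext fun _ => mul_add _ _ _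
      map_smul' := fun _ _ => funext fun _ => mul_left_comm _ _ _ }
  | Int.negSucc m =>
    { toFun := fun X μ => ((√((m.succPNat : ℝ) * (μ m.succPNat : ℝ)) : ℝ) : ℂ) *
        X (μ - Finsupp.single m.succPNat 1)
      map_add' := fun _ _ => funext fun _ => mul_add _ _ _
      map_smul' := fun _ _ => funext fun _ => mul_left_comm _ _ _ }

theorem coordMode_zero_apply (a : ℂ) (X : MultiIndex → ℂ) (μ : MultiIndex) :
    coordMode a 0 X μ = a * X μ := rfl

theorem coordMode_pos_apply (a : ℂ) (k : ℕ+) (X : MultiIndex → ℂ) (μ : MultiIndex) :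
    coordMode a k X μ =
      ((√((k : ℝ) * ((μ k : ℝ) + 1)) : ℝ) : ℂ) * X (μ + Finsupp.single k 1) := by
  obtain ⟨m, rfl⟩ : ∃ m : ℕ, k = m.succPNat := ⟨k.natPred, by simp⟩
  rfl

theorem coordMode_neg_apply (a : ℂ) (k : ℕ+) (X : MultiIndex → ℂ) (μ : MultiIndex) :
    coordMode a (-(k : ℤ)) X μ =
      ((√((k : ℝ) * (μ k : ℝ)) : ℝ) : ℂ) * X (μ - Finsupp.single k 1) := by
  obtain ⟨m, rfl⟩ : ∃ m : ℕ, k = m.succPNat := ⟨k.natPred, by simp⟩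
  rfl

theorem ev_mode_apply {α β : ℂ} : ∀ (n : ℤ) {Ψ : FockSpace α β}, Ψ ∈ (mode α β n).domain →
    ∀ μ, ev (mode α β n) Ψ μ = coordMode α n Ψ μ
  | Int.ofNat 0, _, h, _ => by rw [ev_of_mem _ h]; rfl
  | Int.ofNat (_ + 1), _, h, _ => by rw [ev_of_mem _ h]; rfl
  | Int.negSucc _, _, h, _ => by rw [ev_of_mem _ h]; rfl

theorem ev_mode_coe {α β : ℂ} (n : ℤ) (Φ : finiteSpace α β) :
    ev (mode α β n) (Φ : FockSpace α β) = modeF α β n Φ :=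
  ev_of_mem _ (finiteSpace_le_mode_domain α β n Φ.2)

theorem modeF_apply {α β : ℂ} (n : ℤ) (Φ : finiteSpace α β) (μ : MultiIndex) :
    (modeF α β n Φ : FockSpace α β) μ = coordMode α n (Φ : FockSpace α β) μ := by
  rw [← ev_mode_coe, ev_mode_apply n (finiteSpace_le_mode_domain α β n Φ.2)]

theorem mode_neg_domain (α β : ℂ) (k : ℕ+) :
    (mode α β (-(k : ℤ))).domain = modeDomain α β k := by
  obtain ⟨m, rfl⟩ : ∃ m : ℕ, k = m.succPNat := ⟨k.natPred, by simp⟩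
  rfl

theorem theta_pos (ω : ℤ → ℂ) (γ : ℂ) (k : ℕ+) :
    theta ω γ k = ((√(k : ℝ) : ℝ) : ℂ) * ω k := by
  simp [theta]

theorem theta_neg (ω : ℤ → ℂ) (γ : ℂ) (k : ℕ+) :
    theta ω γ (-(k : ℤ)) = ((√(k : ℝ) : ℝ) : ℂ) * ω (-(k : ℤ)) := by
  simp [theta]

/-- The commutation relation `[a_n, T_γ V(ω)] = θ_n T_γ V(ω)`. -/
theorem coordMode_vertexF {α β : ℂ} {ω : ℤ → ℂ}
    (hω : Summable fun k : ℕ+ => (k : ℝ) * ‖ω k‖) (γ : ℂ) (n : ℤ) (Φ : finiteSpace α β)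
    (μ : MultiIndex) :
    coordMode (α + γ) n (vertexF α β hω Φ) μ =
      vertexF α β hω (modeF α β n Φ) μ + theta ω γ n * vertexF α β hω Φ μ := by
  induction Φ using finiteSpace_induction with
  | h0 =>
    simp only [map_zero, lp.coeFn_zero, Pi.zero_apply, mul_zero, add_zero]
  | ha x y hx hy =>
    simp only [map_add, lp.coeFn_add, Pi.add_apply] at hx hy ⊢
    rw [hx, hy]; ring
  | hs c x hx =>
    simp only [map_smul, lp.coeFn_smul, Pi.smul_apply, smul_eq_mul] at hx ⊢
    rw [hx]; ring
  -- On Φ_ν the relation is the right recursion for n < 0, the shift of the charge for n = 0 and the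
  -- left recursion for n > 0.
  | hb ν =>
    rcases lt_trichotomy n 0 with hn | rfl | hn
    · obtain ⟨k, rfl⟩ : ∃ k : ℕ+, n = -(k : ℤ) := ⟨⟨(-n).toNat, by omega⟩, by simp; omega⟩
      have h := vertexCoeff_add_single_right ω k μ ν
      rw [coordMode_neg_apply, modeF_neg_basisF, theta_neg, map_smul, lp.coeFn_smul,
        Pi.smul_apply, smul_eq_mul, vertexF_basisF_apply, vertexF_basisF_apply,
        vertexF_basisF_apply, Real.sqrt_mul (by positivity), Real.sqrt_mul (by positivity)]
      push_cast
      linear_combination (-((√(k : ℝ) : ℝ) : ℂ)) * h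
    · have : modeF α β 0 (basisF α β ν) = α • basisF α β ν := rfl
      rw [coordMode_zero_apply, this, map_smul, lp.coeFn_smul, Pi.smul_apply, smul_eq_mul]
      simp [theta]; ring
    · obtain ⟨k, rfl⟩ : ∃ k : ℕ+, n = k := ⟨⟨n.toNat, by omega⟩, by simp; omega⟩
      have h := vertexCoeff_add_single_left ω k μ ν
      rw [coordMode_pos_apply, modeF_pos_basisF, theta_pos, map_smul, lp.coeFn_smul,
        Pi.smul_apply, smul_eq_mul, vertexF_basisF_apply, vertexF_basisF_apply,
        vertexF_basisF_apply, Real.sqrt_mul (by positivity), Real.sqrt_mul (by positivity)]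
      push_cast
      linear_combination (((√(k : ℝ) : ℝ) : ℂ)) * h

/-! ### Modes applied to rapidly decaying vectors -/

theorem RapidDecay.mem_modeDomain {α β : ℂ} {Ψ : FockSpace α β} (h : RapidDecay Ψ) (k : ℕ+) :
    Ψ ∈ modeDomain α β k := by
  have hs : Summable fun η : MultiIndex => ((η k : ℝ) + 1) * ‖Ψ η‖ := by
    refine Summable.of_nonneg_of_le (fun η => by positivity) (fun η => ?_) (h 2)
    gcongr
    have h1 : η k ≤ η.degree := Finsupp.le_degree k η
    have h2 : (η k : ℝ) + 1 ≤ η.degree + 1 := by exact_mod_cast Nat.succ_le_succ h1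
    refine (h2.trans (degree_lt_two_pow η)).trans ?_
    push_cast
    exact le_mul_of_one_le_left (by positivity) (by simp)
  refine Summable.of_nonneg_of_le (fun η => by positivity) (fun η => ?_)
    (summable_sq_of_summable (fun η => by positivity) hs)
  rw [mul_pow]
  gcongr
  have : (0 : ℝ) ≤ η k := by positivity
  nlinarith

/-- A bound for `‖a_{-k} Ψ‖ / √k`. -/
def creationBound (X : MultiIndex → ℂ) : ℝ :=
  ∑' η : MultiIndex, ((level η : ℝ) + 1) * (2 : ℕ) ^ η.degree * ‖X η‖

theorem creationBound_nonneg (X : MultiIndex → ℂ) : 0 ≤ creationBound X :=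
  tsum_nonneg fun η => by positivity

/-- The ℓ² norm is estimated by the ℓ¹ norm, in which √(k (η_k + 1)) ≤ √k · 2^{|η|} separates k from
Ψ. Growth of order √k is what the coefficients θ_{n+k} can absorb. -/
theorem norm_creation_le {α β : ℂ} {Ψ : FockSpace α β} (h : RapidDecay Ψ) (k : ℕ+) :
    ‖ev (mode α β (-(k : ℤ))) Ψ‖ ≤ √(k : ℝ) * creationBound Ψ := by
  have hdom : Ψ ∈ (mode α β (-(k : ℤ))).domain := by
    rw [mode_neg_domain]; exact h.mem_modeDomain k
  have hinj : Function.Injective fun μ : MultiIndex => μ + Finsupp.single k 1 :=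
    add_left_injective _
  have hsupp : ∀ μ ∉ Set.range (fun μ : MultiIndex => μ + Finsupp.single k 1),
      ‖ev (mode α β (-(k : ℤ))) Ψ μ‖ = 0 := by
    intro μ hμ
    have : μ k = 0 := by
      by_contra hne
      refine hμ ⟨μ - Finsupp.single k 1, ?_⟩
      exact tsub_add_cancel_of_le (Finsupp.single_le_iff.2 (Nat.pos_of_ne_zero hne))
    rw [ev_mode_apply _ hdom, coordMode_neg_apply, this]; simp
  have hle : ∀ η : MultiIndex, ‖ev (mode α β (-(k : ℤ))) Ψ (η + Finsupp.single k 1)‖ ≤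
      √(k : ℝ) * (((level η : ℝ) + 1) * (2 : ℕ) ^ η.degree * ‖Ψ η‖) := by
    intro η
    rw [ev_mode_apply _ hdom, coordMode_neg_apply, add_tsub_cancel_right, norm_mul,
      Complex.norm_real, Real.norm_of_nonneg (Real.sqrt_nonneg _), Real.sqrt_mul (by positivity),
      mul_assoc, ← mul_assoc]
    rw [mul_assoc]
    gcongr
    simp only [Finsupp.add_apply, Finsupp.single_eq_same]
    push_cast
    have h1 : η k ≤ η.degree := Finsupp.le_degree k η
    have h2 : (η k : ℝ) + 1 ≤ η.degree + 1 := by exact_mod_cast Nat.succ_le_succ h1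
    have h3 : √((η k : ℝ) + 1) ≤ (η k : ℝ) + 1 := Real.sqrt_le_iff.2
      ⟨by positivity, by nlinarith [Nat.cast_nonneg (α := ℝ) (η k)]⟩
    refine ((h3.trans h2).trans (degree_lt_two_pow η)).trans ?_
    exact le_mul_of_one_le_left (by positivity) (by simp)
  have hs := (h 2).mul_left √(k : ℝ)
  have hsum : Summable ((fun μ => ‖ev (mode α β (-(k : ℤ))) Ψ μ‖) ∘
      fun μ : MultiIndex => μ + Finsupp.single k 1) :=
    Summable.of_nonneg_of_le (fun η => norm_nonneg _) hle hs
  refine (norm_le_tsum _ ((hinj.summable_iff hsupp).1 hsum)).trans ?_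
  rw [← hinj.tsum_eq (Function.support_subset_iff'.2 hsupp), creationBound, ← tsum_mul_left]
  exact hsum.tsum_le_tsum hle hs

/-! ### The closure of an operator on the finite vectors -/

section Closure

variable {α β : ℂ} {T : finiteSpace α β →ₗ[ℂ] finiteSpace α β}
  {ρ : MultiIndex → FockSpace α β →L[ℂ] ℂ}

/-- A relation `p.2 μ = ρ μ p.1` with continuous ρ μ is a closed condition, so it survives on the
closure of the graph; there it determines p.2 from p.1. -/
theorem isClosable_of_rows
    (h : ∀ (Φ : finiteSpace α β) μ, (T Φ : FockSpace α β) μ = ρ μ Φ) :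
    (⟨finiteSpace α β, (finiteSpace α β).subtype ∘ₗ T⟩ :
      FockSpace α β →ₗ.[ℂ] FockSpace α β).IsClosable ∧
    ∀ p ∈ (⟨finiteSpace α β, (finiteSpace α β).subtype ∘ₗ T⟩ :
      FockSpace α β →ₗ.[ℂ] FockSpace α β).graph.topologicalClosure, ∀ μ, p.2 μ = ρ μ p.1 := by
  set f : FockSpace α β →ₗ.[ℂ] FockSpace α β :=
    ⟨finiteSpace α β, (finiteSpace α β).subtype ∘ₗ T⟩
  have key : ∀ p ∈ f.graph.topologicalClosure, ∀ μ, p.2 μ = ρ μ p.1 := by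
    intro p hp μ
    have hcl : IsClosed {p : FockSpace α β × FockSpace α β | p.2 μ = ρ μ p.1} :=
      isClosed_eq ((lp.evalCLM ℂ (fun _ : MultiIndex => ℂ) 2 μ).continuous.comp continuous_snd)
        ((ρ μ).continuous.comp continuous_fst)
    refine closure_minimal (fun q hq => ?_) hcl hp
    obtain ⟨y, hy1, hy2⟩ := (LinearPMap.mem_graph_iff _).1 hq
    change q.2 μ = ρ μ q.1
    rw [← hy1, ← hy2]
    exact h y μ
  refine ⟨⟨f.graph.topologicalClosure.toLinearPMap, ?_⟩, key⟩
  refine (Submodule.toLinearPMap_graph_eq _ fun p hp h0 => ?_).symm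
  refine lp.ext (funext fun μ => ?_)
  rw [key p hp μ, h0, map_zero]
  rfl

theorem closure_apply_of_rows
    (h : ∀ (Φ : finiteSpace α β) μ, (T Φ : FockSpace α β) μ = ρ μ Φ) {Ψ : FockSpace α β}
    (hΨ : Ψ ∈ (LinearPMap.closure ⟨finiteSpace α β, (finiteSpace α β).subtype ∘ₗ T⟩ :
      FockSpace α β →ₗ.[ℂ] FockSpace α β).domain) (μ : MultiIndex) :
    ev (LinearPMap.closure ⟨finiteSpace α β, (finiteSpace α β).subtype ∘ₗ T⟩) Ψ μ = ρ μ Ψ := by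
  obtain ⟨h1, h2⟩ := isClosable_of_rows h
  rw [ev_of_mem _ hΨ]
  refine h2 (Ψ, _) ?_ μ
  rw [h1.graph_closure_eq_closure_graph]
  exact LinearPMap.mem_graph _ ⟨Ψ, hΨ⟩

/-- The partial sums of ∑ Ψ_η Φ_η are finite vectors, and the column bound together with rapid decay
makes their images converge absolutely; the limiting pair lies in the closed graph. -/
theorem mem_closure_domain_of_rows
    (h : ∀ (Φ : finiteSpace α β) μ, (T Φ : FockSpace α β) μ = ρ μ Φ) {Ψ : FockSpace α β}
    (hΨ : RapidDecay Ψ) {C : ℝ} {R : ℕ}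
    (hT : ∀ η, ‖T (basisF α β η)‖ ≤ C * (((level η : ℝ) + 1) * (R : ℝ) ^ η.degree)) :
    Ψ ∈ (LinearPMap.closure ⟨finiteSpace α β, (finiteSpace α β).subtype ∘ₗ T⟩ :
      FockSpace α β →ₗ.[ℂ] FockSpace α β).domain := by
  obtain ⟨h1, -⟩ := isClosable_of_rows h
  have hs : Summable fun η => Ψ η • (T (basisF α β η) : FockSpace α β) := by
    refine Summable.of_norm_bounded ((hΨ R).mul_left C) fun η => ?_
    rw [norm_smul]
    calc ‖Ψ η‖ * ‖(T (basisF α β η) : FockSpace α β)‖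
        ≤ ‖Ψ η‖ * (C * (((level η : ℝ) + 1) * (R : ℝ) ^ η.degree)) := by
          gcongr; exact hT η
      _ = _ := by ring
  refine LinearPMap.mem_domain_of_mem_graph (y := ∑' η, Ψ η • (T (basisF α β η) : FockSpace α β)) ?_
  rw [← h1.graph_closure_eq_closure_graph]
  have hlim := (hasSum_smul_basisVec Ψ).prodMk hs.hasSum
  refine mem_closure_of_tendsto hlim (Eventually.of_forall fun s => ?_)
  refine (LinearPMap.mem_graph_iff _).2 ⟨∑ η ∈ s, Ψ η • basisF α β η, ?_, ?_⟩
  · rw [Prod.fst_sum, AddSubmonoidClass.coe_finsetSum]; rfl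
  · rw [Prod.snd_sum]
    change ((T (∑ η ∈ s, Ψ η • basisF α β η) : finiteSpace α β) : FockSpace α β) = _
    rw [map_sum, AddSubmonoidClass.coe_finsetSum]
    refine Finset.sum_congr rfl fun η _ => ?_
    rw [map_smul]; rfl

end Closure

/-! ### Rows and columns of the Virasoro operators -/

theorem coordMode_eq_mul (a : ℂ) : ∀ (n : ℤ) (μ : MultiIndex), ∃ (c : ℂ) (ξ : MultiIndex),
    ∀ X, coordMode a n X μ = c * X ξ
  | Int.ofNat 0, μ => ⟨a, μ, fun _ => rfl⟩
  | Int.ofNat (_ + 1), _ => ⟨_, _, fun _ => rfl⟩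
  | Int.negSucc _, _ => ⟨_, _, fun _ => rfl⟩

theorem exists_coordMode_clm (α β a : ℂ) (n : ℤ) (μ : MultiIndex) :
    ∃ ρ : FockSpace α β →L[ℂ] ℂ, ∀ Ψ : FockSpace α β, coordMode a n Ψ μ = ρ Ψ := by
  obtain ⟨c, ξ, h⟩ := coordMode_eq_mul a n μ
  exact ⟨c • lp.evalCLM ℂ (fun _ : MultiIndex => ℂ) 2 ξ, fun Ψ => h Ψ⟩

theorem exists_coordMode_comp_clm (α β a : ℂ) (m n : ℤ) (μ : MultiIndex) :
    ∃ ρ : FockSpace α β →L[ℂ] ℂ, ∀ Ψ : FockSpace α β,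
      coordMode a m (coordMode a n Ψ) μ = ρ Ψ := by
  obtain ⟨c, ξ, h⟩ := coordMode_eq_mul a m μ
  obtain ⟨c', ξ', h'⟩ := coordMode_eq_mul a n ξ
  exact ⟨(c * c') • lp.evalCLM ℂ (fun _ : MultiIndex => ℂ) 2 ξ', fun Ψ => by
    rw [h, h', ← mul_assoc]; rfl⟩

theorem pointwiseSum_apply {α β : ℂ} {ι : Type*} (T : ι → finiteSpace α β →ₗ[ℂ] finiteSpace α β)
    (h : ∀ x, {i | T i x ≠ 0}.Finite) (x : finiteSpace α β) (μ : MultiIndex) (s : Finset ι)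
    (hs : ∀ i ∉ s, (T i x : FockSpace α β) μ = 0) :
    (pointwiseSum T h x : FockSpace α β) μ = ∑ i ∈ s, (T i x : FockSpace α β) μ := by
  classical
  have h1 : pointwiseSum T h x = ∑ i ∈ (h x).toFinset ∪ s, T i x := by
    refine finsum_eq_sum_of_support_subset _ fun i hi => ?_
    simp only [Finset.coe_union, Set.Finite.coe_toFinset]
    exact Or.inl hi
  rw [h1, AddSubmonoidClass.coe_finsetSum, lp.coeFn_sum, Finset.sum_apply]
  exact (Finset.sum_subset Finset.subset_union_right fun i _ hi => hs i hi).symm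

/-- The row vanishes once the creator among the two modes has an index not occupied in μ. For very
negative k the creator stands on the right; n ≠ 0 keeps the two indices distinct, so the annihilator
on the left does not fill the gap. No decay of X is involved, so the cutoff serves infinite vectors
as well. -/
theorem coordMode_comp_eq_zero (a : ℂ) {n : ℤ} (hn : n ≠ 0) (μ : MultiIndex) :
    ∃ M : ℕ, ∀ k : ℤ, (k < -M ∨ M < k) → ∀ X,
      coordMode a (-k) (coordMode a (n + k) X) μ = 0 := by
  obtain ⟨K, hK⟩ := exists_bound μ
  refine ⟨K + n.natAbs, fun k hk X => ?_⟩
  rcases hk with hk | hk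
  · obtain ⟨j, hj⟩ : ∃ j : ℕ+, (j : ℤ) = -k := ⟨⟨(-k).toNat, by omega⟩, by simp; omega⟩
    obtain ⟨i, hi⟩ : ∃ i : ℕ+, -(i : ℤ) = n + k :=
      ⟨⟨(-(n + k)).toNat, by omega⟩, by simp; omega⟩
    have hij : i ≠ j := by rintro rfl; omega
    have : μ i = 0 := hK i (by omega)
    rw [← hi, ← hj, coordMode_pos_apply, coordMode_neg_apply]
    simp [this, Finsupp.single_eq_of_ne hij]
  · obtain ⟨j, hj⟩ : ∃ j : ℕ+, -(j : ℤ) = -k := ⟨⟨k.toNat, by omega⟩, by simp; omega⟩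
    have : μ j = 0 := hK j (by omega)
    rw [← hj, coordMode_neg_apply]
    simp [this]

theorem virasoroF_apply (α β : ℂ) {n : ℤ} (hn : n ≠ 0) (μ : MultiIndex) (s : Finset ℤ)
    (hs : ∀ k ∉ s, ∀ X, coordMode α (-k) (coordMode α (n + k) X) μ = 0)
    (Φ : finiteSpace α β) :
    (virasoroF α β n Φ : FockSpace α β) μ =
      1 / 2 * ∑ k ∈ s, coordMode α (-k) (coordMode α (n + k) (Φ : FockSpace α β)) μ +
        n * β * coordMode α n (Φ : FockSpace α β) μ := by
  have hc : ∀ k, ((modeF α β (-k) ∘ₗ modeF α β (n + k)) Φ : FockSpace α β) μ =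
      coordMode α (-k) (coordMode α (n + k) (Φ : FockSpace α β)) μ := by
    intro k
    rw [LinearMap.comp_apply, modeF_apply]
    exact congrArg (fun X => coordMode α (-k) X μ) (funext fun ξ => modeF_apply (n + k) Φ ξ)
  rw [virasoroF, dif_neg hn]
  change (1 / 2 : ℂ) * (pointwiseSum _ _ Φ : FockSpace α β) μ +
    (n * β) * (modeF α β n Φ : FockSpace α β) μ = _
  rw [pointwiseSum_apply _ _ _ _ s fun k hk => by rw [hc]; exact hs k hk _, modeF_apply]
  simp only [hc]

theorem virasoroF_zero_apply (α β : ℂ) (μ : MultiIndex) (Φ : finiteSpace α β) :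
    (virasoroF α β 0 Φ : FockSpace α β) μ = (α ^ 2 - β ^ 2) / 2 * (Φ : FockSpace α β) μ +
      ∑ k ∈ μ.support, coordMode α (-(k : ℤ)) (coordMode α k (Φ : FockSpace α β)) μ := by
  have hc : ∀ k : ℕ+, ((modeF α β (-(k : ℤ)) ∘ₗ modeF α β k) Φ : FockSpace α β) μ =
      coordMode α (-(k : ℤ)) (coordMode α k (Φ : FockSpace α β)) μ := by
    intro k
    rw [LinearMap.comp_apply, modeF_apply]
    exact congrArg (fun X => coordMode α (-(k : ℤ)) X μ) (funext fun ξ => modeF_apply k Φ ξ)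
  rw [virasoroF, dif_pos rfl]
  change ((α ^ 2 - β ^ 2) / 2) * (Φ : FockSpace α β) μ +
    (pointwiseSum _ _ Φ : FockSpace α β) μ = _
  rw [pointwiseSum_apply _ _ _ _ μ.support fun k hk => ?_]
  · simp only [hc]
  · rw [hc, coordMode_neg_apply, Finsupp.notMem_support_iff.1 hk]; simp

theorem exists_virasoro_rows (α β : ℂ) (n : ℤ) :
    ∃ ρ : MultiIndex → FockSpace α β →L[ℂ] ℂ,
      ∀ (Φ : finiteSpace α β) μ, (virasoroF α β n Φ : FockSpace α β) μ = ρ μ Φ := by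
  suffices h : ∀ μ, ∃ ρ : FockSpace α β →L[ℂ] ℂ,
      ∀ (Φ : finiteSpace α β), (virasoroF α β n Φ : FockSpace α β) μ = ρ Φ by
    choose ρ hρ using h
    exact ⟨ρ, fun Φ μ => hρ μ Φ⟩
  intro μ
  rcases eq_or_ne n 0 with rfl | hn
  · choose ρ hρ using fun k : ℕ+ => exists_coordMode_comp_clm α β α (-(k : ℤ)) k μ
    refine ⟨((α ^ 2 - β ^ 2) / 2) • lp.evalCLM ℂ (fun _ : MultiIndex => ℂ) 2 μ +
      ∑ k ∈ μ.support, ρ k, fun Φ => ?_⟩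
    rw [virasoroF_zero_apply]
    simp only [hρ, add_apply, sum_apply]
    rfl
  · obtain ⟨M, hM⟩ := coordMode_comp_eq_zero α hn μ
    choose ρ hρ using fun k : ℤ => exists_coordMode_comp_clm α β α (-k) (n + k) μ
    obtain ⟨σ, hσ⟩ := exists_coordMode_clm α β α n μ
    refine ⟨(1 / 2 : ℂ) • ∑ k ∈ Finset.Icc (-(M : ℤ)) M, ρ k + (n * β : ℂ) • σ, fun Φ => ?_⟩
    rw [virasoroF_apply α β hn μ (Finset.Icc (-(M : ℤ)) M) fun k hk => hM k ?_]
    · simp only [hρ, hσ, add_apply, smul_apply,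
        sum_apply, smul_eq_mul]
    · rw [Finset.mem_Icc] at hk; omega

/-- The row formula is continuous and therefore passes to the closure. The set s stays free so that
it can be matched with the cutoff in the commutator. -/
theorem ev_virasoro_apply {α β : ℂ} {n : ℤ} (hn : n ≠ 0) {Ψ : FockSpace α β}
    (hΨ : Ψ ∈ (virasoro α β n).domain) (μ : MultiIndex) (s : Finset ℤ)
    (hs : ∀ k ∉ s, ∀ X, coordMode α (-k) (coordMode α (n + k) X) μ = 0) :
    ev (virasoro α β n) Ψ μ = 1 / 2 * ∑ k ∈ s, coordMode α (-k) (coordMode α (n + k) Ψ) μ +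
        n * β * coordMode α n Ψ μ := by
  classical
  obtain ⟨ρ, hρ⟩ := exists_virasoro_rows α β n
  choose τ hτ using fun k : ℤ => exists_coordMode_comp_clm α β α (-k) (n + k) μ
  obtain ⟨σ, hσ⟩ := exists_coordMode_clm α β α n μ
  -- Only the row μ is made explicit; s need not be admissible for the other rows, which keep ρ.
  have h : ∀ (Φ : finiteSpace α β) ξ, (virasoroF α β n Φ : FockSpace α β) ξ =
      (Function.update ρ μ ((1 / 2 : ℂ) • ∑ k ∈ s, τ k + (n * β : ℂ) • σ)) ξ Φ := by
    intro Φ ξ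
    rcases eq_or_ne ξ μ with rfl | hξ
    · rw [virasoroF_apply α β hn ξ s hs, Function.update_self]
      simp only [hτ, hσ, add_apply, smul_apply,
        sum_apply, smul_eq_mul]
    · rw [Function.update_of_ne hξ, hρ]
  rw [virasoro, closure_apply_of_rows h hΨ, Function.update_self]
  simp only [hτ, hσ, add_apply, smul_apply,
        sum_apply, smul_eq_mul]

theorem ev_virasoro_zero_apply {α β : ℂ} {Ψ : FockSpace α β}
    (hΨ : Ψ ∈ (virasoro α β 0).domain) (μ : MultiIndex) :
    ev (virasoro α β 0) Ψ μ = (α ^ 2 - β ^ 2) / 2 * Ψ μ +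
      ∑ k ∈ μ.support, coordMode α (-(k : ℤ)) (coordMode α k Ψ) μ := by
  have h : ∀ μ, ∃ ρ : FockSpace α β →L[ℂ] ℂ, ∀ Ψ : FockSpace α β, (α ^ 2 - β ^ 2) / 2 * Ψ μ +
      ∑ k ∈ μ.support, coordMode α (-(k : ℤ)) (coordMode α k Ψ) μ = ρ Ψ := by
    intro μ
    choose τ hτ using fun k : ℕ+ => exists_coordMode_comp_clm α β α (-(k : ℤ)) k μ
    refine ⟨((α ^ 2 - β ^ 2) / 2) • lp.evalCLM ℂ (fun _ : MultiIndex => ℂ) 2 μ +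
      ∑ k ∈ μ.support, τ k, fun Φ => ?_⟩
    simp only [hτ, add_apply, sum_apply]
    rfl
  choose ρ hρ using h
  rw [virasoro, closure_apply_of_rows
    (fun Φ ξ => (virasoroF_zero_apply α β ξ Φ).trans (hρ ξ Φ)) hΨ, hρ]

theorem modeF_basisF (α β : ℂ) (n : ℤ) (η : MultiIndex) : ∃ (c : ℂ) (ξ : MultiIndex),
    modeF α β n (basisF α β η) = c • basisF α β ξ ∧
      ‖c‖ ≤ ‖α‖ + √(|(n : ℝ)| * (η.degree + 1)) ∧ ξ.degree ≤ η.degree + 1 := by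
  have hdeg : ∀ k : ℕ+, (η k : ℝ) ≤ η.degree := fun k => by exact_mod_cast Finsupp.le_degree k η
  rcases lt_trichotomy n 0 with hn | rfl | hn
  · obtain ⟨k, rfl⟩ : ∃ k : ℕ+, n = -(k : ℤ) := ⟨⟨(-n).toNat, by omega⟩, by simp; omega⟩
    refine ⟨_, _, modeF_neg_basisF α β k η, ?_, by simp⟩
    rw [Complex.norm_real, Real.norm_of_nonneg (Real.sqrt_nonneg _)]
    refine le_add_of_nonneg_of_le (norm_nonneg _) (Real.sqrt_le_sqrt ?_)
    simp only [Int.cast_neg, Int.cast_natCast, abs_neg, Nat.abs_cast]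
    gcongr
    exact Finsupp.le_degree k η
  · exact ⟨α, η, rfl, by simp, by simp⟩
  · obtain ⟨k, rfl⟩ : ∃ k : ℕ+, n = k := ⟨⟨n.toNat, by omega⟩, by simp; omega⟩
    refine ⟨_, _, modeF_pos_basisF α β k η, ?_, ?_⟩
    · rw [Complex.norm_real, Real.norm_of_nonneg (Real.sqrt_nonneg _)]
      refine le_add_of_nonneg_of_le (norm_nonneg _) (Real.sqrt_le_sqrt ?_)
      simp only [Int.cast_natCast, Nat.abs_cast]
      gcongr
      exact (hdeg k).trans (by simp)
    · exact (Finsupp.degree_mono tsub_le_self).trans (Nat.le_succ _)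

theorem norm_basisF (α β : ℂ) (η : MultiIndex) : ‖basisF α β η‖ = 1 := norm_basisVec α β η

/-- Each mode costs at most ‖α‖ + √q with q = (N + ‖η‖)(|η| + 2), where 2 instead of 1 allows the
first mode to create; then (‖α‖ + √q)² ≤ 2‖α‖² + 2q. -/
theorem norm_modeF_modeF_le (α β : ℂ) (N : ℕ) (η : MultiIndex) {m n : ℤ}
    (hm : |m| ≤ N + level η) (hn : |n| ≤ N + level η) :
    ‖modeF α β m (modeF α β n (basisF α β η))‖ ≤
      (2 * ‖α‖ ^ 2 + 4 * N + 4) * ((level η + 1) * (η.degree + 1)) := by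
  obtain ⟨c, ξ, h1, h2, h3⟩ := modeF_basisF α β n η
  obtain ⟨c', ξ', h1', h2', -⟩ := modeF_basisF α β m ξ
  rw [h1, map_smul, h1', norm_smul, norm_smul, norm_basisF, mul_one]
  have hm' : |(m : ℝ)| ≤ N + level η := by exact_mod_cast hm
  have hn' : |(n : ℝ)| ≤ N + level η := by exact_mod_cast hn
  have h3' : (ξ.degree : ℝ) ≤ η.degree + 1 := by exact_mod_cast h3
  set q : ℝ := (N + level η) * (η.degree + 2) with hq
  have hq0 : 0 ≤ q := by positivity
  have hc : ‖c‖ ≤ ‖α‖ + √q := h2.trans (by gcongr; rw [hq]; gcongr; norm_num)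
  have hc' : ‖c'‖ ≤ ‖α‖ + √q := h2'.trans (by
    gcongr
    exact mul_le_mul hm' (by linarith) (by positivity) (by positivity))
  have h4 : q ≤ (2 * N + 2) * ((level η + 1) * (η.degree + 1)) := by
    rw [hq]
    have e1 : (N : ℝ) + level η ≤ (N + 1) * (level η + 1) := by
      have : (0 : ℝ) ≤ N * level η := by positivity
      linarith
    have e2 : (η.degree : ℝ) + 2 ≤ 2 * (η.degree + 1) := by
      have : (0 : ℝ) ≤ η.degree := by positivity
      linarith
    calc ((N : ℝ) + level η) * (η.degree + 2)
        ≤ ((N + 1) * (level η + 1)) * (2 * (η.degree + 1)) := by gcongr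
      _ = _ := by ring
  have h5 : 1 ≤ ((level η : ℝ) + 1) * (η.degree + 1) :=
    one_le_mul_of_one_le_of_one_le (by simp) (by simp)
  have h6 := Real.sq_sqrt hq0
  have h7 : 2 * ‖α‖ ^ 2 * 1 ≤ 2 * ‖α‖ ^ 2 * (((level η : ℝ) + 1) * (η.degree + 1)) := by gcongr
  calc ‖c‖ * ‖c'‖ ≤ (‖α‖ + √q) * (‖α‖ + √q) := by gcongr
    _ ≤ 2 * ‖α‖ ^ 2 + 2 * q := by nlinarith [sq_nonneg (‖α‖ - √q)]
    _ ≤ _ := by linarith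

theorem card_support_le_degree (η : MultiIndex) : η.support.card ≤ η.degree := by
  rw [Finsupp.degree_apply, Finset.card_eq_sum_ones]
  exact Finset.sum_le_sum fun i hi => Nat.one_le_iff_ne_zero.2 (Finsupp.mem_support_iff.1 hi)

theorem norm_pointwiseSum_le {α β : ℂ} {ι : Type*}
    (T : ι → finiteSpace α β →ₗ[ℂ] finiteSpace α β) (h : ∀ x, {i | T i x ≠ 0}.Finite)
    (x : finiteSpace α β) (s : Finset ι) (hs : ∀ i ∉ s, T i x = 0) {c : ℝ}
    (hc : ∀ i ∈ s, ‖T i x‖ ≤ c) : ‖pointwiseSum T h x‖ ≤ s.card * c := by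
  have h1 : pointwiseSum T h x = ∑ i ∈ s, T i x :=
    finsum_eq_sum_of_support_subset _ fun i hi => by
      by_contra hc
      exact hi (hs i hc)
  rw [h1, ← nsmul_eq_mul]
  exact norm_sum_le_of_le s hc |>.trans (by rw [Finset.sum_const])

/-- For |k| > |n| one of the modes annihilates. It acts first, or, since n ≠ 0, its index differs
from the one just created; either way it needs its index occupied in η. -/
theorem modeF_comp_basisF_eq_zero (α β : ℂ) {n : ℤ} (hn : n ≠ 0) (η : MultiIndex) {k : ℤ}
    (h0 : k ∉ Finset.Icc (-|n|) |n|) (h1 : ∀ j : ℕ+, η j ≠ 0 → n + k ≠ j)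
    (h2 : ∀ j : ℕ+, η j ≠ 0 → -k ≠ j) :
    (modeF α β (-k) ∘ₗ modeF α β (n + k)) (basisF α β η) = 0 := by
  rw [Finset.mem_Icc, not_and_or, not_le, not_le] at h0
  have hn1 := le_abs_self n
  have hn2 := neg_abs_le n
  rw [LinearMap.comp_apply]
  rcases lt_or_ge 0 (n + k) with h | h
  · obtain ⟨j, hj⟩ : ∃ j : ℕ+, (j : ℤ) = n + k := ⟨⟨(n + k).toNat, by omega⟩, by simp; omega⟩
    have : η j = 0 := by_contra fun hne => h1 j hne hj.symm
    rw [← hj, modeF_pos_basisF]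
    simp [this]
  · obtain ⟨j, hj⟩ : ∃ j : ℕ+, (j : ℤ) = -k := ⟨⟨(-k).toNat, by omega⟩, by simp; omega⟩
    obtain ⟨i, hi⟩ : ∃ i : ℕ+, -(i : ℤ) = n + k :=
      ⟨⟨(-(n + k)).toNat, by omega⟩, by simp; omega⟩
    have hij : j ≠ i := by rintro rfl; omega
    have : η j = 0 := by_contra fun hne => h2 j hne hj.symm
    rw [← hi, modeF_neg_basisF, map_smul, ← hj, modeF_pos_basisF]
    simp [this, Finsupp.single_eq_of_ne hij]

/-- `RapidDecay` admits the level only to the first power, and a single term already uses it. The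
nonzero terms must therefore be counted by the degree: apart from |k| ≤ |n| they need -k or n + k in
the support of η, which has at most |η| elements. The resulting two powers of |η| + 1 are absorbed
by 4^{|η|}. -/
theorem norm_virasoroF_basisF_le (α β : ℂ) (n : ℤ) : ∃ C : ℝ, ∀ η : MultiIndex,
    ‖virasoroF α β n (basisF α β η)‖ ≤ C * (((level η : ℝ) + 1) * (4 : ℕ) ^ η.degree) := by
  suffices h : ∃ C : ℝ, 0 ≤ C ∧ ∀ η : MultiIndex, ‖virasoroF α β n (basisF α β η)‖ ≤
      C * ((level η + 1) * (η.degree + 1)) * (η.degree + 1) by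
    obtain ⟨C, hC, h⟩ := h
    refine ⟨C, fun η => (h η).trans ?_⟩
    have h4 : ((4 : ℕ) : ℝ) ^ η.degree = 2 ^ η.degree * 2 ^ η.degree := by
      rw [← mul_pow]; norm_num
    rw [h4, mul_assoc, mul_assoc]
    have := degree_lt_two_pow η
    gcongr
  rcases eq_or_ne n 0 with rfl | hn
  · refine ⟨‖(α ^ 2 - β ^ 2) / 2‖ + (2 * ‖α‖ ^ 2 + 4 * (0 : ℕ) + 4), by positivity, fun η => ?_⟩
    have h1 := norm_pointwiseSum_le (fun k : ℕ+ => modeF α β (-(k : ℤ)) ∘ₗ modeF α β k)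
      (finite_number α β) (basisF α β η) η.support (fun k hk => by
        rw [LinearMap.comp_apply, modeF_pos_basisF, Finsupp.notMem_support_iff.1 hk]; simp)
      (fun k hk => by
        have hk' := le_level (Finsupp.mem_support_iff.1 hk)
        exact norm_modeF_modeF_le α β 0 η (by simpa using hk') (by simpa using hk'))
    rw [virasoroF, dif_pos rfl]
    refine (norm_add_le _ _).trans ?_
    rw [LinearMap.smul_apply, norm_smul, LinearMap.id_apply, norm_basisF, add_mul, add_mul]
    have hcard : (η.support.card : ℝ) ≤ η.degree + 1 := by
      exact_mod_cast (card_support_le_degree η).trans (Nat.le_succ _)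
    refine add_le_add ?_ (h1.trans ?_)
    · rw [mul_assoc]
      refine mul_le_mul_of_nonneg_left ?_ (norm_nonneg _)
      exact one_le_mul_of_one_le_of_one_le
        (one_le_mul_of_one_le_of_one_le (by simp) (by simp)) (by simp)
    · rw [mul_comm]
      gcongr
  -- This N serves twice: N + 1 integers satisfy |k| ≤ |n|, and N + ‖η‖ bounds both |k| and |n + k|
  -- for the relevant k.
  · set N := 2 * n.natAbs with hN
    have hN' : (N : ℤ) = 2 * |n| := by rw [hN, Nat.cast_mul, Int.natCast_natAbs]; rfl
    have hn0 := abs_nonneg n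
    refine ⟨‖(1 / 2 : ℂ)‖ * ((N + 2) * (2 * ‖α‖ ^ 2 + 4 * N + 4)) +
      ‖(n : ℂ) * β‖ * (‖α‖ + (|(n : ℝ)| + 1)), by positivity, fun η => ?_⟩
    classical
    set s : Finset ℤ := Finset.Icc (-|n|) |n| ∪
      (η.support.image (fun j : ℕ+ => (j : ℤ) - n) ∪ η.support.image fun j : ℕ+ => -(j : ℤ)) with hs
    have hcard : (s.card : ℝ) ≤ (N + 2) * (η.degree + 1) := by
      have h1 : s.card ≤ (N + 1) + (η.degree + η.degree) := by
        refine (Finset.card_union_le _ _).trans (add_le_add ?_ ((Finset.card_union_le _ _).trans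
          (add_le_add ?_ ?_)))
        · rw [Int.card_Icc]; omega
        · exact Finset.card_image_le.trans (card_support_le_degree η)
        · exact Finset.card_image_le.trans (card_support_le_degree η)
      have h2 : (N + 1) + (η.degree + η.degree) ≤ (N + 2) * (η.degree + 1) := by nlinarith
      exact_mod_cast h1.trans h2
    have h1 := norm_pointwiseSum_le (fun k : ℤ => modeF α β (-k) ∘ₗ modeF α β (n + k))
      (finite_quadratic α β hn) (basisF α β η) s (fun k hk => by
        rw [hs, Finset.mem_union, Finset.mem_union, not_or, not_or, Finset.mem_image,
          Finset.mem_image] at hk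
        refine modeF_comp_basisF_eq_zero α β hn η hk.1 (fun j hj h => ?_) fun j hj h => ?_
        · exact hk.2.1 ⟨j, Finsupp.mem_support_iff.2 hj, by omega⟩
        · exact hk.2.2 ⟨j, Finsupp.mem_support_iff.2 hj, by omega⟩)
      (fun k hk => by
        have hb : |k| ≤ |n| + level η := by
          rw [hs, Finset.mem_union, Finset.mem_union, Finset.mem_image, Finset.mem_image,
            Finset.mem_Icc] at hk
          rcases hk with hk | ⟨j, hj, rfl⟩ | ⟨j, hj, rfl⟩
          · rw [abs_le]; omega
          · have := le_level (Finsupp.mem_support_iff.1 hj)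
            have hn1 := le_abs_self n
            have hn2 := neg_abs_le n
            rw [abs_le]; omega
          · have := le_level (Finsupp.mem_support_iff.1 hj)
            have hn1 := abs_nonneg n
            rw [abs_le]; omega
        have hb' := abs_add_le n k
        exact norm_modeF_modeF_le α β N η (by rw [abs_neg]; omega) (by omega))
    obtain ⟨c, ξ, e1, e2, -⟩ := modeF_basisF α β n η
    have h2 : ‖modeF α β n (basisF α β η)‖ ≤
        (‖α‖ + (|(n : ℝ)| + 1)) * ((level η + 1) * (η.degree + 1)) * (η.degree + 1) := by
      rw [e1, norm_smul, norm_basisF, mul_one]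
      refine e2.trans ?_
      have hsq : √(|(n : ℝ)| * (η.degree + 1)) ≤ (|(n : ℝ)| + 1) * (η.degree + 1) := by
        refine Real.sqrt_le_iff.2 ⟨by positivity, ?_⟩
        have a1 : 1 ≤ (η.degree : ℝ) + 1 := by simp
        have a2 : 0 ≤ |(n : ℝ)| := abs_nonneg _
        rw [mul_pow]
        refine mul_le_mul (by nlinarith) (by nlinarith) (by positivity) (by positivity)
      have a1 : 1 ≤ (η.degree : ℝ) + 1 := by simp
      have a3 : 1 ≤ ((level η : ℝ) + 1) * (η.degree + 1) :=
        one_le_mul_of_one_le_of_one_le (by simp) (by simp)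
      have a4 : ‖α‖ ≤ ‖α‖ * (η.degree + 1) := le_mul_of_one_le_right (norm_nonneg _) a1
      calc ‖α‖ + √(|(n : ℝ)| * (η.degree + 1))
          ≤ (‖α‖ + (|(n : ℝ)| + 1)) * 1 * (η.degree + 1) := by linarith
        _ ≤ _ := by gcongr
    rw [virasoroF, dif_neg hn]
    refine (norm_add_le _ _).trans ?_
    rw [LinearMap.smul_apply, LinearMap.smul_apply, norm_smul, norm_smul, add_mul, add_mul]
    refine add_le_add ?_ ?_
    · rw [mul_assoc, mul_assoc]
      refine mul_le_mul_of_nonneg_left (h1.trans ?_) (norm_nonneg _)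
      calc (s.card : ℝ) * ((2 * ‖α‖ ^ 2 + 4 * N + 4) * ((level η + 1) * (η.degree + 1)))
          ≤ ((N + 2) * (η.degree + 1)) *
            ((2 * ‖α‖ ^ 2 + 4 * N + 4) * ((level η + 1) * (η.degree + 1))) := by gcongr
        _ = _ := by ring
    · rw [mul_assoc, mul_assoc]
      refine mul_le_mul_of_nonneg_left (h2.trans_eq ?_) (norm_nonneg _)
      ring

theorem RapidDecay.mem_virasoro_domain {α β : ℂ} {Ψ : FockSpace α β} (h : RapidDecay Ψ) (n : ℤ) :
    Ψ ∈ (virasoro α β n).domain := by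
  obtain ⟨ρ, hρ⟩ := exists_virasoro_rows α β n
  obtain ⟨C, hC⟩ := norm_virasoroF_basisF_le α β n
  exact mem_closure_domain_of_rows hρ h hC

/-! ### Commutators of Virasoro operators and vertex operators -/

theorem hasSum_pnat_of_bounded {f : ℤ → ℂ} {N : ℤ} (hf : ∀ k, N < k → f k = 0) :
    HasSum (fun k : ℕ+ => f k) (∑ k ∈ Finset.Icc 1 N, f k) := by
  have hinj : Function.Injective fun k : ℕ+ => (k : ℤ) := fun a b h => PNat.coe_injective (by
    simpa using h)
  rw [← Finset.sum_preimage (fun k : ℕ+ => (k : ℤ)) (Finset.Icc 1 N) hinj.injOn f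
    fun k hk hk' => (hk' ⟨⟨k.toNat, by rw [Finset.mem_Icc] at hk; omega⟩, by
      rw [Finset.mem_Icc] at hk; simp; omega⟩).elim]
  refine hasSum_sum_of_ne_finset_zero fun k hk => hf k ?_
  rw [Finset.mem_preimage, Finset.mem_Icc, not_and_or, not_le, not_le] at hk
  have := k.pos
  omega

theorem sum_Icc_split (f : ℤ → ℂ) {a b c : ℤ} (h1 : a ≤ b) (h2 : b ≤ c) :
    ∑ k ∈ Finset.Icc (a + 1) c, f k =
      ∑ k ∈ Finset.Icc (a + 1) b, f k + ∑ k ∈ Finset.Icc (b + 1) c, f k := by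
  rw [← Finset.sum_union]
  · congr 1
    ext k
    simp only [Finset.mem_union, Finset.mem_Icc]
    omega
  · rw [Finset.disjoint_left]
    intro k
    simp only [Finset.mem_Icc]
    omega

theorem sum_Icc_sub (f : ℤ → ℂ) (a b c : ℤ) :
    ∑ k ∈ Finset.Icc a b, f (c - k) = ∑ k ∈ Finset.Icc (c - b) (c - a), f k :=
  Finset.sum_nbij' (fun k => c - k) (fun k => c - k)
    (by simp only [Finset.mem_Icc]; omega) (by simp only [Finset.mem_Icc]; omega)
    (fun k _ => by ring) (fun k _ => by ring) fun _ _ => rfl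

/-- The cutoff M drops out of the difference, and the convention for sums with n ≤ 0 makes the
outcome uniform in the sign of n. -/
theorem sum_Icc_sub_sum_Icc (g : ℤ → ℂ) {n M : ℤ} (hM : 0 ≤ M) (hMn : 0 ≤ M + n) :
    ∑ k ∈ Finset.Icc 1 (M + n), g k - ∑ k ∈ Finset.Icc (n + 1) (M + n), g k =
      signedSum n g + g n := by
  rw [signedSum]
  split_ifs with hn
  · have h1 := sum_Icc_split g hn.le (show n ≤ M + n by omega)
    have h2 := sum_Icc_split g (show 0 ≤ n - 1 by omega) (show n - 1 ≤ n by omega)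
    simp only [zero_add, sub_add_cancel, Finset.Icc_self, Finset.sum_singleton] at h1 h2
    rw [h1, h2]; ring
  · have h1 := sum_Icc_split g (show n ≤ 0 by omega) (show 0 ≤ M + n by omega)
    have h2 := sum_Icc_split g (show n - 1 ≤ n by omega) (show n ≤ 0 by omega)
    simp only [zero_add, sub_add_cancel, Finset.Icc_self, Finset.sum_singleton] at h1 h2
    rw [h1, h2]; ring

/-- Here t_m stands for θ_m, x_m for a coordinate of a_m V Φ, y_m for that of V a_m Φ and X for that
of V Φ. The window for k is the one in which -k and n + k both run over [-M, M + n], so the left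
side is ½ ∑_m t_{n-m} (x_m + y_m). Normal ordering relative to V replaces y_m by x_m for m < 0 and
x_m by y_m for m > 0; the corrections are the two sums of t_m t_{n-m} X whose difference is
`sum_Icc_sub_sum_Icc`. -/
theorem half_sum_eq (t x y : ℤ → ℂ) (X : ℂ) (h : ∀ m, x m = y m + t m * X) {n M : ℤ}
    (hM : 0 ≤ M) (hMn : 0 ≤ M + n) :
    1 / 2 * ∑ k ∈ Finset.Icc (-M - n) M, (t (-k) * y (n + k) + t (n + k) * x (-k)) =
      ∑ k ∈ Finset.Icc 1 M, t (n + k) * x (-k) + ∑ k ∈ Finset.Icc 1 (M + n), t (n - k) * y k +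
        (1 / 2 * signedSum n (fun k => t k * t (n - k)) * X +
          1 / 2 * (t n * t 0) * X + 1 / 2 * t n * (x 0 + y 0)) := by
  have e1 : ∑ k ∈ Finset.Icc (-M - n) M, t (-k) * y (n + k) =
      ∑ k ∈ Finset.Icc (-M) (M + n), t (n - k) * y k := by
    refine Finset.sum_nbij' (fun k => n + k) (fun k => k - n)
      (by simp only [Finset.mem_Icc]; omega) (by simp only [Finset.mem_Icc]; omega)
      (fun k _ => by ring) (fun k _ => by ring) fun k _ => ?_
    rw [show n - (n + k) = -k by ring]
  have e2 : ∑ k ∈ Finset.Icc (-M - n) M, t (n + k) * x (-k) =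
      ∑ k ∈ Finset.Icc (-M) (M + n), t (n - k) * x k := by
    have := sum_Icc_sub (fun k => t (n - k) * x k) (-M - n) M 0
    simp only [zero_sub, sub_neg_eq_add] at this
    rw [this]; congr 2; ring
  have e3 : ∑ k ∈ Finset.Icc 1 M, t (n + k) * x (-k) =
      ∑ k ∈ Finset.Icc (-M) (-1), t (n - k) * x k := by
    have := sum_Icc_sub (fun k => t (n - k) * x k) 1 M 0
    simpa only [zero_sub, sub_neg_eq_add] using this
  have e4 : ∀ f : ℤ → ℂ, ∑ k ∈ Finset.Icc (-M) (M + n), f k =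
      ∑ k ∈ Finset.Icc (-M) (-1), f k + f 0 + ∑ k ∈ Finset.Icc 1 (M + n), f k := by
    intro f
    have h1 := sum_Icc_split f (show -M - 1 ≤ -1 by omega) (show -1 ≤ M + n by omega)
    have h2 := sum_Icc_split f (show -1 ≤ (0 : ℤ) by omega) hMn
    simp only [sub_add_cancel, zero_add, Int.reduceNeg, neg_add_cancel, Finset.Icc_self,
      Finset.sum_singleton] at h1 h2
    rw [h1, h2, add_assoc]
  have e5 := sum_Icc_sub_sum_Icc (fun k => t k * t (n - k)) hM hMn
  have e6 : ∑ k ∈ Finset.Icc (n + 1) (M + n), t k * t (n - k) =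
      ∑ k ∈ Finset.Icc (-M) (-1), t (n - k) * t k := by
    have := sum_Icc_sub (fun k => t k * t (n - k)) (-M) (-1) n
    simp only [sub_sub_cancel, sub_neg_eq_add, add_comm n M] at this
    exact this.symm
  have e7 : ∑ k ∈ Finset.Icc (-M) (-1), t (n - k) * y k =
      ∑ k ∈ Finset.Icc (-M) (-1), t (n - k) * x k -
        (∑ k ∈ Finset.Icc (-M) (-1), t (n - k) * t k) * X := by
    rw [Finset.sum_mul, ← Finset.sum_sub_distrib]
    exact Finset.sum_congr rfl fun k _ => by rw [h]; ring
  have e8 : ∑ k ∈ Finset.Icc 1 (M + n), t (n - k) * x k =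
      ∑ k ∈ Finset.Icc 1 (M + n), t (n - k) * y k +
        (∑ k ∈ Finset.Icc 1 (M + n), t k * t (n - k)) * X := by
    rw [Finset.sum_mul, ← Finset.sum_add_distrib]
    exact Finset.sum_congr rfl fun k _ => by rw [h]; ring
  rw [Finset.sum_add_distrib, e1, e2, e3, e4, e4 (fun k => t (n - k) * x k), e7, e8]
  simp only [sub_zero, sub_self] at e5 ⊢
  rw [e6] at e5
  linear_combination (1 / 2 * X) * e5

theorem exists_modeF_bound {α β : ℂ} (Φ : finiteSpace α β) :
    ∃ M : ℕ, ∀ k : ℤ, (M : ℤ) < k → modeF α β k Φ = 0 := by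
  have hfin : {k : ℕ+ | modeF α β k Φ ≠ 0}.Finite := by
    refine finite_of_basisF (fun k : ℕ+ => modeF α β k) (fun η => ?_) Φ
    refine η.support.finite_toSet.subset fun k hk => ?_
    by_contra hc
    refine hk ?_
    rw [modeF_pos_basisF, Finsupp.notMem_support_iff.1 hc]
    simp
  obtain ⟨M, hM⟩ := (hfin.image fun k : ℕ+ => (k : ℕ)).bddAbove
  refine ⟨M, fun k hk => ?_⟩
  by_contra hne
  obtain ⟨j, rfl⟩ : ∃ j : ℕ+, k = j := ⟨⟨k.toNat, by omega⟩, by simp; omega⟩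
  have := hM ⟨j, hne, rfl⟩
  simp only at this
  omega

section

variable {α β : ℂ} {ω : ℤ → ℂ} (hω : Summable fun k : ℕ+ => (k : ℝ) * ‖ω k‖) (γ : ℂ)

/-- The Leibniz rule for a_m a_n. In the last term a_m is left in front of V, which is the form that
`half_sum_eq` reorders. -/
theorem coordMode_comp_vertexF (m n : ℤ) (Φ : finiteSpace α β) (μ : MultiIndex) :
    coordMode (α + γ) m (coordMode (α + γ) n (vertexF α β hω Φ)) μ =
      vertexF α β hω (modeF α β m (modeF α β n Φ)) μ +
        (theta ω γ m * vertexF α β hω (modeF α β n Φ) μ +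
          theta ω γ n * coordMode (α + γ) m (vertexF α β hω Φ) μ) := by
  have h : coordMode (α + γ) n (vertexF α β hω Φ) =
      (vertexF α β hω (modeF α β n Φ) : MultiIndex → ℂ) +
        theta ω γ n • (vertexF α β hω Φ : MultiIndex → ℂ) :=
    funext fun ξ => coordMode_vertexF hω γ n Φ ξ
  rw [h, map_add, map_smul, Pi.add_apply, Pi.smul_apply, smul_eq_mul,
    coordMode_vertexF hω γ m (modeF α β n Φ), add_assoc]

/-- One window, beyond every index relevant for the row μ or the vector Φ, cuts off L_n on both
sides of V. Its dependence on μ is harmless because the series are compared coordinate by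
coordinate. -/
theorem virasoro_vertexF_apply_of_ne {n : ℤ} (hn : n ≠ 0) (Φ : finiteSpace α β) (μ : MultiIndex) :
    ∃ M : ℕ, (∀ k : ℤ, (M : ℤ) < k → coordMode (α + γ) (-k) (vertexF α β hω Φ) μ = 0) ∧
      (∀ k : ℤ, (M : ℤ) + n < k → modeF α β k Φ = 0) ∧
      ev (virasoro (α + γ) β n) (vertexF α β hω Φ) μ -
          vertexF α β hω (virasoroF α β n Φ) μ =
        ∑ k ∈ Finset.Icc 1 (M : ℤ),
          theta ω γ (n + k) * coordMode (α + γ) (-k) (vertexF α β hω Φ) μ +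
        ∑ k ∈ Finset.Icc 1 ((M : ℤ) + n), theta ω γ (n - k) * vertexF α β hω (modeF α β k Φ) μ +
        (1 / 2 * signedSum n (fun k => theta ω γ k * theta ω γ (n - k)) +
          theta ω γ n * (α + γ + n * β)) * vertexF α β hω Φ μ := by
  classical
  obtain ⟨M₁, h1⟩ := coordMode_comp_eq_zero (α + γ) hn μ
  obtain ⟨M₂, h2⟩ := exists_modeF_bound Φ
  obtain ⟨M₃, h3⟩ := exists_bound μ
  obtain ⟨M₄, h4⟩ := ((finite_quadratic α β hn Φ).image Int.natAbs).bddAbove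
  have h4' : ∀ k : ℤ, (M₄ : ℤ) < |k| → modeF α β (-k) (modeF α β (n + k) Φ) = 0 := by
    intro k hk
    by_contra hne
    have := h4 ⟨k, hne, rfl⟩
    rw [← Int.natCast_natAbs] at hk
    omega
  obtain ⟨M, hM⟩ : ∃ M : ℕ, M = M₁ + M₂ + M₃ + M₄ + n.natAbs := ⟨_, rfl⟩
  have hdom := (rapidDecay_vertexF hω Φ).mem_virasoro_domain (α := α + γ) (β := β) n
  refine ⟨M, fun k hk => ?_, fun k hk => h2 k (by omega), ?_⟩
  · obtain ⟨j, rfl⟩ : ∃ j : ℕ+, k = j := ⟨⟨k.toNat, by omega⟩, by simp; omega⟩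
    rw [coordMode_neg_apply, h3 j (by omega)]; simp
  · have hL : virasoroF α β n Φ = (1 / 2 : ℂ) • ∑ k ∈ Finset.Icc (-(M : ℤ) - n) M,
        modeF α β (-k) (modeF α β (n + k) Φ) + (n * β : ℂ) • modeF α β n Φ := by
      rw [virasoroF, dif_neg hn]
      change (1 / 2 : ℂ) • (∑ᶠ k : ℤ, modeF α β (-k) (modeF α β (n + k) Φ)) + _ = _
      rw [finsum_eq_sum_of_support_subset _ (s := Finset.Icc (-(M : ℤ) - n) M) fun k hk => ?_]
      · rfl
      · by_contra hc
        rw [Finset.coe_Icc, Set.mem_Icc] at hc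
        refine hk (h4' k ?_)
        rw [lt_abs]; omega
    have hL' : vertexF α β hω (virasoroF α β n Φ) μ =
        1 / 2 * ∑ k ∈ Finset.Icc (-(M : ℤ) - n) M,
          vertexF α β hω (modeF α β (-k) (modeF α β (n + k) Φ)) μ +
        n * β * vertexF α β hω (modeF α β n Φ) μ := by
      rw [hL, map_add, map_smul, map_smul, map_sum, lp.coeFn_add, Pi.add_apply, lp.coeFn_smul,
        lp.coeFn_smul, Pi.smul_apply, Pi.smul_apply, lp.coeFn_sum, Finset.sum_apply]
      rfl
    have hhalf := half_sum_eq (theta ω γ)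
      (fun m => coordMode (α + γ) m (vertexF α β hω Φ) μ)
      (fun m => vertexF α β hω (modeF α β m Φ) μ) (vertexF α β hω Φ μ)
      (fun m => coordMode_vertexF hω γ m Φ μ) (n := n) (M := M) (by omega) (by omega)
    have h0 : vertexF α β hω (modeF α β 0 Φ) μ = α * vertexF α β hω Φ μ := by
      have : modeF α β 0 Φ = α • Φ := rfl
      rw [this, map_smul]; rfl
    have hθ : theta ω γ 0 = γ := by simp [theta]
    simp only [coordMode_zero_apply, h0, hθ] at hhalf
    rw [ev_virasoro_apply hn hdom μ (Finset.Icc (-(M : ℤ) - n) M) fun k hk X =>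
      h1 k (by rw [Finset.mem_Icc] at hk; omega) X, hL', coordMode_vertexF]
    simp only [coordMode_comp_vertexF]
    rw [Finset.sum_add_distrib]
    linear_combination hhalf

/-- L_0 is normally ordered, so the Leibniz rule for a_{-k} a_k, k ≥ 1, needs no reordering. The
constant is the change of α²/2, namely ((α+γ)² - α²)/2 = -γ²/2 + γ(α+γ). -/
theorem virasoro_vertexF_apply_zero (Φ : finiteSpace α β) (μ : MultiIndex) :
    ∃ M : ℕ, (∀ k : ℤ, (M : ℤ) < k → coordMode (α + γ) (-k) (vertexF α β hω Φ) μ = 0) ∧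
      (∀ k : ℤ, (M : ℤ) < k → modeF α β k Φ = 0) ∧
      ev (virasoro (α + γ) β 0) (vertexF α β hω Φ) μ -
          vertexF α β hω (virasoroF α β 0 Φ) μ =
        ∑ k ∈ Finset.Icc 1 (M : ℤ),
          theta ω γ k * coordMode (α + γ) (-k) (vertexF α β hω Φ) μ +
        ∑ k ∈ Finset.Icc 1 (M : ℤ), theta ω γ (-k) * vertexF α β hω (modeF α β k Φ) μ +
        (-(1 / 2) * γ ^ 2 + γ * (α + γ)) * vertexF α β hω Φ μ := by
  classical
  obtain ⟨M₂, h2⟩ := exists_modeF_bound Φ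
  obtain ⟨M₃, h3⟩ := exists_bound μ
  obtain ⟨M, hM⟩ : ∃ M : ℕ, M = M₂ + M₃ := ⟨_, rfl⟩
  have hdom := (rapidDecay_vertexF hω Φ).mem_virasoro_domain (α := α + γ) (β := β) 0
  have h3' : ∀ k : ℤ, (M : ℤ) < k → ∀ X, coordMode (α + γ) (-k) X μ = 0 := by
    intro k hk X
    obtain ⟨j, rfl⟩ : ∃ j : ℕ+, k = j := ⟨⟨k.toNat, by omega⟩, by simp; omega⟩
    rw [coordMode_neg_apply, h3 j (by omega)]; simp
  refine ⟨M, fun k hk => h3' k hk _, fun k hk => h2 k (by omega), ?_⟩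
  have hconv : ∀ (E : Type) [AddCommMonoid E] (f : ℤ → E) (s : Finset ℕ+),
      (∀ k ∈ s, f k ≠ 0 → (k : ℤ) ≤ M) → (∀ k : ℕ+, (k : ℤ) ≤ M → k ∉ s → f k = 0) →
      ∑ k ∈ s, f k = ∑ k ∈ Finset.Icc 1 (M : ℤ), f k := by
    intro E _ f s hs1 hs2
    refine Finset.sum_bij_ne_zero (fun k _ _ => (k : ℤ)) (fun k hk hne => ?_)
      (fun a _ _ b _ _ h => by simpa using h) (fun b hb hne => ?_) fun _ _ _ => rfl
    · exact Finset.mem_Icc.2 ⟨by have := k.pos; omega, hs1 k hk hne⟩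
    · rw [Finset.mem_Icc] at hb
      obtain ⟨j, rfl⟩ : ∃ j : ℕ+, b = j := ⟨⟨b.toNat, by omega⟩, by simp; omega⟩
      exact ⟨j, by_contra fun hj => hne (hs2 j hb.2 hj), hne, rfl⟩
  have hL : virasoroF α β 0 Φ = ((α ^ 2 - β ^ 2) / 2) • Φ + ∑ k ∈ Finset.Icc 1 (M : ℤ),
      modeF α β (-k) (modeF α β k Φ) := by
    rw [virasoroF, dif_pos rfl]
    change ((α ^ 2 - β ^ 2) / 2) • Φ +
      (∑ᶠ k : ℕ+, modeF α β (-(k : ℤ)) (modeF α β k Φ)) = _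
    rw [finsum_eq_sum (fun k : ℕ+ => modeF α β (-(k : ℤ)) (modeF α β k Φ)) (finite_number α β Φ),
      hconv _ (fun k => modeF α β (-k) (modeF α β k Φ))]
    · intro k _ hne
      by_contra hc
      refine hne ?_
      rw [h2 k (by omega), map_zero]
    · intro k _ hk
      by_contra hc
      exact hk ((Set.Finite.mem_toFinset _).2 hc)
  have hL' : vertexF α β hω (virasoroF α β 0 Φ) μ =
      (α ^ 2 - β ^ 2) / 2 * vertexF α β hω Φ μ + ∑ k ∈ Finset.Icc 1 (M : ℤ),
        vertexF α β hω (modeF α β (-k) (modeF α β k Φ)) μ := by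
    rw [hL, map_add, map_smul, map_sum, lp.coeFn_add, Pi.add_apply, lp.coeFn_smul,
      Pi.smul_apply, lp.coeFn_sum, Finset.sum_apply]
    rfl
  rw [ev_virasoro_zero_apply hdom, hL',
    hconv _ (fun k => coordMode (α + γ) (-k) (coordMode (α + γ) k (vertexF α β hω Φ)) μ)]
  · simp only [coordMode_comp_vertexF]
    rw [Finset.sum_add_distrib, Finset.sum_add_distrib]
    ring
  · intro k _ hne
    by_contra hc
    exact hne (h3' k (by omega) _)
  · intro k _ hk
    rw [coordMode_neg_apply, Finsupp.notMem_support_iff.1 hk]; simp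

theorem virasoro_vertexF_apply (n : ℤ) (Φ : finiteSpace α β) (μ : MultiIndex) :
    ∃ M N : ℤ, (∀ k : ℤ, M < k → coordMode (α + γ) (-k) (vertexF α β hω Φ) μ = 0) ∧
      (∀ k : ℤ, N < k → modeF α β k Φ = 0) ∧
      ev (virasoro (α + γ) β n) (vertexF α β hω Φ) μ -
          vertexF α β hω (virasoroF α β n Φ) μ =
        ∑ k ∈ Finset.Icc 1 M,
          theta ω γ (n + k) * coordMode (α + γ) (-k) (vertexF α β hω Φ) μ +
        ∑ k ∈ Finset.Icc 1 N, theta ω γ (n - k) * vertexF α β hω (modeF α β k Φ) μ +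
        (1 / 2 * signedSum n (fun k => theta ω γ k * theta ω γ (n - k)) +
          theta ω γ n * (α + γ + n * β)) * vertexF α β hω Φ μ := by
  rcases eq_or_ne n 0 with rfl | hn
  · obtain ⟨M, h1, h2, h3⟩ := virasoro_vertexF_apply_zero hω γ Φ μ
    refine ⟨M, M, h1, h2, h3.trans ?_⟩
    -- At n = 0 the signed sum is the single term -θ_0² = -γ².
    simp [signedSum, theta]
    left; ring
  · obtain ⟨M, h1, h2, h3⟩ := virasoro_vertexF_apply_of_ne hω γ hn Φ μ
    exact ⟨M, M + n, h1, h2, h3⟩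

end

/-! ### Norm convergence of the mode series and the commutator in Hilbert space -/

/-- The weight √k is the growth of ‖a_{-k} Ψ‖. For j = n + k ≥ 1 one has k ≤ (|n|+1) j, hence √j √k
≤ (|n|+1) j and the term is at most (|n|+1) j |ω_j|; finitely many small k are discarded. -/
theorem summable_theta_mul_sqrt {ω : ℤ → ℂ} (hω : Summable fun k : ℕ+ => (k : ℝ) * ‖ω k‖)
    (γ : ℂ) (n : ℤ) : Summable fun k : ℕ+ => ‖theta ω γ (n + k)‖ * √(k : ℝ) := by
  have hinj : Function.Injective fun k : ℕ+ => (k : ℤ) := fun a b h => PNat.coe_injective (by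
    simpa using h)
  have hg : Summable fun k : ℤ => if 0 < k then (k : ℝ) * ‖ω k‖ else 0 := by
    refine (hinj.summable_iff fun k hk => if_neg fun h => hk ⟨⟨k.toNat, by omega⟩, ?_⟩).1 ?_
    · simp; omega
    · refine hω.congr fun k => ?_
      simp
  have hg' := hg.comp_injective ((add_right_injective n).comp hinj)
  refine Summable.of_norm_bounded_eventually (hg'.mul_left ((n.natAbs : ℝ) + 1)) ?_
  have hfin : (Set.Iic (n.natAbs.succPNat)).Finite := Set.finite_Iic _
  filter_upwards [hfin.compl_mem_cofinite] with k hk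
  rw [Set.mem_compl_iff, Set.mem_Iic, not_le, ← PNat.coe_lt_coe, Nat.succPNat_coe] at hk
  obtain ⟨j, hj⟩ : ∃ j : ℕ+, n + k = j := ⟨⟨(n + k).toNat, by omega⟩, by simp; omega⟩
  have hkj : (k : ℝ) ≤ (n.natAbs + 1) * j := by
    have h1 : (k : ℤ) ≤ n.natAbs + j := by omega
    have h2 : (1 : ℤ) ≤ j := by have := j.pos; omega
    have h3 : (k : ℤ) ≤ (n.natAbs + 1) * j := by nlinarith [Int.natCast_nonneg n.natAbs]
    exact_mod_cast h3
  simp only [Function.comp, hj, theta_pos, Int.natCast_pos, PNat.pos, if_true, Int.cast_natCast]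
  have key : √(j : ℝ) * √(k : ℝ) ≤ (n.natAbs + 1) * j := by
    rw [← Real.sqrt_mul (by positivity)]
    refine Real.sqrt_le_iff.2 ⟨by positivity, ?_⟩
    have : (1 : ℝ) ≤ n.natAbs + 1 := by simp
    calc (j : ℝ) * k ≤ j * ((n.natAbs + 1) * j) := by gcongr
      _ ≤ (n.natAbs + 1) * (j * ((n.natAbs + 1) * j)) := le_mul_of_one_le_left (by positivity) this
      _ = _ := by ring
  rw [norm_mul, norm_norm, Real.norm_of_nonneg (Real.sqrt_nonneg _), norm_mul, Complex.norm_real,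
    Real.norm_of_nonneg (Real.sqrt_nonneg _), mul_right_comm, ← mul_assoc]
  exact mul_le_mul_of_nonneg_right key (norm_nonneg _)

theorem ev_smul {E E' : Type*} [AddCommGroup E] [Module ℂ E] [AddCommGroup E'] [Module ℂ E']
    (A : E →ₗ.[ℂ] E') {x : E} (h : x ∈ A.domain) (c : ℂ) : ev A (c • x) = c • ev A x := by
  rw [ev_of_mem _ h, ev_of_mem _ (A.domain.smul_mem c h)]
  exact A.map_smul c ⟨x, h⟩

theorem ev_scaledTranslate {α β γ c : ℂ} {A : FockSpace α β →ₗ.[ℂ] FockSpace α β}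
    (x : FockSpace α β) : ev (scaledTranslate α β γ c A) x = c • ev A x := by
  by_cases h : x ∈ A.domain
  · rw [ev_of_mem _ h, ev_of_mem (scaledTranslate α β γ c A) (x := x) h]
    rfl
  · rw [ev, ev, dif_neg h, dif_neg (by exact h), smul_zero]

theorem summable_smul_annihilation {α β : ℂ} {ω : ℤ → ℂ}
    (hω : Summable fun k : ℕ+ => (k : ℝ) * ‖ω k‖) (t : ℤ → ℂ) (Φ : finiteSpace α β) :
    Summable fun k : ℕ+ => t k • vertexF α β hω (modeF α β k Φ) := by
  obtain ⟨M, hM⟩ := exists_modeF_bound Φ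
  refine summable_of_hasFiniteSupport ((Set.finite_Iic M.succPNat).subset fun k hk => ?_)
  by_contra hc
  rw [Set.mem_Iic, not_le, ← PNat.coe_lt_coe, Nat.succPNat_coe] at hc
  refine hk ?_
  simp only
  rw [hM k (by omega), map_zero, smul_zero]

theorem RapidDecay.mem_mode_domain {α β : ℂ} {Ψ : FockSpace α β} (h : RapidDecay Ψ) (k : ℕ+) :
    Ψ ∈ (mode α β (-(k : ℤ))).domain := by
  rw [mode_neg_domain]
  exact h.mem_modeDomain k

theorem summable_theta_creation {α β : ℂ} {ω : ℤ → ℂ}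
    (hω : Summable fun k : ℕ+ => (k : ℝ) * ‖ω k‖) (γ : ℂ) (n : ℤ) {Ψ : FockSpace α β}
    (hΨ : RapidDecay Ψ) :
    Summable fun k : ℕ+ => theta ω γ (n + k) • ev (mode α β (-(k : ℤ))) Ψ := by
  refine Summable.of_norm_bounded
    ((summable_theta_mul_sqrt hω γ n).mul_right (creationBound Ψ)) fun k => ?_
  rw [norm_smul, mul_assoc]
  gcongr
  exact norm_creation_le hΨ k

theorem hasSum_coord {α β : ℂ} {ι : Type*} {f : ι → FockSpace α β} {S : FockSpace α β}
    (h : HasSum f S) (μ : MultiIndex) : HasSum (fun i => f i μ) (S μ) :=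
  h.mapL (lp.evalCLM ℂ (fun _ : MultiIndex => ℂ) 2 μ)

/-- Both series converge in norm, so the identity may be tested on coordinates, where they become
the finite sums of `virasoro_vertexF_apply`. -/
theorem virComm_scaledTranslate {α β : ℂ} {ω : ℤ → ℂ}
    (hω : Summable fun k : ℕ+ => (k : ℝ) * ‖ω k‖) (γ c : ℂ) (n : ℤ) (Φ : finiteSpace α β) :
    VirCommDefined n (scaledTranslate α β γ c (vertexOp α β ω)) Φ ∧
      virComm n (scaledTranslate α β γ c (vertexOp α β ω)) Φ =
        c • (∑' k : ℕ+, theta ω γ (n + k) •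
            ev (mode (α + γ) β (-(k : ℤ))) (vertexF α β hω Φ) +
          ∑' k : ℕ+, theta ω γ (n - k) • vertexF α β hω (modeF α β k Φ) +
          (1 / 2 * signedSum n (fun k => theta ω γ k * theta ω γ (n - k)) +
            theta ω γ n * (α + γ + n * β)) • (vertexF α β hω Φ : FockSpace (α + γ) β)) := by
  have hR := rapidDecay_vertexF hω Φ
  have hdom := hR.mem_virasoro_domain (α := α + γ) (β := β) n
  have hP : ∀ Ψ : finiteSpace α β, ev (scaledTranslate α β γ c (vertexOp α β ω)) Ψ =
      c • vertexF α β hω Ψ := fun Ψ => by rw [ev_scaledTranslate, ev_vertexOp hω]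
  refine ⟨⟨finiteSpace_le_vertexOp_domain α β hω Φ.2, ?_, mem_virasoro_domain n Φ, ?_⟩, ?_⟩
  · rw [hP]
    exact Submodule.smul_mem _ c hdom
  · rw [ev_virasoro]
    exact finiteSpace_le_vertexOp_domain α β hω (virasoroF α β n Φ).2
  · rw [virComm, ev_virasoro, hP, hP, ev_smul _ hdom, ← smul_sub]
    congr 1
    refine lp.ext (funext fun μ => ?_)
    obtain ⟨M, N, h1, h2, h3⟩ := virasoro_vertexF_apply hω γ n Φ μ
    have hS1 := (hasSum_coord (summable_theta_creation (α := α + γ) (β := β) hω γ n hR).hasSum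
      μ).unique ((hasSum_pnat_of_bounded (N := M)
        (f := fun k => theta ω γ (n + k) * coordMode (α + γ) (-k) (vertexF α β hω Φ) μ)
        fun k hk => by rw [h1 k hk, mul_zero]).congr_fun fun k => ?_)
    · have hS2 := (hasSum_coord (summable_smul_annihilation hω (fun k => theta ω γ (n - k))
        Φ).hasSum μ).unique ((hasSum_pnat_of_bounded (N := N)
        (f := fun k => theta ω γ (n - k) * vertexF α β hω (modeF α β k Φ) μ)
        fun k hk => by rw [h2 k hk, map_zero]; exact mul_zero _).congr_fun fun k => rfl)
      refine h3.trans ?_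
      rw [← hS1, ← hS2]
      rfl
    · exact congrArg (theta ω γ (n + k) * ·)
        (ev_mode_apply (-(k : ℤ)) (hR.mem_mode_domain (α := α + γ) (β := β) k) μ)

/-! ### Holomorphy -/

/-- Cauchy's estimate for t ↦ f (x + t • v) on the disc of radius R/‖v‖ bounds the derivative along
v by C ‖v‖/R. -/
theorem norm_fderiv_le_of_forall_norm_le {E F : Type*} [NormedAddCommGroup E] [NormedSpace ℂ E]
    [NormedAddCommGroup F] [NormedSpace ℂ F] {f : E → F} {x : E} {R C : ℝ}
    (hR : 0 < R) (hf : ∀ y ∈ Metric.closedBall x R, DifferentiableAt ℂ f y)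
    (hC : ∀ y ∈ Metric.closedBall x R, ‖f y‖ ≤ C) : ‖fderiv ℂ f x‖ ≤ C / R := by
  have hx : x ∈ Metric.closedBall x R := Metric.mem_closedBall_self hR.le
  have hC0 : 0 ≤ C := (norm_nonneg _).trans (hC x hx)
  refine ContinuousLinearMap.opNorm_le_bound _ (by positivity) fun v => ?_
  rcases eq_or_ne v 0 with rfl | hv
  · simp
  have hv' : 0 < ‖v‖ := norm_pos_iff.2 hv
  have hmem : ∀ t ∈ Metric.closedBall (0 : ℂ) (R / ‖v‖), x + t • v ∈ Metric.closedBall x R := by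
    intro t ht
    rw [mem_closedBall_zero_iff, le_div_iff₀ hv'] at ht
    rwa [mem_closedBall_iff_norm, add_sub_cancel_left, norm_smul]
  have hline : ∀ t : ℂ, HasDerivAt (fun t : ℂ => x + t • v) v t := fun t => by
    simpa using ((hasDerivAt_id t).smul_const v).const_add x
  have hd : ∀ t ∈ Metric.closedBall (0 : ℂ) (R / ‖v‖),
      DifferentiableAt ℂ (fun t : ℂ => f (x + t • v)) t := fun t ht =>
    (hf _ (hmem t ht)).comp t (hline t).differentiableAt
  have h0 : deriv (fun t : ℂ => f (x + t • v)) 0 = fderiv ℂ f x v := by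
    have h1 : HasFDerivAt f (fderiv ℂ f x) (x + (0 : ℂ) • v) := by
      rw [zero_smul, add_zero]; exact (hf x hx).hasFDerivAt
    exact (h1.comp_hasDerivAt (0 : ℂ) (hline 0)).deriv
  have h := Complex.norm_deriv_le_of_forall_mem_sphere_norm_le (c := (0 : ℂ)) (R := R / ‖v‖)
    (f := fun t : ℂ => f (x + t • v)) (C := C) (by positivity)
    (DifferentiableOn.diffContOnCl fun t ht =>
      (hd t (Metric.closure_ball_subset_closedBall ht)).differentiableWithinAt)
    fun t ht => hC _ (hmem t (Metric.sphere_subset_closedBall ht))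
  rw [← h0]
  refine h.trans_eq ?_
  field_simp

/-- Weierstrass' theorem: Cauchy estimates on slightly smaller balls turn the majorant of the terms
into a majorant of their derivatives, so the series may be differentiated termwise. -/
theorem differentiableOn_tsum_of_norm_le {ι E F : Type*} [NormedAddCommGroup E] [NormedSpace ℂ E]
    [NormedAddCommGroup F] [NormedSpace ℂ F] [CompleteSpace F] {f : ι → E → F} {u : ι → ℝ}
    (hu : Summable u) {U : Set E} (hU : IsOpen U) (hf : ∀ i, DifferentiableOn ℂ (f i) U)
    (hb : ∀ i, ∀ x ∈ U, ‖f i x‖ ≤ u i) : DifferentiableOn ℂ (fun x => ∑' i, f i x) U := by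
  intro x₀ hx₀
  obtain ⟨R, hR, hRU⟩ := Metric.isOpen_iff.1 hU x₀ hx₀
  have hsub : ∀ x ∈ Metric.ball x₀ (R / 2), Metric.closedBall x (R / 4) ⊆ U := by
    intro x hx y hy
    refine hRU ?_
    rw [Metric.mem_ball] at hx ⊢
    rw [Metric.mem_closedBall] at hy
    linarith [dist_triangle y x x₀]
  have hd : ∀ i, ∀ x ∈ U, DifferentiableAt ℂ (f i) x := fun i x hx =>
    (hf i).differentiableAt (hU.mem_nhds hx)
  -- The real structure gives convexity, hence preconnectedness, of the ball.
  let _ : NormedSpace ℝ E := NormedSpace.restrictScalars ℝ ℂ E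
  have h := hasFDerivAt_tsum_of_isPreconnected (f := f) (f' := fun i x => fderiv ℂ (f i) x)
    (u := fun i => u i / (R / 4)) (s := Metric.ball x₀ (R / 2)) (x₀ := x₀) (x := x₀)
    (hu.div_const _) Metric.isOpen_ball (convex_ball x₀ (R / 2)).isPreconnected
    (fun i x hx => (hd i x (hsub x hx (Metric.mem_closedBall_self (by positivity)))).hasFDerivAt)
    (fun i x hx => norm_fderiv_le_of_forall_norm_le (by positivity)
      (fun y hy => hd i y (hsub x hx hy)) fun y hy => hb i y (hsub x hx hy))
    (Metric.mem_ball_self (by positivity))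
    (Summable.of_norm_bounded hu fun i => hb i x₀ hx₀) (Metric.mem_ball_self (by positivity))
  exact h.differentiableAt.differentiableWithinAt

theorem summable_pnat_mul_pow {ρ : ℝ} (h0 : 0 ≤ ρ) (h1 : ρ < 1) :
    Summable fun k : ℕ+ => (k : ℝ) * ρ ^ (k : ℕ) := by
  have h := summable_pow_mul_geometric_of_norm_lt_one (R := ℝ) 1 (r := ρ)
    (by rwa [Real.norm_of_nonneg h0])
  simp only [pow_one] at h
  exact h.comp_injective PNat.coe_injective

theorem one_le_sqrt_pnat (k : ℕ+) : 1 ≤ √(k : ℝ) :=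
  Real.one_le_sqrt.2 (by exact_mod_cast k.pos)

/-- Nonnegative powers are largest at the outer radius ρ, negative ones at the inner radius δ. -/
theorem norm_multiSeq_le {r : ℕ} (γ z : Fin r → ℂ) {δ ρ : ℝ} (hδ : 0 < δ)
    (hz : ∀ i, δ ≤ ‖z i‖ ∧ ‖z i‖ ≤ ρ) (k : ℤ) :
    ‖multiSeq γ z k‖ ≤ ∑ i, ‖γ i‖ * (if 0 ≤ k then ρ ^ k else δ ^ k) / √|(k : ℝ)| := by
  refine (norm_sum_le _ _).trans (Finset.sum_le_sum fun i _ => ?_)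
  rw [norm_div, norm_mul, norm_zpow, Complex.norm_real, Real.norm_of_nonneg (Real.sqrt_nonneg _)]
  gcongr
  split_ifs with hk
  · exact zpow_le_zpow_left₀ hk (norm_nonneg _) (hz i).2
  · obtain ⟨m, rfl⟩ : ∃ m : ℕ, k = -(m : ℤ) := ⟨(-k).toNat, by omega⟩
    rw [zpow_neg, zpow_neg, zpow_natCast, zpow_natCast]
    gcongr
    exact (hz i).1

/-- A majorant of the sequences `multiSeq γ z` on `{δ ≤ |z_i| ≤ ρ}`. -/
def majorantSeq {r : ℕ} (γ : Fin r → ℂ) (δ ρ : ℝ) (k : ℤ) : ℂ :=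
  (if 0 ≤ k then 1 else -1) *
    ((∑ i, ‖γ i‖ * (if 0 ≤ k then ρ ^ k else δ ^ k) / √|(k : ℝ)| : ℝ) : ℂ)

theorem summable_majorantSeq {r : ℕ} (γ : Fin r → ℂ) (δ : ℝ) {ρ : ℝ} (h0 : 0 ≤ ρ) (h1 : ρ < 1) :
    Summable fun k : ℕ+ => (k : ℝ) * ‖majorantSeq γ δ ρ k‖ := by
  refine Summable.of_nonneg_of_le (fun k => by positivity) (fun k => ?_)
    ((summable_pnat_mul_pow h0 h1).mul_left (∑ i, ‖γ i‖))
  have hk : (0 : ℤ) ≤ (k : ℤ) := by positivity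
  rw [majorantSeq, if_pos hk, if_pos hk, one_mul, Complex.norm_real,
    Real.norm_of_nonneg (Finset.sum_nonneg fun i _ => by positivity), zpow_natCast,
    mul_left_comm, ← Finset.sum_div, ← Finset.sum_mul]
  gcongr
  refine div_le_self (by positivity) ?_
  simpa using one_le_sqrt_pnat k

theorem summable_multiSeq {r : ℕ} (γ z : Fin r → ℂ) (hz : ∀ i, ‖z i‖ < 1) :
    Summable fun k : ℕ+ => (k : ℝ) * ‖multiSeq γ z k‖ := by
  have h := summable_sum fun i (_ : i ∈ Finset.univ) =>
    (summable_pnat_mul_pow (norm_nonneg (z i)) (hz i)).mul_left ‖γ i‖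
  refine Summable.of_nonneg_of_le (fun k => by positivity) (fun k => ?_) h
  rw [multiSeq]
  refine (mul_le_mul_of_nonneg_left (norm_sum_le _ _) (by positivity)).trans ?_
  rw [Finset.mul_sum]
  refine Finset.sum_le_sum fun i _ => ?_
  rw [norm_div, norm_mul, norm_zpow, Complex.norm_real, Real.norm_of_nonneg (Real.sqrt_nonneg _),
    zpow_natCast, mul_left_comm]
  gcongr
  refine div_le_self (by positivity) ?_
  simpa using one_le_sqrt_pnat k

theorem norm_vertexCoeff_multiSeq_le {r : ℕ} (γ z : Fin r → ℂ) {δ ρ : ℝ} (hδ : 0 < δ)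
    (hz : ∀ i, δ ≤ ‖z i‖ ∧ ‖z i‖ ≤ ρ) (η ν : MultiIndex) :
    ‖vertexCoeff (multiSeq γ z) η ν‖ ≤ ‖vertexCoeff (majorantSeq γ δ ρ) η ν‖ := by
  refine norm_vertexCoeff_le (norm_multiSeq_le γ z hδ hz) (fun k => ?_) (fun k => ?_) η ν
  · have hk : (0 : ℤ) ≤ (k : ℤ) := by positivity
    rw [majorantSeq, if_pos hk, one_mul]
  · have hk : ¬ (0 : ℤ) ≤ -(k : ℤ) := by have := k.pos; omega
    rw [majorantSeq, if_neg hk, neg_one_mul]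

theorem exists_annulus {r : ℕ} {z : Fin r → ℂ} (hz : ∀ i, 0 < ‖z i‖ ∧ ‖z i‖ < 1) :
    ∃ δ ρ : ℝ, 0 < δ ∧ 0 ≤ ρ ∧ ρ < 1 ∧ ∀ i, δ < ‖z i‖ ∧ ‖z i‖ < ρ := by
  have h1 : ∀ᶠ δ in 𝓝[>] (0 : ℝ), ∀ i, δ < ‖z i‖ :=
    eventually_all.2 fun i => nhdsWithin_le_nhds (eventually_lt_nhds (hz i).1)
  have h2 : ∀ᶠ ρ in 𝓝[<] (1 : ℝ), ∀ i, ‖z i‖ < ρ :=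
    eventually_all.2 fun i => nhdsWithin_le_nhds (eventually_gt_nhds (hz i).2)
  have h3 : ∀ᶠ ρ in 𝓝[<] (1 : ℝ), 0 < ρ := nhdsWithin_le_nhds (eventually_gt_nhds one_pos)
  obtain ⟨δ, hδ, hδ0⟩ := (h1.and self_mem_nhdsWithin).exists
  obtain ⟨ρ, ⟨hρ, hρ0⟩, hρ1⟩ := ((h2.and h3).and self_mem_nhdsWithin).exists
  exact ⟨δ, ρ, hδ0, hρ0.le, hρ1, fun i => ⟨hδ i, hρ i⟩⟩

theorem isOpen_annulus {r : ℕ} (δ ρ : ℝ) :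
    IsOpen {z : Fin r → ℂ | ∀ i, δ < ‖z i‖ ∧ ‖z i‖ < ρ} := by
  simp only [Set.ofPred_forall]
  refine isOpen_iInter_of_finite fun i => ?_
  exact (isOpen_lt continuous_const (continuous_apply i).norm).inter
    (isOpen_lt (continuous_apply i).norm continuous_const)

theorem differentiableAt_multiSeq {r : ℕ} (γ : Fin r → ℂ) {z : Fin r → ℂ} (hz : ∀ i, z i ≠ 0)
    (k : ℤ) : DifferentiableAt ℂ (fun z => multiSeq γ z k) z := by
  have h : ∀ i, DifferentiableAt ℂ
      (fun z : Fin r → ℂ => γ i * z i ^ k / ((√|(k : ℝ)| : ℝ) : ℂ)) z := by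
    intro i
    have h1 : DifferentiableAt ℂ (fun z : Fin r → ℂ => z i) z :=
      (ContinuousLinearMap.proj (R := ℂ) (φ := fun _ : Fin r => ℂ) i).differentiableAt
    have h2 : DifferentiableAt ℂ (fun z : Fin r → ℂ => z i ^ k) z :=
      DifferentiableAt.comp (g := fun w : ℂ => w ^ k) z
        (differentiableAt_zpow.2 (Or.inl (hz i))) h1
    simp only [div_eq_mul_inv]
    exact (h2.const_mul _).mul_const _
  exact DifferentiableAt.fun_sum fun i _ => h i

theorem differentiableAt_vertexCoeff_multiSeq {r : ℕ} (γ : Fin r → ℂ) {z : Fin r → ℂ}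
    (hz : ∀ i, z i ≠ 0) (η ν : MultiIndex) :
    DifferentiableAt ℂ (fun z => vertexCoeff (multiSeq γ z) η ν) z := by
  simp only [fun z => vertexCoeff_eq_prod (multiSeq γ z) η ν Finset.subset_union_left
    Finset.subset_union_right]
  have h : ∀ i : ℕ+, DifferentiableAt ℂ (fun z => modeCoeff (η i) (ν i) (multiSeq γ z i)
      (-multiSeq γ z (-(i : ℤ)))) z := fun i =>
    DifferentiableAt.comp (g := fun p : ℂ × ℂ => modeCoeff (η i) (ν i) p.1 p.2)
      (f := fun z : Fin r → ℂ => (multiSeq γ z i, -multiSeq γ z (-(i : ℤ)))) z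
      (differentiable_modeCoeff (η i) (ν i)).differentiableAt
      ((differentiableAt_multiSeq γ hz i).prodMk (differentiableAt_multiSeq γ hz (-(i : ℤ))).fun_neg)
  induction η.support ∪ ν.support using Finset.induction_on with
  | empty => simp only [Finset.prod_empty]; exact differentiableAt_const _
  | insert i s hi ih => simp only [Finset.prod_insert hi]; exact (h i).mul ih

theorem vertexF_basisF_eq_tsum {α β : ℂ} {ω : ℤ → ℂ}
    (hω : Summable fun k : ℕ+ => (k : ℝ) * ‖ω k‖) (ν : MultiIndex) :
    vertexF α β hω (basisF α β ν) = ∑' η, vertexCoeff ω η ν • basisVec α β η := by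
  rw [← (hasSum_smul_basisVec (vertexF α β hω (basisF α β ν))).tsum_eq]
  exact tsum_congr fun η => by rw [vertexF_basisF_apply]

/-- For a basis vector the coordinates are holomorphic, and on an annulus δ < |z_i| < ρ < 1 they are
dominated by the matrix elements of one fixed sequence, `majorantSeq`. These are summable since ρ <
1, so Weierstrass' theorem applies. -/
theorem differentiableOn_vertexMulti (α β : ℂ) {r : ℕ} (γ : Fin r → ℂ) (Φ : finiteSpace α β) :
    DifferentiableOn ℂ (fun z : Fin r → ℂ => ev (vertexMulti α β γ z) (Φ : FockSpace α β))
      {z | ∀ i, 0 < ‖z i‖ ∧ ‖z i‖ < 1} := by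
  have hev : ∀ z : Fin r → ℂ, (hz : ∀ i, 0 < ‖z i‖ ∧ ‖z i‖ < 1) → ∀ Φ : finiteSpace α β,
      ev (vertexMulti α β γ z) (Φ : FockSpace α β) =
        vertexF α β (summable_multiSeq γ z fun i => (hz i).2) Φ := fun z hz Φ => ev_vertexOp _ Φ
  induction Φ using finiteSpace_induction with
  | h0 =>
    refine (differentiableOn_const (0 : FockSpace α β)).congr fun z hz => ?_
    rw [hev z hz, map_zero]
  | ha x y hx hy =>
    refine (hx.add hy).congr fun z hz => ?_
    rw [hev z hz, map_add, Pi.add_apply, hev z hz, hev z hz]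
  | hs c x hx =>
    refine (hx.const_smul c).congr fun z hz => ?_
    rw [hev z hz, map_smul, Pi.smul_apply, hev z hz]
  | hb ν =>
    intro z hz
    obtain ⟨δ, ρ, hδ, hρ0, hρ1, hzδ⟩ := exists_annulus hz
    have hd := differentiableOn_tsum_of_norm_le
      (f := fun η (z : Fin r → ℂ) => vertexCoeff (multiSeq γ z) η ν • basisVec α β η)
      (rapidDecay_vertexCoeff _ (summable_majorantSeq γ δ hρ0 hρ1) ν).summable_norm
      (isOpen_annulus (r := r) δ ρ)
      (fun η w hw => ((differentiableAt_vertexCoeff_multiSeq γ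
        (fun i => norm_pos_iff.1 (hδ.trans (hw i).1)) η ν).smul_const _).differentiableWithinAt)
      (fun η w hw => by
        rw [norm_smul, norm_basisVec, mul_one]
        exact norm_vertexCoeff_multiSeq_le γ w hδ (fun i => ⟨(hw i).1.le, (hw i).2.le⟩) η ν)
    refine DifferentiableAt.differentiableWithinAt ?_
    refine (hd.differentiableAt ((isOpen_annulus δ ρ).mem_nhds hzδ)).congr_of_eventuallyEq ?_
    filter_upwards [(isOpen_annulus δ ρ).mem_nhds hzδ] with w hw
    rw [hev w fun i => ⟨hδ.trans (hw i).1, (hw i).2.trans hρ1⟩, vertexF_basisF_eq_tsum]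

/-! ### The derivative with respect to one variable -/

theorem hasDerivAt_multiSeq_update {r : ℕ} (γ z : Fin r → ℂ) (j : Fin r) (hz : z j ≠ 0) (k : ℤ) :
    HasDerivAt (fun w => multiSeq γ (Function.update z j w) k)
      (γ j * (k * z j ^ (k - 1)) / ((√|(k : ℝ)| : ℝ) : ℂ)) (z j) := by
  have h : ∀ i, HasDerivAt (fun w => γ i * Function.update z j w i ^ k / ((√|(k : ℝ)| : ℝ) : ℂ))
      (if i = j then γ j * (k * z j ^ (k - 1)) / ((√|(k : ℝ)| : ℝ) : ℂ) else 0) (z j) := by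
    intro i
    rcases eq_or_ne i j with rfl | hi
    · simp only [Function.update_self, if_true]
      exact ((hasDerivAt_zpow k (z i) (Or.inl hz)).const_mul _).div_const _
    · simp only [Function.update_of_ne hi, if_neg hi]
      exact hasDerivAt_const _ _
  exact (HasDerivAt.fun_sum fun i (_ : i ∈ Finset.univ) => h i).congr_deriv (by simp)

theorem hasDerivAt_modeCoeff_comp (n m : ℕ) {x y : ℂ → ℂ} {x' y' t : ℂ} (hx : HasDerivAt x x' t)
    (hy : HasDerivAt y y' t) :
    HasDerivAt (fun t => modeCoeff n m (x t) (y t))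
      ((√(n : ℝ) : ℝ) * modeCoeff (n - 1) m (x t) (y t) * x' +
        (√(m : ℝ) : ℝ) * modeCoeff n (m - 1) (x t) (y t) * y') t := by
  have hF := (differentiable_modeCoeff n m (x t, y t)).hasFDerivAt
  set L := fderiv ℂ (fun p : ℂ × ℂ => modeCoeff n m p.1 p.2) (x t, y t)
  have e1 : HasDerivAt (fun s => modeCoeff n m s (y t)) (L (1, 0)) (x t) :=
    HasFDerivAt.comp_hasDerivAt (l := fun p : ℂ × ℂ => modeCoeff n m p.1 p.2)
      (f := fun s => (s, y t)) (x t) hF ((hasDerivAt_id (x t)).prodMk (hasDerivAt_const (x t) (y t)))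
  have e2 : HasDerivAt (fun s => modeCoeff n m (x t) s) (L (0, 1)) (y t) :=
    HasFDerivAt.comp_hasDerivAt (l := fun p : ℂ × ℂ => modeCoeff n m p.1 p.2)
      (f := fun s => (x t, s)) (y t) hF ((hasDerivAt_const (y t) (x t)).prodMk (hasDerivAt_id (y t)))
  have h1 := e1.unique (hasDerivAt_modeCoeff_left n m (x t) (y t))
  have h2 := e2.unique (hasDerivAt_modeCoeff_right n m (x t) (y t))
  refine (hF.comp_hasDerivAt t (hx.prodMk hy)).congr_deriv ?_
  have h3 : ((x', y') : ℂ × ℂ) = x' • (1, 0) + y' • (0, 1) := by simp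
  rw [h3, map_add, map_smul, map_smul, h1, h2, smul_eq_mul, smul_eq_mul]
  ring

theorem mul_deriv_zpow_div_sqrt {a z : ℂ} (hz : z ≠ 0) (k : ℕ+) :
    z * (a * (((k : ℤ) : ℂ) * z ^ ((k : ℤ) - 1)) / ((√|((k : ℤ) : ℝ)| : ℝ) : ℂ)) =
        a * (z ^ (k : ℤ) * ((√(k : ℝ) : ℝ) : ℂ)) ∧
      z * (a * (((-(k : ℤ) : ℤ) : ℂ) * z ^ (-(k : ℤ) - 1)) / ((√|((-(k : ℤ) : ℤ) : ℝ)| : ℝ) : ℂ)) =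
        -(a * (z ^ (-(k : ℤ)) * ((√(k : ℝ) : ℝ) : ℂ))) := by
  have hk : ((√(k : ℝ) : ℝ) : ℂ) ≠ 0 := by
    rw [Complex.ofReal_ne_zero]
    exact (zero_lt_one.trans_le (one_le_sqrt_pnat k)).ne'
  have h := ofReal_sqrt_mul_self (x := (k : ℝ)) (by positivity)
  push_cast at h
  rw [zpow_sub_one₀ hz, zpow_sub_one₀ hz]
  simp only [Int.cast_neg, abs_neg, Int.cast_natCast, Nat.abs_cast]
  constructor
  · field_simp
    linear_combination (-a) * h
  · field_simp
    linear_combination a * h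

/-- Product rule: differentiating in ω_k lowers μ_k, differentiating in -ω_{-k} lowers ν_k. Since z
∂_z (z^{±k}/√k) = ±√k z^{±k}, the minus sign of the negative modes cancels the one in -ω_{-k}. -/
theorem hasDerivAt_vertexCoeff_update {r : ℕ} (γ z : Fin r → ℂ) (j : Fin r) (hz : z j ≠ 0)
    (μ ν : MultiIndex) :
    ∃ d, HasDerivAt (fun w => vertexCoeff (multiSeq γ (Function.update z j w)) μ ν) d (z j) ∧
      HasSum (fun k : ℕ+ => γ j * (z j ^ (k : ℤ) * (((√((k : ℝ) * (μ k : ℝ)) : ℝ) : ℂ) *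
          vertexCoeff (multiSeq γ z) (μ - Finsupp.single k 1) ν)) +
        γ j * (z j ^ (-(k : ℤ)) * (((√((k : ℝ) * (ν k : ℝ)) : ℝ) : ℂ) *
          vertexCoeff (multiSeq γ z) μ (ν - Finsupp.single k 1)))) (z j * d) := by
  classical
  have hself : Function.update z j (z j) = z := Function.update_eq_self j z
  have hf := fun i : ℕ+ => hasDerivAt_modeCoeff_comp (μ i) (ν i)
    (hasDerivAt_multiSeq_update γ z j hz i) (hasDerivAt_multiSeq_update γ z j hz (-(i : ℤ))).fun_neg
  simp only [hself] at hf
  have hprod := HasDerivAt.fun_finsetProd (u := μ.support ∪ ν.support)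
    fun i (_ : i ∈ μ.support ∪ ν.support) => hf i
  simp only [hself] at hprod
  refine ⟨_, hprod.congr_of_eventuallyEq (Eventually.of_forall fun w => vertexCoeff_eq_prod _ μ ν
    Finset.subset_union_left Finset.subset_union_right), ?_⟩
  rw [Finset.mul_sum]
  have hs := hasSum_sum_of_ne_finset_zero (L := SummationFilter.unconditional ℕ+)
    (s := μ.support ∪ ν.support) (f := fun k : ℕ+ =>
      γ j * (z j ^ (k : ℤ) * (((√((k : ℝ) * (μ k : ℝ)) : ℝ) : ℂ) *
          vertexCoeff (multiSeq γ z) (μ - Finsupp.single k 1) ν)) +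
        γ j * (z j ^ (-(k : ℤ)) * (((√((k : ℝ) * (ν k : ℝ)) : ℝ) : ℂ) *
          vertexCoeff (multiSeq γ z) μ (ν - Finsupp.single k 1)))) fun k hk => by
    rw [Finset.mem_union, not_or, Finsupp.notMem_support_iff, Finsupp.notMem_support_iff] at hk
    simp [hk.1, hk.2]
  convert hs using 1
  refine Finset.sum_congr rfl fun k _ => ?_
  obtain ⟨h1, h2⟩ := mul_deriv_zpow_div_sqrt (a := γ j) hz k
  rw [vertexCoeff_eq_mul_erase _ k (μ - _), vertexCoeff_eq_mul_erase _ k μ,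
    coeffErase_congr (multiSeq γ z) (k := k) (ν := ν) (ν' := ν) (η := μ - Finsupp.single k 1)
      (η' := μ) (fun i hi => by simp [Finsupp.single_eq_of_ne hi]) (fun _ _ => rfl),
    coeffErase_congr (multiSeq γ z) (k := k) (η := μ) (η' := μ) (ν := ν - Finsupp.single k 1)
      (ν' := ν) (fun _ _ => rfl) (fun i hi => by simp [Finsupp.single_eq_of_ne hi]),
    Real.sqrt_mul (by positivity), Real.sqrt_mul (by positivity)]
  simp only [Finsupp.tsub_apply, Finsupp.single_eq_same, coeffErase, smul_eq_mul,
    Complex.ofReal_mul]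
  set E := ∏ i ∈ (μ.support ∪ ν.support).erase k,
    modeCoeff (μ i) (ν i) (multiSeq γ z i) (-multiSeq γ z (-(i : ℤ)))
  set c₁ := modeCoeff (μ k - 1) (ν k) (multiSeq γ z k) (-multiSeq γ z (-(k : ℤ)))
  set c₂ := modeCoeff (μ k) (ν k - 1) (multiSeq γ z k) (-multiSeq γ z (-(k : ℤ)))
  linear_combination (E * (√(μ k : ℝ) : ℝ) * c₁) * h1 - (E * (√(ν k : ℝ) : ℝ) * c₂) * h2

theorem ev_vertexMulti {α β : ℂ} {r : ℕ} {γ z : Fin r → ℂ} (hz : ∀ i, ‖z i‖ < 1)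
    (Φ : finiteSpace α β) : ev (vertexMulti α β γ z) (Φ : FockSpace α β) =
      vertexF α β (summable_multiSeq γ z hz) Φ :=
  ev_vertexOp _ Φ

theorem eventually_update_lt {r : ℕ} {z : Fin r → ℂ} (hz : ∀ i, ‖z i‖ < 1) (j : Fin r) :
    ∀ᶠ w in 𝓝 (z j), ∀ i, ‖Function.update z j w i‖ < 1 := by
  refine eventually_all.2 fun i => ?_
  have hc : ContinuousAt (fun w => ‖Function.update z j w i‖) (z j) := by fun_prop
  refine hc.eventually_lt_const ?_
  simpa using hz i

theorem hasDerivAt_vertexMulti_apply {α β : ℂ} {r : ℕ} (γ : Fin r → ℂ) {z : Fin r → ℂ}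
    (hz : ∀ i, ‖z i‖ < 1) (j : Fin r) (hj : z j ≠ 0) (Φ : finiteSpace α β) (μ : MultiIndex) :
    ∃ d, HasDerivAt (fun w => ev (vertexMulti α β γ (Function.update z j w))
        (Φ : FockSpace α β) μ) d (z j) ∧
      HasSum (fun k : ℕ+ =>
        γ j * (z j ^ (k : ℤ) *
          coordMode α (-(k : ℤ)) (vertexF α β (summable_multiSeq γ z hz) Φ) μ) +
        γ j * (z j ^ (-(k : ℤ)) *
          vertexF α β (summable_multiSeq γ z hz) (modeF α β k Φ) μ)) (z j * d) := by
  have hev := eventually_update_lt hz j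
  induction Φ using finiteSpace_induction with
  | hb ν =>
    obtain ⟨d, h1, h2⟩ := hasDerivAt_vertexCoeff_update γ z j hj μ ν
    refine ⟨d, h1.congr_of_eventuallyEq ?_, h2.congr_fun fun k => ?_⟩
    · filter_upwards [hev] with w hw
      rw [ev_vertexMulti hw, vertexF_basisF_apply]
    · rw [coordMode_neg_apply, modeF_pos_basisF, map_smul, lp.coeFn_smul, Pi.smul_apply,
        smul_eq_mul, vertexF_basisF_apply, vertexF_basisF_apply]
  | h0 =>
    refine ⟨0, (hasDerivAt_const (z j) (0 : ℂ)).congr_of_eventuallyEq ?_, ?_⟩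
    · filter_upwards [hev] with w hw
      rw [ev_vertexMulti hw, map_zero]; rfl
    · rw [mul_zero]
      refine hasSum_zero.congr_fun fun k => ?_
      rw [map_zero, map_zero, coordMode_neg_apply]
      simp
  | ha x y hx hy =>
    obtain ⟨d, h1, h2⟩ := hx
    obtain ⟨d', h1', h2'⟩ := hy
    refine ⟨d + d', (h1.add h1').congr_of_eventuallyEq ?_, ?_⟩
    · filter_upwards [hev] with w hw
      rw [Pi.add_apply, ev_vertexMulti hw, ev_vertexMulti hw, ev_vertexMulti hw, map_add]; rfl
    · rw [mul_add]
      refine (h2.add h2').congr_fun fun k => ?_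
      simp only [map_add, lp.coeFn_add, Pi.add_apply]
      ring
  | hs c x hx =>
    obtain ⟨d, h1, h2⟩ := hx
    refine ⟨c * d, (h1.const_mul c).congr_of_eventuallyEq ?_, ?_⟩
    · filter_upwards [hev] with w hw
      rw [ev_vertexMulti hw, ev_vertexMulti hw, map_smul]; rfl
    · rw [mul_left_comm]
      refine (h2.mul_left c).congr_fun fun k => ?_
      simp only [map_smul, lp.coeFn_smul, Pi.smul_apply, smul_eq_mul]
      ring

theorem summable_zpow_creation {α β : ℂ} {Ψ : FockSpace α β} (hΨ : RapidDecay Ψ) {z : ℂ}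
    (hz : ‖z‖ < 1) : Summable fun k : ℕ+ => z ^ (k : ℤ) • ev (mode α β (-(k : ℤ))) Ψ := by
  refine Summable.of_norm_bounded
    ((summable_pnat_mul_pow (norm_nonneg z) hz).mul_right (creationBound Ψ)) fun k => ?_
  have hk : √(k : ℝ) ≤ k := by
    have : (1 : ℝ) ≤ k := by exact_mod_cast k.pos
    exact Real.sqrt_le_iff.2 ⟨by positivity, by nlinarith⟩
  rw [norm_smul, norm_zpow, zpow_natCast]
  calc ‖z‖ ^ (k : ℕ) * ‖ev (mode α β (-(k : ℤ))) Ψ‖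
      ≤ ‖z‖ ^ (k : ℕ) * (k * creationBound Ψ) := by
        refine mul_le_mul_of_nonneg_left ((norm_creation_le hΨ k).trans ?_) (by positivity)
        exact mul_le_mul_of_nonneg_right hk (creationBound_nonneg _)
    _ = _ := by ring

/-- The derivative exists in norm by holomorphy; its value is identified through the coordinates,
which by themselves would only give weak information. -/
theorem hasDerivAt_vertexMulti {α β : ℂ} {r : ℕ} (γ : Fin r → ℂ) {z : Fin r → ℂ}
    (hz : ∀ i, 0 < ‖z i‖ ∧ ‖z i‖ < 1) (j : Fin r) (Φ : finiteSpace α β) :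
    ∃ D, HasDerivAt (fun w => ev (vertexMulti α β γ (Function.update z j w))
        (Φ : FockSpace α β)) D (z j) ∧
      z j • D = γ j • ∑' k : ℕ+, z j ^ (k : ℤ) • ev (mode α β (-(k : ℤ)))
          (vertexF α β (summable_multiSeq γ z fun i => (hz i).2) Φ) +
        γ j • ∑' k : ℕ+, z j ^ (-(k : ℤ)) •
          vertexF α β (summable_multiSeq γ z fun i => (hz i).2) (modeF α β k Φ) := by
  have hself : Function.update z j (z j) = z := Function.update_eq_self j z
  have hopen : IsOpen {z : Fin r → ℂ | ∀ i, 0 < ‖z i‖ ∧ ‖z i‖ < 1} := isOpen_annulus 0 1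
  have hd : DifferentiableAt ℂ (fun z : Fin r → ℂ => ev (vertexMulti α β γ z)
      (Φ : FockSpace α β)) (Function.update z j (z j)) := by
    rw [hself]
    exact (differentiableOn_vertexMulti α β γ Φ).differentiableAt (hopen.mem_nhds hz)
  have hD := hd.hasFDerivAt.comp_hasDerivAt (z j) (hasDerivAt_update z j (z j))
  refine ⟨_, hD, ?_⟩
  set D := fderiv ℂ (fun z : Fin r → ℂ => ev (vertexMulti α β γ z) (Φ : FockSpace α β))
    (Function.update z j (z j)) (Pi.single j 1)
  refine lp.ext (funext fun μ => ?_)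
  have hR := rapidDecay_vertexF (summable_multiSeq γ z fun i => (hz i).2) Φ
  obtain ⟨d, h1, h2⟩ := hasDerivAt_vertexMulti_apply γ (fun i => (hz i).2) j
    (norm_pos_iff.1 (hz j).1) Φ μ
  have hDμ : HasDerivAt (fun w => ev (vertexMulti α β γ (Function.update z j w))
      (Φ : FockSpace α β) μ) (D μ) (z j) :=
    (lp.evalCLM ℂ (fun _ : MultiIndex => ℂ) 2 μ).hasFDerivAt.comp_hasDerivAt (z j) hD
  have hS1 := hasSum_coord (summable_zpow_creation hR (hz j).2).hasSum μ
  have hS2 := hasSum_coord (summable_smul_annihilation (summable_multiSeq γ z fun i => (hz i).2)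
    (fun k => z j ^ (-k)) Φ).hasSum μ
  have hS := (hS1.mul_left (γ j)).add (hS2.mul_left (γ j))
  rw [← hDμ.unique h1] at h2
  refine h2.unique (hS.congr_fun fun k => ?_)
  have := ev_mode_apply (-(k : ℤ)) (hR.mem_mode_domain (α := α) (β := β) k) μ
  rw [← this]
  rfl

/-! ### Prefactors -/

theorem signedSum_add_one (n : ℤ) (f : ℤ → ℂ) : signedSum (n + 1) f = signedSum n f + f n := by
  rcases lt_trichotomy n 0 with hn | rfl | hn
  · have h := sum_Icc_split f (show n - 1 ≤ n by omega) (show n ≤ 0 by omega)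
    simp only [sub_add_cancel, Finset.Icc_self, Finset.sum_singleton] at h
    rw [signedSum, signedSum, if_neg (by omega), if_neg (by omega), h]
    ring
  · simp [signedSum]
  · have h := sum_Icc_split f (show 0 ≤ n - 1 by omega) (show n - 1 ≤ n by omega)
    simp only [sub_add_cancel, zero_add, Finset.Icc_self, Finset.sum_singleton] at h
    rw [signedSum, signedSum, if_pos (by omega), if_pos hn, add_sub_cancel_right, h]

theorem signedSum_one (f : ℤ → ℂ) : signedSum 1 f = 0 := by
  simp [signedSum]

/-- Induction in both directions from n = 1, where the signed sum is empty. -/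
theorem signedSum_telescope (n : ℤ) (G : ℤ → ℂ) :
    signedSum n (fun k => G k - G (k + 1)) = G 1 - G n := by
  induction n using Int.inductionOn' (b := 1) with
  | zero => rw [signedSum_one, sub_self]
  | succ k _ ih => rw [signedSum_add_one, ih]; ring
  | pred k _ ih =>
    have := signedSum_add_one (k - 1) fun k => G k - G (k + 1)
    rw [sub_add_cancel, ih] at this
    linear_combination -this

theorem signedSum_const (n : ℤ) (c : ℂ) : signedSum n (fun _ => c) = (n - 1) * c := by
  induction n using Int.inductionOn' (b := 1) with
  | zero => rw [signedSum_one]; simp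
  | succ k _ ih => rw [signedSum_add_one, ih]; push_cast; ring
  | pred k _ ih =>
    have := signedSum_add_one (k - 1) fun _ => c
    rw [sub_add_cancel, ih] at this
    push_cast
    linear_combination -this

/-- The added terms are those for k = n and k = 0; they complete the signed sum to a full geometric
sum, which telescopes. -/
theorem signedSum_zpow_mul {x y : ℂ} (hx : x ≠ 0) (hy : y ≠ 0) (n : ℤ) :
    (y - x) * (signedSum n (fun k => x ^ k * y ^ (n - k)) + x ^ n + y ^ n) =
      y ^ (n + 1) - x ^ (n + 1) := by
  have hmul : ∀ (c : ℂ) (f : ℤ → ℂ), c * signedSum n f = signedSum n fun k => c * f k := by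
    intro c f
    simp only [signedSum]
    split_ifs
    · rw [Finset.mul_sum]
    · rw [mul_neg, Finset.mul_sum]
  have h := signedSum_telescope n fun k => x ^ k * y ^ (n + 1 - k)
  have h' : (fun k : ℤ => x ^ k * y ^ (n + 1 - k) - x ^ (k + 1) * y ^ (n + 1 - (k + 1))) =
      fun k => (y - x) * (x ^ k * y ^ (n - k)) := by
    funext k
    rw [show n + 1 - k = n - k + 1 by ring, show n + 1 - (k + 1) = n - k by ring,
      zpow_add_one₀ hy, zpow_add_one₀ hx]
    ring
  rw [h', ← hmul] at h
  rw [mul_add, mul_add, h]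
  simp only [add_sub_cancel_right, add_sub_cancel_left, zpow_one]
  rw [zpow_add_one₀ hx, zpow_add_one₀ hy]
  ring

/-- Expanding over pairs and symmetrizing θ_n ∑ γ_i supplies both end terms of each geometric sum.
Off the diagonal the sums are z_j^{n+1}/(z_j - z_i) + z_i^{n+1}/(z_i - z_j), which matches the
logarithmic derivatives of (z_i - z_j)^{γ_i γ_j}; the diagonal yields the weights γ_j²/2. -/
theorem half_signedSum_theta {r : ℕ} (γ z : Fin r → ℂ) (hz : ∀ i, z i ≠ 0)
    (hne : ∀ i j, i ≠ j → z i ≠ z j) (n : ℤ) :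
    1 / 2 * signedSum n (fun k => (∑ i, γ i * z i ^ k) * ∑ i, γ i * z i ^ (n - k)) +
        (∑ i, γ i * z i ^ n) * ∑ i, γ i =
      ∑ j, z j ^ n * (∑ i, γ i * γ j * z j / (z j - z i) + (n + 1) * (γ j ^ 2 / 2)) := by
  have hsum : ∀ f : Fin r → Fin r → ℤ → ℂ, signedSum n (fun k => ∑ i, ∑ j, f i j k) =
      ∑ i, ∑ j, signedSum n (f i j) := by
    intro f
    simp only [signedSum]
    split_ifs
    · rw [Finset.sum_comm]
      exact Finset.sum_congr rfl fun i _ => Finset.sum_comm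
    · simp only [Finset.sum_neg_distrib]
      rw [Finset.sum_comm]
      exact congrArg _ (Finset.sum_congr rfl fun i _ => Finset.sum_comm)
  have hmul : ∀ (c : ℂ) (f : ℤ → ℂ), (signedSum n fun k => c * f k) = c * signedSum n f := by
    intro c f
    simp only [signedSum]
    split_ifs
    · rw [Finset.mul_sum]
    · rw [mul_neg, Finset.mul_sum]
  -- For i = j both quotients are 0 by the convention x / 0 = 0, and the left side is (n - 1) z^n +
  -- 2 z^n.
  have hpair : ∀ i j, signedSum n (fun k => z i ^ k * z j ^ (n - k)) + z i ^ n + z j ^ n =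
      z j ^ n * z j / (z j - z i) + z i ^ n * z i / (z i - z j) +
        if i = j then (n + 1) * z j ^ n else 0 := by
    intro i j
    rcases eq_or_ne i j with rfl | hij
    · have : (fun k : ℤ => z i ^ k * z i ^ (n - k)) = fun _ => z i ^ n := by
        funext k
        rw [← zpow_add₀ (hz i)]; congr 1; ring
      rw [this, signedSum_const]
      simp; ring
    · have h1 := signedSum_zpow_mul (hz i) (hz j) n
      have h2 : z j - z i ≠ 0 := sub_ne_zero.2 (hne j i hij.symm)
      rw [if_neg hij, add_zero, show z i - z j = -(z j - z i) by ring, div_neg, ← sub_eq_add_neg,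
        ← sub_div, eq_div_iff h2, ← zpow_add_one₀ (hz j), ← zpow_add_one₀ (hz i), mul_comm, h1]
  have e1 : signedSum n (fun k => (∑ i, γ i * z i ^ k) * ∑ i, γ i * z i ^ (n - k)) =
      ∑ i, ∑ j, γ i * γ j * signedSum n (fun k => z i ^ k * z j ^ (n - k)) := by
    simp only [Finset.sum_mul_sum, ← hmul]
    rw [← hsum]
    congr 1
    funext k
    exact Finset.sum_congr rfl fun i _ => Finset.sum_congr rfl fun j _ => by ring
  have e2 : (∑ i, γ i * z i ^ n) * ∑ i, γ i = ∑ i, ∑ j, γ i * γ j * z i ^ n := by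
    rw [Finset.sum_mul_sum]
    exact Finset.sum_congr rfl fun i _ => Finset.sum_congr rfl fun j _ => by ring
  have e3 : (∑ i, γ i * z i ^ n) * ∑ i, γ i = ∑ i, ∑ j, γ i * γ j * z j ^ n := by
    rw [mul_comm, Finset.sum_mul_sum]
    exact Finset.sum_congr rfl fun i _ => Finset.sum_congr rfl fun j _ => by ring
  have e4 : ∑ i, ∑ j, γ i * γ j * (signedSum n (fun k => z i ^ k * z j ^ (n - k)) +
      z i ^ n + z j ^ n) = ∑ i, ∑ j, (γ i * γ j * (z j ^ n * z j / (z j - z i)) +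
        γ i * γ j * (z i ^ n * z i / (z i - z j)) +
        if i = j then γ i * γ j * ((n + 1) * z j ^ n) else 0) := by
    refine Finset.sum_congr rfl fun i _ => Finset.sum_congr rfl fun j _ => ?_
    rw [hpair]
    split_ifs <;> ring
  have e5 : ∑ i, ∑ j, γ i * γ j * (z j ^ n * z j / (z j - z i)) =
      ∑ j, z j ^ n * ∑ i, γ i * γ j * z j / (z j - z i) := by
    rw [Finset.sum_comm]
    refine Finset.sum_congr rfl fun j _ => ?_
    rw [Finset.mul_sum]
    exact Finset.sum_congr rfl fun i _ => by ring
  have e6 : ∑ i, ∑ j, γ i * γ j * (z i ^ n * z i / (z i - z j)) =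
      ∑ j, z j ^ n * ∑ i, γ i * γ j * z j / (z j - z i) := by
    refine Finset.sum_congr rfl fun j _ => ?_
    rw [Finset.mul_sum]
    exact Finset.sum_congr rfl fun i _ => by ring
  have e7 : ∑ i, ∑ j, (if i = j then γ i * γ j * ((n + 1) * z j ^ n) else 0) =
      2 * ∑ j, z j ^ n * ((n + 1) * (γ j ^ 2 / 2)) := by
    rw [Finset.mul_sum]
    refine Finset.sum_congr rfl fun i _ => ?_
    rw [Finset.sum_ite_eq, if_pos (Finset.mem_univ i)]
    ring
  simp only [mul_add, Finset.sum_add_distrib] at e4 e7 ⊢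
  rw [e5, e6] at e4
  linear_combination (1 / 2) * e1 + (1 / 2) * e2 + (1 / 2) * e3 + (1 / 2) * e4 + (1 / 2) * e7

/-! ### Derivatives of logarithm branches and of the prefactor -/

/-- A branch is only assumed continuous. Near t, however, ℓ(p w) - ℓ(p t) has imaginary part in (-π,
π), so it is the principal logarithm of f(p w)/f(p t). The map p is a slice on which a single z_j
varies. -/
theorem IsLogBranch.hasDerivAt {X : Type*} [TopologicalSpace X] {U : Set X} {f ℓ : X → ℂ}
    (h : IsLogBranch U f ℓ) (hU : IsOpen U) {p : ℂ → X} {t f' : ℂ} (hp : ContinuousAt p t)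
    (ht : p t ∈ U) (hf : HasDerivAt (fun w => f (p w)) f' t) :
    HasDerivAt (fun w => ℓ (p w)) (f' / f (p t)) t := by
  have hf0 : f (p t) ≠ 0 := by rw [← h.2 _ ht]; exact Complex.exp_ne_zero _
  have hc : ContinuousAt (fun w => ℓ (p w) - ℓ (p t)) t :=
    ((h.1.continuousAt (hU.mem_nhds ht)).comp hp).sub continuousAt_const
  have him : ∀ᶠ w in 𝓝 t, |(ℓ (p w) - ℓ (p t)).im| < Real.pi := by
    have : ContinuousAt (fun w => |(ℓ (p w) - ℓ (p t)).im|) t :=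
      (Complex.continuous_im.continuousAt.comp hc).abs
    refine this.eventually_lt_const ?_
    simpa using Real.pi_pos
  have hlog : HasDerivAt (fun w => ℓ (p t) + Complex.log (f (p w) / f (p t))) (f' / f (p t)) t := by
    have h1 := (hf.div_const (f (p t))).clog (by rw [div_self hf0]; exact Complex.one_mem_slitPlane)
    rw [div_self hf0, div_one] at h1
    exact h1.const_add _
  refine hlog.congr_of_eventuallyEq ?_
  filter_upwards [him, hp.eventually (hU.mem_nhds ht)] with w hw hwU
  rw [← h.2 _ hwU, ← h.2 _ ht, ← Complex.exp_sub, Complex.log_exp]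
  · ring
  · exact (abs_lt.1 hw).1
  · exact (abs_lt.1 hw).2.le

theorem prefactor_eq_exp {r : ℕ} (lam : ℂ) (γ : Fin r → ℂ) (d : Fin r → Fin r → ℂ)
    (ℓ : Fin r → ℂ) : prefactor lam γ d ℓ =
      Complex.exp (∑ i, ∑ j ∈ Finset.Ioi i, γ i * γ j * d i j + ∑ i, lam * γ i * ℓ i) := by
  rw [prefactor, Complex.exp_add, Complex.exp_sum, Complex.exp_sum]
  simp only [Complex.exp_sum]

theorem hasDerivAt_prefactor {r : ℕ} (lam : ℂ) (γ : Fin r → ℂ) {U : Set (Fin r → ℂ)}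
    (hU : IsOpen U) {d : (Fin r → ℂ) → Fin r → Fin r → ℂ} {ℓ : (Fin r → ℂ) → Fin r → ℂ}
    (hd : ∀ i j, i < j → IsLogBranch U (fun z => z i - z j) (fun z => d z i j))
    (hℓ : ∀ i, IsLogBranch U (fun z => z i) (fun z => ℓ z i)) {z : Fin r → ℂ} (hz : z ∈ U)
    (j : Fin r) : ∃ c' : ℂ,
      HasDerivAt (fun w => prefactor lam γ (d (Function.update z j w)) (ℓ (Function.update z j w)))
        c' (z j) ∧
      z j * c' = (∑ i, γ i * γ j * z j / (z j - z i) + lam * γ j) * prefactor lam γ (d z) (ℓ z) := by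
  have hself : Function.update z j (z j) = z := Function.update_eq_self j z
  have hp : ContinuousAt (fun w => Function.update z j w) (z j) := by fun_prop
  have hzU : Function.update z j (z j) ∈ U := by rwa [hself]
  have hup : ∀ i, HasDerivAt (fun w => Function.update z j w i) (if i = j then 1 else 0) (z j) := by
    intro i
    rcases eq_or_ne i j with rfl | hi
    · simp only [Function.update_self, if_true]
      exact hasDerivAt_id _
    · simp only [Function.update_of_ne hi, if_neg hi]
      exact hasDerivAt_const _ _
  have hz0 : ∀ i, z i ≠ 0 := fun i => by
    have := (hℓ i).2 z hz
    simp only at this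
    rw [← this]; exact Complex.exp_ne_zero _
  have h1 : ∀ i, ∀ k ∈ Finset.Ioi i, HasDerivAt (fun w => γ i * γ k * d (Function.update z j w) i k)
      (γ i * γ k * (((if i = j then 1 else 0) - if k = j then 1 else 0) / (z i - z k))) (z j) := by
    intro i k hik
    have := ((hd i k (Finset.mem_Ioi.1 hik)).hasDerivAt hU hp hzU ((hup i).fun_sub (hup k)))
    rw [hself] at this
    exact this.const_mul _
  have h2 : ∀ i, HasDerivAt (fun w => lam * γ i * ℓ (Function.update z j w) i)
      (lam * γ i * ((if i = j then 1 else 0) / z i)) (z j) := by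
    intro i
    have := (hℓ i).hasDerivAt hU hp hzU (hup i)
    rw [hself] at this
    exact this.const_mul _
  have h3 := ((HasDerivAt.fun_sum fun i (_ : i ∈ Finset.univ) =>
    HasDerivAt.fun_sum (h1 i)).fun_add (HasDerivAt.fun_sum fun i (_ : i ∈ Finset.univ) => h2 i)).cexp
  simp only [← prefactor_eq_exp, hself] at h3
  refine ⟨_, h3, ?_⟩
  rw [mul_comm (prefactor _ _ _ _), ← mul_assoc]
  congr 1
  have e1 : ∑ i, lam * γ i * ((if i = j then (1 : ℂ) else 0) / z i) = lam * γ j / z j := by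
    rw [Finset.sum_eq_single j (fun i _ hi => by simp [hi]) (by simp)]
    simp [div_eq_mul_inv]
  have e2 : ∑ i, ∑ k ∈ Finset.Ioi i, γ i * γ k *
      (((if i = j then (1 : ℂ) else 0) - if k = j then 1 else 0) / (z i - z k)) =
      ∑ i, γ i * γ j / (z j - z i) := by
    -- A factor involves z_j as its first or as its second index; both cases contribute the same
    -- expression γ_i γ_j/(z_j - z_i), and i = j contributes 0 as a quotient by 0.
    have e3 : ∀ i k, γ i * γ k *
      (((if i = j then (1 : ℂ) else 0) - if k = j then 1 else 0) / (z i - z k)) =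
        (if i = j then γ i * γ k / (z i - z k) else 0) +
          if k = j then γ i * γ k / (z k - z i) else 0 := by
      intro i k
      rw [← neg_sub (z i) (z k), div_neg]
      split_ifs <;> ring
    have eA : ∑ i, ∑ k ∈ Finset.Ioi i, (if i = j then γ i * γ k / (z i - z k) else 0) =
        ∑ i, if j < i then γ i * γ j / (z j - z i) else 0 := by
      rw [Finset.sum_eq_single j (fun i _ hi => by simp [hi]) (by simp),
        ← Finset.filter_lt_eq_Ioi, Finset.sum_filter]
      exact Finset.sum_congr rfl fun k _ => by rw [if_pos rfl, mul_comm (γ j)]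
    have eB : ∑ i, ∑ k ∈ Finset.Ioi i, (if k = j then γ i * γ k / (z k - z i) else 0) =
        ∑ i, if i < j then γ i * γ j / (z j - z i) else 0 := by
      refine Finset.sum_congr rfl fun i _ => ?_
      rw [Finset.sum_ite_eq']
      simp only [Finset.mem_Ioi]
    simp only [e3, Finset.sum_add_distrib]
    rw [eA, eB, ← Finset.sum_add_distrib]
    refine Finset.sum_congr rfl fun i _ => ?_
    rcases lt_trichotomy i j with h | rfl | h
    · rw [if_neg h.not_gt, if_pos h, zero_add]
    · simp
    · rw [if_pos h, if_neg h.not_gt, add_zero]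
  rw [e1, e2, mul_add, Finset.mul_sum]
  congr 1
  · exact Finset.sum_congr rfl fun i _ => by ring
  · have := hz0 j
    field_simp

/-! ### Commutators with products of vertex operators -/

theorem theta_multiSeq {r : ℕ} (γ z : Fin r → ℂ) (k : ℤ) :
    theta (multiSeq γ z) (∑ i, γ i) k = ∑ i, γ i * z i ^ k := by
  rw [theta]
  split_ifs with hk
  · simp [hk]
  · have : ((√|(k : ℝ)| : ℝ) : ℂ) ≠ 0 := by
      rw [Complex.ofReal_ne_zero, Real.sqrt_ne_zero']
      simpa using hk
    rw [multiSeq, Finset.mul_sum]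
    exact Finset.sum_congr rfl fun i _ => by field_simp

theorem ev_mode_zero (α β : ℂ) (Ψ : FockSpace α β) : ev (mode α β 0) Ψ = α • Ψ :=
  ev_of_mem (mode α β 0) (x := Ψ) Submodule.mem_top

theorem ev_mode_neg (α α' : ℂ) {β : ℂ} (k : ℕ+) (Ψ : FockSpace α β) :
    ev (mode α β (-(k : ℤ))) Ψ = ev (mode α' β (-(k : ℤ))) (Ψ : FockSpace α' β) := by
  obtain ⟨m, rfl⟩ : ∃ m : ℕ, k = m.succPNat := ⟨k.natPred, by simp⟩
  rfl

theorem tsum_sum_smul {ι κ E : Type*} [Fintype κ] [NormedAddCommGroup E] [NormedSpace ℂ E]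
    (x : ι → E) (a : κ → ι → ℂ) (b c : κ → ℂ) (hs : ∀ i, Summable fun k => a i k • x k) :
    ∑' k, (∑ i, c i * (b i * a i k)) • x k = ∑ i, b i • c i • ∑' k, a i k • x k := by
  have h : ∀ k, (∑ i, c i * (b i * a i k)) • x k = ∑ i, b i • c i • a i k • x k := fun k => by
    rw [Finset.sum_smul]
    exact Finset.sum_congr rfl fun i _ => by module
  simp only [h]
  rw [Summable.tsum_finsetSum fun i _ => ((hs i).const_smul (c i)).const_smul (b i)]
  refine Finset.sum_congr rfl fun i _ => ?_
  rw [tsum_const_smul'', tsum_const_smul'']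

/-- The total charge occurs in the type of the target space; keeping it as a variable g lets the
case r = 1 land literally in `FockSpace (α + γ) β`. -/
theorem virComm_vertexMulti {α β : ℂ} {r : ℕ} {γ : Fin r → ℂ} {g lam : ℂ} (hg : g = ∑ i, γ i)
    {U : Set (Fin r → ℂ)} (hU : IsOpen U) (hU1 : ∀ z ∈ U, ∀ i, ‖z i‖ < 1)
    {d : (Fin r → ℂ) → Fin r → Fin r → ℂ} {ℓ : (Fin r → ℂ) → Fin r → ℂ}
    (hd : ∀ i j, i < j → IsLogBranch U (fun z => z i - z j) (fun z => d z i j))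
    (hℓ : ∀ i, IsLogBranch U (fun z => z i) (fun z => ℓ z i))
    {P : (Fin r → ℂ) → FockSpace α β →ₗ.[ℂ] FockSpace (α + g) β}
    (hP : ∀ z, P z = scaledTranslate α β g (prefactor lam γ (d z) (ℓ z)) (vertexMulti α β γ z))
    {z : Fin r → ℂ} (hz : z ∈ U) (Φ : finiteSpace α β) :
    ∃ D : Fin r → FockSpace (α + g) β,
      (∀ j, HasDerivAt (fun w => ev (P (Function.update z j w)) (Φ : FockSpace α β)) (D j) (z j)) ∧
      ∀ n : ℤ, VirCommDefined n (P z) Φ ∧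
        virComm n (P z) Φ = ∑ j, z j ^ n •
          (z j • D j + (((n : ℂ) + 1) * (γ j ^ 2 / 2) + n * β * γ j) • ev (P z) Φ +
            γ j • (ev (mode (α + g) β 0) (ev (P z) Φ) - (g + lam) • ev (P z) Φ)) := by
  have hz0 : ∀ i, z i ≠ 0 := fun i => by
    have h : Complex.exp (ℓ z i) = z i := (hℓ i).2 z hz
    rw [← h]; exact Complex.exp_ne_zero _
  have hne' : ∀ i j, i < j → z i ≠ z j := fun i j hij => by
    have h : Complex.exp (d z i j) = z i - z j := (hd i j hij).2 z hz
    rw [← sub_ne_zero, ← h]; exact Complex.exp_ne_zero _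
  have hne : ∀ i j, i ≠ j → z i ≠ z j := fun i j hij =>
    hij.lt_or_gt.elim (hne' i j) fun h => (hne' j i h).symm
  have hz1 : ∀ i, 0 < ‖z i‖ ∧ ‖z i‖ < 1 := fun i => ⟨norm_pos_iff.2 (hz0 i), hU1 z hz i⟩
  set hω := summable_multiSeq γ z fun i => (hz1 i).2
  have hR := rapidDecay_vertexF (α := α) (β := β) hω Φ
  choose c' hc' hc using fun j => hasDerivAt_prefactor lam γ hU hd hℓ hz j
  choose D hD hzD using fun j => hasDerivAt_vertexMulti (α := α) (β := β) γ hz1 j Φ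
  set c := prefactor lam γ (d z) (ℓ z) with hcdef
  set X : FockSpace α β := vertexF α β hω Φ with hX
  have hevz : ev (P z) (Φ : FockSpace α β) = c • X := by
    rw [hP, ev_scaledTranslate, ev_vertexMulti fun i => (hz1 i).2]
  refine ⟨fun j => c • D j + c' j • X, fun j => ?_, fun n => ?_⟩
  · have hself : Function.update z j (z j) = z := Function.update_eq_self j z
    have h := (hc' j).fun_smul (hD j)
    rw [hself, ev_vertexMulti fun i => (hz1 i).2] at h
    refine h.congr_of_eventuallyEq (Eventually.of_forall fun w => ?_)
    beta_reduce
    rw [hP]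
    exact ev_scaledTranslate _
  · obtain ⟨h1, h2⟩ := virComm_scaledTranslate (α := α) (β := β) hω g c n Φ
    rw [hevz, ev_mode_zero]
    rw [hP z]
    refine ⟨h1, h2.trans ?_⟩
    have hθ : ∀ k, theta (multiSeq γ z) g k = ∑ i, γ i * z i ^ k := fun k => by
      rw [hg, theta_multiSeq]
    simp only [hθ]
    have hS1 : ∑' k : ℕ+, (∑ i, γ i * z i ^ (n + k)) • ev (mode (α + g) β (-(k : ℤ))) X =
        ∑ j, z j ^ n • γ j • ∑' k : ℕ+, z j ^ (k : ℤ) • ev (mode α β (-(k : ℤ))) X := by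
      simp only [fun (i : Fin r) (k : ℕ+) => zpow_add₀ (hz0 i) n k, ev_mode_neg (α + g) α]
      exact tsum_sum_smul _ _ _ _ fun i => summable_zpow_creation hR (hz1 i).2
    have hS2 : ∑' k : ℕ+, (∑ i, γ i * z i ^ (n - k)) • vertexF α β hω (modeF α β k Φ) =
        ∑ j, z j ^ n • γ j • ∑' k : ℕ+, z j ^ (-(k : ℤ)) • vertexF α β hω (modeF α β k Φ) := by
      simp only [sub_eq_add_neg, fun (i : Fin r) (k : ℕ+) => zpow_add₀ (hz0 i) n (-(k : ℤ))]
      exact tsum_sum_smul _ _ _ _ fun i => summable_smul_annihilation hω (fun k => z i ^ (-k)) Φ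
    rw [hS1, hS2, ← Finset.sum_add_distrib]
    simp only [← smul_add, ← hzD]
    -- λ cancels between the derivative of the prefactor and the last bracket, and g cancels inside
    -- the bracket. What remains is the right side of `half_signedSum_theta` and (nβ + α) θ_n.
    have hterm : ∀ j, z j ^ n • (z j • (c • D j + c' j • X) +
        (((n : ℂ) + 1) * (γ j ^ 2 / 2) + n * β * γ j) • c • X +
        γ j • ((α + g) • c • X - (g + lam) • c • X)) =
        c • (z j ^ n • z j • D j) + (c * (z j ^ n * (∑ i, γ i * γ j * z j / (z j - z i) +
          (n + 1) * (γ j ^ 2 / 2)) + (n * β + α) * (γ j * z j ^ n))) • X := by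
      intro j
      have hcX : (z j * c' j) • X =
          ((∑ i, γ i * γ j * z j / (z j - z i) + lam * γ j) * c) • X := by rw [hc]
      have e : z j ^ n • (z j • (c • D j + c' j • X) +
        (((n : ℂ) + 1) * (γ j ^ 2 / 2) + n * β * γ j) • c • X +
        γ j • ((α + g) • c • X - (g + lam) • c • X)) =
        c • (z j ^ n • z j • D j) + z j ^ n • ((z j * c' j) • X) +
        (z j ^ n * c * (((n : ℂ) + 1) * (γ j ^ 2 / 2) + n * β * γ j + γ j * (α - lam))) • X := by
        module
      rw [e, hcX]
      module
    refine Eq.trans ?_ (Finset.sum_congr rfl fun j _ => (hterm j).symm)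
    have hK := half_signedSum_theta γ z hz0 hne n
    rw [Finset.sum_add_distrib, ← Finset.sum_smul, ← Finset.smul_sum, smul_add, ← Finset.mul_sum,
      Finset.sum_add_distrib, ← hK, ← Finset.mul_sum, ← hg, mul_smul]
    congr 3
    ring

end VertexOp

end

/-! ### The four statements -/

theorem mainTheorem10 (α β : ℂ) :
    -- commutator of the Virasoro operators with a general vertex operator
    (∀ (ω : ℤ → ℂ) (γ : ℂ), Summable (fun k : ℕ+ => (k : ℝ) * ‖ω k‖) →
      ∀ P : FockSpace α β →ₗ.[ℂ] FockSpace (α + γ) β,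
      P = scaledTranslate α β γ 1 (vertexOp α β ω) →
      ∀ Φ ∈ finiteSpace α β,
        (∀ k : ℕ+, ev P Φ ∈ (mode (α + γ) β (-(k : ℤ))).domain ∧
          Φ ∈ (mode α β k).domain ∧ ev (mode α β k) Φ ∈ P.domain) ∧
        ∀ n : ℤ, VirCommDefined n P Φ ∧
          ∃ S₁ S₂ : FockSpace (α + γ) β,
            HasSum (fun k : ℕ+ =>
              theta ω γ (n + k) • ev (mode (α + γ) β (-(k : ℤ))) (ev P Φ)) S₁ ∧
            HasSum (fun k : ℕ+ => theta ω γ (n - k) • ev P (ev (mode α β k) Φ)) S₂ ∧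
            virComm n P Φ = S₁ + S₂ +
              (1 / 2 * signedSum n (fun k => theta ω γ k * theta ω γ (n - k)) +
                theta ω γ n * (α + γ + n * β)) • ev P Φ) ∧
    -- holomorphy and derivatives of the multi-vertex operators
    (∀ (r : ℕ) (γ : Fin r → ℂ), ∀ Φ ∈ finiteSpace α β,
      DifferentiableOn ℂ (fun z : Fin r → ℂ => ev (vertexMulti α β γ z) Φ)
        {z | ∀ i, 0 < ‖z i‖ ∧ ‖z i‖ < 1} ∧
      ∀ z : Fin r → ℂ, (∀ i, 0 < ‖z i‖ ∧ ‖z i‖ < 1) →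
        Φ ∈ (vertexMulti α β γ z).domain ∧
        (∀ k : ℕ+, ev (vertexMulti α β γ z) Φ ∈ (mode α β (-(k : ℤ))).domain ∧
          Φ ∈ (mode α β k).domain ∧ ev (mode α β k) Φ ∈ (vertexMulti α β γ z).domain) ∧
        ∀ j : Fin r, ∃ D S₁ S₂ : FockSpace α β,
          HasDerivAt (fun w => ev (vertexMulti α β γ (Function.update z j w)) Φ) D (z j) ∧
          HasSum (fun k : ℕ+ =>
            z j ^ (k : ℤ) • ev (mode α β (-(k : ℤ))) (ev (vertexMulti α β γ z) Φ)) S₁ ∧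
          HasSum (fun k : ℕ+ =>
            z j ^ (-(k : ℤ)) • ev (vertexMulti α β γ z) (ev (mode α β k) Φ)) S₂ ∧
          z j • D = γ j • S₁ + γ j • S₂) ∧
    -- `T_γ z^{γ(α-β)} V(γ, z)` is a conformal field of weight `γ²/2 + βγ`
    (∀ (γ : ℂ) (U : Set ℂ) (ℓ : ℂ → ℂ), IsOpen U → (∀ z ∈ U, ‖z‖ < 1) →
      IsLogBranch U (fun z => z) ℓ →
      IsConformalField U
        (fun z => scaledTranslate α β γ (Complex.exp (γ * (α - β) * ℓ z)) (vertexSingle α β γ z))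
        (γ ^ 2 / 2 + β * γ)) ∧
    -- commutator of the Virasoro operators with the multi-vertex operators
    (∀ (r : ℕ) (γ : Fin r → ℂ) (lam : ℂ) (U : Set (Fin r → ℂ))
      (d : (Fin r → ℂ) → Fin r → Fin r → ℂ) (ℓ : (Fin r → ℂ) → Fin r → ℂ),
      IsOpen U → (∀ z ∈ U, ∀ i, ‖z i‖ < 1) →
      (∀ i j, i < j → IsLogBranch U (fun z => z i - z j) (fun z => d z i j)) →
      (∀ i, IsLogBranch U (fun z => z i) (fun z => ℓ z i)) →
      ∀ P : (Fin r → ℂ) → FockSpace α β →ₗ.[ℂ] FockSpace (α + ∑ i, γ i) β,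
      (∀ z, P z = scaledTranslate α β (∑ i, γ i) (prefactor lam γ (d z) (ℓ z))
        (vertexMulti α β γ z)) →
      ∀ z ∈ U, ∀ Φ ∈ finiteSpace α β, ∃ D : Fin r → FockSpace (α + ∑ i, γ i) β,
        (∀ j, HasDerivAt (fun w => ev (P (Function.update z j w)) Φ) (D j) (z j)) ∧
        ∀ n : ℤ, VirCommDefined n (P z) Φ ∧
          virComm n (P z) Φ = ∑ j, z j ^ n •
            (z j • D j + (((n : ℂ) + 1) * (γ j ^ 2 / 2) + n * β * γ j) • ev (P z) Φ +
              γ j • (ev (mode (α + ∑ i, γ i) β 0) (ev (P z) Φ) -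
                ((∑ i, γ i) + lam) • ev (P z) Φ))) := by
  refine ⟨fun ω γ hω P hP Φ hΦ => ?_, fun r γ Φ hΦ => ⟨differentiableOn_vertexMulti α β γ ⟨Φ, hΦ⟩,
    fun z hz => ?_⟩, fun γ U ℓ hU hU1 hℓ => ?_, fun r γ lam U d ℓ hU hU1 hd hℓ P hP z hz Φ hΦ => ?_⟩
  · lift Φ to finiteSpace α β using hΦ
    subst hP
    have hR := rapidDecay_vertexF hω Φ
    have hev : ∀ Ψ : finiteSpace α β, ev (scaledTranslate α β γ 1 (vertexOp α β ω)) Ψ =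
        vertexF α β hω Ψ := fun Ψ => by rw [ev_scaledTranslate, one_smul, ev_vertexOp hω]
    refine ⟨fun k => ⟨?_, finiteSpace_le_mode_domain α β k Φ.2, ?_⟩, fun n => ?_⟩
    · rw [hev]
      exact hR.mem_mode_domain (α := α + γ) (β := β) k
    · rw [ev_mode_coe]
      exact finiteSpace_le_vertexOp_domain α β hω (modeF α β k Φ).2
    · obtain ⟨h1, h2⟩ := virComm_scaledTranslate hω γ 1 n Φ
      refine ⟨h1, ∑' k : ℕ+, theta ω γ (n + k) •
          ev (mode (α + γ) β (-(k : ℤ))) (vertexF α β hω Φ),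
        ∑' k : ℕ+, theta ω γ (n - k) • vertexF α β hω (modeF α β k Φ), ?_, ?_, h2.trans ?_⟩
      · rw [hev]
        exact (summable_theta_creation (α := α + γ) (β := β) hω γ n hR).hasSum
      · simp only [ev_mode_coe, hev]
        exact (summable_smul_annihilation hω (fun k => theta ω γ (n - k)) Φ).hasSum
      · rw [one_smul, hev]
  · lift Φ to finiteSpace α β using hΦ
    have hz1 : ∀ i, ‖z i‖ < 1 := fun i => (hz i).2
    have hω := summable_multiSeq γ z hz1
    have hR := rapidDecay_vertexF (α := α) (β := β) hω Φ
    refine ⟨finiteSpace_le_vertexOp_domain α β hω Φ.2, fun k => ⟨?_,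
      finiteSpace_le_mode_domain α β k Φ.2, ?_⟩, fun j => ?_⟩
    · rw [ev_vertexMulti hz1]
      exact hR.mem_mode_domain k
    · rw [ev_mode_coe]
      exact finiteSpace_le_vertexOp_domain α β hω (modeF α β k Φ).2
    · obtain ⟨D, hD, hzD⟩ := hasDerivAt_vertexMulti (α := α) (β := β) γ hz j Φ
      refine ⟨D, _, _, hD, ?_, ?_, hzD⟩
      · rw [ev_vertexMulti hz1]
        exact (summable_zpow_creation hR (hz1 j)).hasSum
      · simp only [ev_mode_coe, ev_vertexMulti hz1]
        exact (summable_smul_annihilation hω (fun k => z j ^ (-k)) Φ).hasSum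
  · intro z hz Φ hΦ
    lift Φ to finiteSpace α β using hΦ
    -- The case r = 1, λ = α - β of the multi-vertex formula. There are no pairs i < j, so the
    -- logarithm of differences is a dummy 0.
    have hP : ∀ w : Fin 1 → ℂ, scaledTranslate α β γ (Complex.exp (γ * (α - β) * ℓ (w 0)))
        (vertexSingle α β γ (w 0)) = scaledTranslate α β γ
          (prefactor (α - β) (fun _ : Fin 1 => γ) (fun _ _ => 0) fun _ => ℓ (w 0))
          (vertexMulti α β (fun _ => γ) w) := by
      intro w
      have h1 : vertexSingle α β γ (w 0) = vertexMulti α β (fun _ => γ) w := by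
        rw [vertexSingle, vertexMulti]
        congr 1
        funext k
        simp [multiSeq]
      have h2 : Complex.exp (γ * (α - β) * ℓ (w 0)) =
          prefactor (α - β) (fun _ : Fin 1 => γ) (fun _ _ => 0) fun _ => ℓ (w 0) := by
        simp [prefactor, mul_comm γ]
      rw [h1, h2]
    have hc : Continuous fun w : Fin 1 → ℂ => w 0 := continuous_apply 0
    obtain ⟨D, hD, hL⟩ := virComm_vertexMulti (α := α) (β := β) (γ := fun _ : Fin 1 => γ) (g := γ)
      (lam := α - β) (by simp) (hU.preimage hc)
      (fun w hw i => by rw [Subsingleton.elim i 0]; exact hU1 _ hw)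
      (fun i j hij => absurd hij (by rw [Subsingleton.elim i j]; exact lt_irrefl j))
      (fun i => ⟨hℓ.1.comp hc.continuousOn fun w hw => hw,
        fun w hw => by rw [Subsingleton.elim i 0]; exact hℓ.2 _ hw⟩) hP
      (z := fun _ => z) hz Φ
    refine ⟨D 0, ?_, fun n => ?_⟩
    · have h := hD 0
      simp only [Function.update_self] at h
      exact h
    · obtain ⟨h1, h2⟩ := hL n
      refine ⟨h1, h2.trans ?_⟩
      rw [Fin.sum_univ_one, ev_mode_zero]
      congr 1
      -- The last bracket gives γ (α + γ - γ - (α - β)) = βγ, which completes nβγ to (n + 1)βγ.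
      module
  · lift Φ to finiteSpace α β using hΦ
    exact virComm_vertexMulti rfl hU hU1 hd hℓ hP hz Φ
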